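/- Let $G$ be a finite group acting freely by diffeomorphisms on the sphere $S^3$, let $V$ be a finite-dimensional real representation of $G$ of dimension $n$, and let $\mathcal A$ be a finite set of linear subspaces of $V$, closed under intersections and mapped to itself by $G$. Write $D(\mathcal A)=\bigcup_{P\in\mathcal A}P$, and assume: (A1) every maximal element of $\mathcal A$ has dimension $n-2$, and $\dim(P\cap Q)\le n-4$ for any two distinct maximal elements $P,Q$ of $\mathcal A$; (A2) $S^3$ and $V$ are oriented, and $G$ preserves both orientations; (A3) each maximal element $P$ of $\mathcal A$ is oriented, in such a way that for every $g\in G$ the isomorphism $g\colon P\to g(P)$ preserves orientations. Let $\Omega_1(G)$ be the group of oriented bordism classes of closed oriented smooth $1$-manifolds with a free, orientation preserving smooth action of $G$, where bordisms are compact oriented smooth surfaces with boundary with a free, orientation preserving smooth action of $G$; its zero element is the class of the empty manifold. For a $G$-equivariant map $f\colon S^3\to V$ put $\Delta(f)=f^{-1}(D(\mathcal A))$. If $f$ is smooth and transverse to every element of $\mathcal A$ (written $f\pitchfork\mathcal A$), then $\Delta(f)$ is a closed $G$-invariant one-dimensional submanifold of $S^3$, the disjoint union of the sets $f^{-1}(P)$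 with $P$ maximal in $\mathcal A$. It is oriented as follows: the derivative of $f$ identifies the normal bundle of $f^{-1}(P)$ with the trivial bundle of fibre $V/P$; $V/P$ is oriented so that $V$ is oriented as $P\oplus V/P$, and $f^{-1}(P)$ is oriented so that $S^3$ is oriented as the sum of the tangent bundle and the normal bundle of $f^{-1}(P)$. Then: 1. For every smooth $G$-equivariant map $f\colon S^3\to V$ with $f\pitchfork\mathcal A$, the oriented $G$-manifold $\Delta(f)$ has a well-defined class $[\Delta(f)]\in\Omega_1(G)$. 2. This class does not depend on $f$: $[\Delta(f)]=[\Delta(f')]$ for any two smooth $G$-equivariant maps $f,f'\colon S^3\to V$ with $f\pitchfork\mathcal A$ and $f'\pitchfork\mathcal A$. 3. Consequently, if $[\Delta(f)]\neq 0$ for one such $f$, then $\Delta(g)\ne\emptyset$ for every continuous $G$-equivariant map $g\colon S^3\to V$, that is, every such map meets $D(\mathcal A)$. -/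

import Mathlib

open scoped Manifold ContDiff Topology

/-- The sign of a family `v` of vectors with respect to an orientation `o`: it is `1` for positively
oriented bases, `-1` for negatively oriented bases and `0` for families that are not bases (when the
index type has as many elements as the dimension). The orientation is a ray of alternating forms,
and the sign does not depend on the form chosen in it (see `orSign_rayOfNeZero`). In dimension zero
the sign of the empty family is the sign of the oriented point. -/
noncomputable def orSign {W ι : Type*} [AddCommGroup W] [Module ℝ W]
    (o : Orientation ℝ W ι) (v : ι → W) : SignType :=
  SignType.sign (o.someVector v)

theorem orSign_rayOfNeZero {W ι : Type*} [AddCommGroup W] [Module ℝ W]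
    (φ : W [⋀^ι]→ₗ[ℝ] ℝ) (hφ : φ ≠ 0) (v : ι → W) :
    orSign (rayOfNeZero ℝ φ hφ) v = SignType.sign (φ v) := by
  unfold orSign
  set o : Orientation ℝ W ι := rayOfNeZero ℝ φ hφ with ho
  have h : rayOfNeZero ℝ _ o.someVector_ne_zero = rayOfNeZero ℝ φ hφ := o.someVector_ray
  obtain ⟨r, hr, h⟩ := ((ray_eq_iff _ _).1 h).exists_pos_left o.someVector_ne_zero hφ
  rw [← h, AlternatingMap.smul_apply, smul_eq_mul, sign_mul, sign_pos hr, one_mul]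

/-- An orientation of a smooth manifold (possibly with boundary): a choice of an orientation of each
tangent space which is locally constant in charts. The map `tangentCoordChange I x x₀ x` is the
isomorphism from the tangent space at `x` to that at `x₀` given by the chart at `x₀`. -/
structure ManifoldOrientation {n : ℕ} {H : Type*} [TopologicalSpace H]
    (I : ModelWithCorners ℝ (EuclideanSpace ℝ (Fin n)) H)
    (M : Type*) [TopologicalSpace M] [ChartedSpace H M] [IsManifold I ∞ M] where
  orient : ∀ x : M, Orientation ℝ (TangentSpace I x) (Fin n)
  locally_constant : ∀ x₀ : M, ∀ᶠ x in 𝓝 x₀, ∀ v : Fin n → TangentSpace I x,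
    orSign (W := TangentSpace I x₀) (orient x₀) (fun i => tangentCoordChange I x x₀ x (v i)) =
      orSign (orient x) v

/-- The action of the group `G` on the manifold `M` is free and by orientation preserving
diffeomorphisms. -/
structure IsFreeOrientedAction (G : Type*) [Group G] {n : ℕ} {H : Type*} [TopologicalSpace H]
    (I : ModelWithCorners ℝ (EuclideanSpace ℝ (Fin n)) H)
    {M : Type*} [TopologicalSpace M] [ChartedSpace H M] [IsManifold I ∞ M] [MulAction G M]
    (o : ManifoldOrientation I M) : Prop where
  smooth : ∀ g : G, ContMDiff I I ∞ (fun x : M => g • x)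
  free : ∀ (g : G) (x : M), g • x = x → g = 1
  preserves : ∀ (g : G) (x : M) (v : Fin n → TangentSpace I x),
    orSign (o.orient (g • x)) (fun i => mfderiv I I (fun y : M => g • y) x (v i)) =
      orSign (o.orient x) v

/-- Compact oriented smooth manifolds with a free orientation preserving smooth action of `G`,
modelled on `I`. They are closed manifolds if `I = 𝓡 n`, and have a boundary in general
if `I = 𝓡∂ n`. -/
structure OrientedGManifold (G : Type*) [Group G] {n : ℕ} {H : Type} [TopologicalSpace H]
    (I : ModelWithCorners ℝ (EuclideanSpace ℝ (Fin n)) H) where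
  carrier : Type
  [topologicalSpace : TopologicalSpace carrier]
  [t2Space : T2Space carrier]
  [compactSpace : CompactSpace carrier]
  [chartedSpace : ChartedSpace H carrier]
  [isManifold : IsManifold I ∞ carrier]
  [mulAction : MulAction G carrier]
  orientation : ManifoldOrientation I carrier
  isFreeOrientedAction : IsFreeOrientedAction G I orientation

attribute [instance] OrientedGManifold.topologicalSpace OrientedGManifold.t2Space
  OrientedGManifold.compactSpace OrientedGManifold.chartedSpace OrientedGManifold.isManifold
  OrientedGManifold.mulAction

/-- `W` is an oriented `G`-bordism from `M` to `N`: its boundary is identified, through the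
equivariant maps `i` and `j`, with the disjoint union of `N` and of `M` with reversed orientation.
The boundary is oriented by the outward normal first convention. The tangent space of `W` at a
point `p` is identified with the model space `ℝ²` by the preferred chart at `p`, which takes values
in the half-plane `{w | 0 ≤ w 0}`, so that at a boundary point the outward vectors are
those with `w 0 < 0`. -/
structure IsOrientedGBordism {G : Type*} [Group G] (M N : OrientedGManifold G (𝓡 1))
    (W : OrientedGManifold G (𝓡∂ 2)) (i : M.carrier → W.carrier) (j : N.carrier → W.carrier) :
    Prop where
  smooth_left : ContMDiff (𝓡 1) (𝓡∂ 2) ∞ i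
  smooth_right : ContMDiff (𝓡 1) (𝓡∂ 2) ∞ j
  equivariant_left : ∀ (g : G) (x : M.carrier), i (g • x) = g • i x
  equivariant_right : ∀ (g : G) (y : N.carrier), j (g • y) = g • j y
  injective_left : Function.Injective i
  injective_right : Function.Injective j
  disjoint : Disjoint (Set.range i) (Set.range j)
  boundary_eq : (𝓡∂ 2).boundary W.carrier = Set.range i ∪ Set.range j
  oriented_left : ∀ (x : M.carrier) (w : EuclideanSpace ℝ (Fin 2)), w 0 < 0 →
    ∀ t : TangentSpace (𝓡 1) x,
      orSign (W := TangentSpace (𝓡∂ 2) (i x)) (W.orientation.orient (i x))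
        ![w, mfderiv (𝓡 1) (𝓡∂ 2) i x t] = - orSign (M.orientation.orient x) ![t]
  oriented_right : ∀ (y : N.carrier) (w : EuclideanSpace ℝ (Fin 2)), w 0 < 0 →
    ∀ t : TangentSpace (𝓡 1) y,
      orSign (W := TangentSpace (𝓡∂ 2) (j y)) (W.orientation.orient (j y))
        ![w, mfderiv (𝓡 1) (𝓡∂ 2) j y t] = orSign (N.orientation.orient y) ![t]

/-- Two closed oriented free `G`-manifolds of dimension one are `G`-bordant. -/
def GBordant {G : Type*} [Group G] (M N : OrientedGManifold G (𝓡 1)) : Prop :=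
  ∃ (W : OrientedGManifold G (𝓡∂ 2)) (i : M.carrier → W.carrier) (j : N.carrier → W.carrier),
    IsOrientedGBordism M N W i j

/-- The set `Ω₁(G)` of bordism classes of closed oriented one-dimensional free `G`-manifolds
(bordism being an equivalence relation, `Quot` is the set of its classes). -/
def Omega1 (G : Type*) [Group G] : Type _ := Quot (GBordant (G := G))

/-- The bordism class of a closed oriented one-dimensional free `G`-manifold. -/
def OrientedGManifold.bordismClass {G : Type*} [Group G] (M : OrientedGManifold G (𝓡 1)) :
    Omega1 G :=
  Quot.mk _ M

/-- The empty one-dimensional manifold. -/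
noncomputable def OrientedGManifold.empty (G : Type*) [Group G] : OrientedGManifold G (𝓡 1) :=
  letI : ChartedSpace (EuclideanSpace ℝ (Fin 1)) Empty := ChartedSpace.empty _ _
  letI : MulAction G Empty :=
    { smul := fun _ x => x, one_smul := fun x => x.elim, mul_smul := fun _ _ x => x.elim }
  haveI : IsManifold (𝓡 1) ∞ Empty := IsManifold.empty _
  { carrier := Empty
    orientation := ⟨fun x => x.elim, fun x => x.elim⟩
    isFreeOrientedAction := ⟨fun _ x => x.elim, fun _ x => x.elim, fun _ x => x.elim⟩ }

/-- The zero element of `Ω₁(G)` is the class of the empty manifold. -/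
noncomputable instance Omega1.instZero (G : Type*) [Group G] : Zero (Omega1 G) :=
  ⟨(OrientedGManifold.empty G).bordismClass⟩

/-- The unit sphere `S³` in `ℝ⁴`. -/
abbrev Sphere3 : Type := Metric.sphere (0 : EuclideanSpace ℝ (Fin (3 + 1))) 1

/-- A `G`-invariant linear subspace arrangement: a finite family of linear subspaces, closed under
intersections and mapped to itself by `G`. -/
structure IsInvariantArrangement {G V : Type*} [Group G] [AddCommGroup V] [Module ℝ V]
    (ρ : Representation ℝ G V) (A : Set (Submodule ℝ V)) : Prop where
  finite : A.Finite
  inf_mem : ∀ P ∈ A, ∀ Q ∈ A, P ⊓ Q ∈ A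
  map_mem : ∀ (g : G), ∀ P ∈ A, P.map (ρ g) ∈ A

/-- The maximal elements of the arrangement have codimension two, and any two distinct ones
intersect in a subspace of codimension at least four. -/
structure HasCodimTwoMaximalElements {V : Type*} [AddCommGroup V] [Module ℝ V]
    (A : Set (Submodule ℝ V)) : Prop where
  finrank_maximal : ∀ P, Maximal (· ∈ A) P → Module.finrank ℝ P + 2 = Module.finrank ℝ V
  finrank_inf : ∀ P Q, Maximal (· ∈ A) P → Maximal (· ∈ A) Q → P ≠ Q →
    Module.finrank ℝ (P ⊓ Q : Submodule ℝ V) + 4 ≤ Module.finrank ℝ V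

/-- The representation preserves the orientation `oV` of `V`. -/
def PreservesOrientation {G V : Type*} [Group G] [AddCommGroup V] [Module ℝ V]
    (ρ : Representation ℝ G V) (oV : Orientation ℝ V (Fin (Module.finrank ℝ V))) : Prop :=
  ∀ (g : G) (v : Fin (Module.finrank ℝ V) → V), orSign oV (fun i => ρ g (v i)) = orSign oV v

/-- The orientations `oA` of the maximal elements of the arrangement are compatible with the action:
`g` maps a basis of `P` to a basis of `g(P)` with the same sign. (The equality `h` of dimensions
always holds, as `g` is invertible.) -/
def CompatibleOrientations {G V : Type*} [Group G] [AddCommGroup V] [Module ℝ V]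
    (ρ : Representation ℝ G V) (A : Set (Submodule ℝ V))
    (oA : ∀ P : Submodule ℝ V, Orientation ℝ P (Fin (Module.finrank ℝ P))) : Prop :=
  ∀ (g : G) (P : Submodule ℝ V), Maximal (· ∈ A) P →
    ∀ (h : Module.finrank ℝ (P.map (ρ g)) = Module.finrank ℝ P)
      (p : Fin (Module.finrank ℝ P) → P),
      orSign (oA (P.map (ρ g)))
        (fun i => ⟨ρ g (p (Fin.cast h i)), Submodule.mem_map_of_mem (p (Fin.cast h i)).2⟩) =
        orSign (oA P) p

/-- The singular set `Δ(f)`: the preimage of the union of the arrangement. -/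
def singularSet {V X : Type*} [AddCommGroup V] [Module ℝ V] (A : Set (Submodule ℝ V))
    (f : X → V) : Set X :=
  {x | ∃ P ∈ A, f x ∈ P}

/-- The differential at `x` of a map from `S³` to a vector space. -/
noncomputable def sphereDifferential {V : Type*} [NormedAddCommGroup V] [NormedSpace ℝ V]
    (f : Sphere3 → V) (x : Sphere3) : TangentSpace (𝓡 3) x →L[ℝ] V :=
  mfderiv (𝓡 3) 𝓘(ℝ, V) f x

/-- Smooth `G`-equivariant maps `S³ → V` that are transverse to every element of `A`. -/
structure IsTransverseGMap {G V : Type*} [Group G] [MulAction G Sphere3]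
    [NormedAddCommGroup V] [NormedSpace ℝ V]
    (ρ : Representation ℝ G V) (A : Set (Submodule ℝ V)) (f : Sphere3 → V) : Prop where
  smooth : ContMDiff (𝓡 3) 𝓘(ℝ, V) ∞ f
  equivariant : ∀ (g : G) (x : Sphere3), f (g • x) = ρ g (f x)
  transverse : ∀ P ∈ A, ∀ x : Sphere3, f x ∈ P → ∀ v : V,
    ∃ u : TangentSpace (𝓡 3) x, ∃ p ∈ P, sphereDifferential f x u + p = v

/-- The embedding `e` identifies the closed oriented free `G`-manifold `M` with the singular
set `Δ(f)`, oriented by the orientations of `S³`, of `V` and of the maximal elements of `A`.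

At a point of `f⁻¹(P)`, with `P` maximal in `A`, the derivative of `f` identifies the normal space
of `f⁻¹(P)` with `V / P`. The quotient is oriented in such a way that `V` is oriented as
`P ⊕ V / P`, and `f⁻¹(P)` is oriented in such a way that `S³` is oriented as the sum of the
tangent space of `f⁻¹(P)` and of its normal space. -/
structure IsOrientedSingularSet {G V : Type*} [Group G] [MulAction G Sphere3]
    [NormedAddCommGroup V] [NormedSpace ℝ V] (A : Set (Submodule ℝ V))
    (oS : ManifoldOrientation (𝓡 3) Sphere3)
    (oV : Orientation ℝ V (Fin (Module.finrank ℝ V)))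
    (oA : ∀ P : Submodule ℝ V, Orientation ℝ P (Fin (Module.finrank ℝ P)))
    (f : Sphere3 → V) (M : OrientedGManifold G (𝓡 1)) (e : M.carrier → Sphere3) : Prop where
  smooth : ContMDiff (𝓡 1) (𝓡 3) ∞ e
  immersion : ∀ x, Function.Injective (mfderiv (𝓡 1) (𝓡 3) e x)
  injective : Function.Injective e
  equivariant : ∀ (g : G) (x : M.carrier), e (g • x) = g • e x
  range_eq : Set.range e = singularSet A f
  oriented : ∀ (P : Submodule ℝ V), Maximal (· ∈ A) P →
    ∀ (h : Module.finrank ℝ V = Module.finrank ℝ P + 2) (x : M.carrier), f (e x) ∈ P →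
    ∀ (p : Module.Basis (Fin (Module.finrank ℝ P)) ℝ P) (t : TangentSpace (𝓡 1) x)
      (a b : TangentSpace (𝓡 3) (e x)),
      orSign (oS.orient (e x)) ![mfderiv (𝓡 1) (𝓡 3) e x t, a, b] =
        orSign (M.orientation.orient x) ![t] *
          (orSign (oA P) p *
            orSign oV (Fin.append (fun i => (p i : V))
              ![sphereDifferential f (e x) a, sphereDifferential f (e x) b] ∘ Fin.cast h))

/-- `c` is the class `[Δ(f)]` in `Ω₁(G)` of the oriented singular set of `f`. -/
def IsSingularClass {G V : Type*} [Group G] [MulAction G Sphere3]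
    [NormedAddCommGroup V] [NormedSpace ℝ V] (A : Set (Submodule ℝ V))
    (oS : ManifoldOrientation (𝓡 3) Sphere3)
    (oV : Orientation ℝ V (Fin (Module.finrank ℝ V)))
    (oA : ∀ P : Submodule ℝ V, Orientation ℝ P (Fin (Module.finrank ℝ P)))
    (f : Sphere3 → V) (c : Omega1 G) : Prop :=
  ∃ (M : OrientedGManifold G (𝓡 1)) (e : M.carrier → Sphere3),
    IsOrientedSingularSet A oS oV oA f M e ∧ M.bordismClass = c

/-! A maximal element `P` is the kernel of a linear surjection `π_P : V → ℝ²`. The orientation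
hypotheses (A2) and (A3) allow these surjections to be chosen so that `G` permutes them up to maps
of `ℝ²` of positive determinant (`exists_arrangementEquations`). Hence `Δ(f)` is the union of the
zero sets of the maps `π_P ∘ f` on `S³`. Transversality makes these zeros regular, and it makes the
zero sets disjoint: `P ⊓ Q` has codimension at least four, so a map from a 3-manifold transverse to
it must miss it (`eq_of_map_eq_zero`).

Two transverse maps are joined by `(1 - t) f + t f' + t (1 - t) (u + t w)` with `u`, `w` smooth and
equivariant. The ends do not move, and for generic `u`, `w` the zeros of every `π_P` on the homotopy
are regular for `0 < t < 1` (`exists_generic_homotopy`). Genericity is a dimension count: the bad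
parameters lie in finitely many `C¹` images of sets of smaller dimension (`dimH_degenerate_le`).
Freeness of the action lets bump functions be disjoint from their translates, so local perturbations
can be summed over `G` without interfering.

In `[0, 1] × S³`, of dimension four, zero sets belonging to different `P` may meet. The bordism is
therefore their disjoint union, in which the index of the equation is remembered
(`LevelSystem.zeroSet`). Over `t = 0` and `t = 1` it restricts to `Δ(f)` and `Δ(f')`
(`gBordant_of_isOrientedSingularSet`). Curves and surfaces come from the same construction
`LevelSystem.exists_orientedGManifold`, with a point or an interval of parameters; orientations are
signs of ambient determinants compared with the differential of the equations.

For the last statement, a continuous equivariant map missing `D(𝒜)` has, by compactness, a smooth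
equivariant approximation that also misses it. This approximation is vacuously transverse with empty
singular set, so the common class is zero. -/

/-! ### Alternating forms of top degree and signs of frames. -/

section TopForms

variable {E K : Type*} [AddCommGroup E] [Module ℝ E] [AddCommGroup K] [Module ℝ K]

/-- A nonzero form of top degree vanishes exactly on the linearly dependent families. -/
theorem topForm_ne_zero_iff {n : ℕ} [FiniteDimensional ℝ E] (hn : Module.finrank ℝ E = n)
    {φ : E [⋀^Fin n]→ₗ[ℝ] ℝ} (hφ : φ ≠ 0) (v : Fin n → E) :
    φ v ≠ 0 ↔ LinearIndependent ℝ v := by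
  constructor
  · intro h
    by_contra hv
    exact h (φ.map_linearDependent v hv)
  · intro hv h0
    let b := basisOfLinearIndependentOfCardEqFinrank' v hv (by simp [hn])
    apply hφ
    have := φ.eq_smul_basis_det b
    rw [this]
    simp [b, h0]

/-- The space of top forms is a line; the identity is written without division so that it passes
directly to signs. -/
theorem topForm_proportional {n : ℕ} [FiniteDimensional ℝ E] (hn : Module.finrank ℝ E = n)
    (φ ψ : E [⋀^Fin n]→ₗ[ℝ] ℝ) (v w : Fin n → E) : φ v * ψ w = φ w * ψ v := by
  let b := Module.finBasisOfFinrankEq ℝ E hn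
  rw [φ.eq_smul_basis_det b, ψ.eq_smul_basis_det b]
  simp only [AlternatingMap.smul_apply, smul_eq_mul]
  ring

theorem SignType.mul_self_of_ne_zero {s : SignType} (h : s ≠ 0) : s * s = 1 := by
  revert s; decide

theorem orSign_ne_zero_iff {n : ℕ} [FiniteDimensional ℝ E] (hn : Module.finrank ℝ E = n)
    (o : Orientation ℝ E (Fin n)) (v : Fin n → E) :
    orSign o v ≠ 0 ↔ LinearIndependent ℝ v := by
  rw [orSign, Ne, sign_eq_zero_iff]
  exact topForm_ne_zero_iff hn o.someVector_ne_zero v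

/-- Proportionality of top forms leaves a single sign, read off on a basis. Later comparisons of
orientations become identities between such signs, often settled by a finite check over `SignType`.
-/
theorem exists_orSign_eq {n : ℕ} [FiniteDimensional ℝ E] (hn : Module.finrank ℝ E = n)
    (o : Orientation ℝ E (Fin n)) {φ : E [⋀^Fin n]→ₗ[ℝ] ℝ} (hφ : φ ≠ 0) :
    ∃ s : SignType, s ≠ 0 ∧ ∀ v, orSign o v = s * SignType.sign (φ v) := by
  let b := Module.finBasisOfFinrankEq ℝ E hn
  have h1 : φ b ≠ 0 := (topForm_ne_zero_iff hn hφ b).2 b.linearIndependent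
  have h2 : o.someVector b ≠ 0 :=
    (topForm_ne_zero_iff hn o.someVector_ne_zero b).2 b.linearIndependent
  refine ⟨SignType.sign (o.someVector b) * SignType.sign (φ b), ?_, fun v => ?_⟩
  · rw [← sign_mul, Ne, sign_eq_zero_iff]
    exact mul_ne_zero h2 h1
  · rw [orSign, ← sign_mul, ← sign_mul]
    have h3 := topForm_proportional hn o.someVector φ b v
    have : o.someVector b * φ b * φ v = (φ b * φ b) * o.someVector v := by
      rw [mul_assoc, mul_comm (φ b), ← mul_assoc, h3]; ring
    rw [this, sign_mul, sign_pos (mul_self_pos.2 h1), one_mul]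

/-- A nonzero form of top degree on the source and a linear automorphism. -/
theorem topForm_comp {n : ℕ} [FiniteDimensional ℝ E] (hn : Module.finrank ℝ E = n)
    (φ : E [⋀^Fin n]→ₗ[ℝ] ℝ) (A : E →ₗ[ℝ] E) (v : Fin n → E) :
    φ (fun i => A (v i)) = LinearMap.det A * φ v := by
  let b := Module.finBasisOfFinrankEq ℝ E hn
  rw [φ.eq_smul_basis_det b]
  simp only [AlternatingMap.smul_apply, smul_eq_mul]
  have : (fun i => A (v i)) = A ∘ v := rfl
  rw [this, Module.Basis.det_comp]
  ring

theorem fin_append_update_left {α : Type*} {d m : ℕ} (v : Fin d → α) (a : Fin m → α) (i : Fin d)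
    (x : α) : Fin.append (Function.update v i x) a =
      Function.update (Fin.append v a) (Fin.castAdd m i) x := by
  ext j
  refine Fin.addCases (fun j => ?_) (fun j => ?_) j
  · by_cases h : j = i
    · subst h; simp
    · rw [Fin.append_left, Function.update_of_ne h, Function.update_of_ne, Fin.append_left]
      simpa using h
  · rw [Fin.append_right, Function.update_of_ne, Fin.append_right]
    intro h
    have := congrArg Fin.val h
    simp at this
    omega

theorem fin_append_update_right {α : Type*} {d m : ℕ} (v : Fin d → α) (a : Fin m → α) (i : Fin m)
    (x : α) : Fin.append v (Function.update a i x) =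
      Function.update (Fin.append v a) (Fin.natAdd d i) x := by
  ext j
  refine Fin.addCases (fun j => ?_) (fun j => ?_) j
  · rw [Fin.append_left, Function.update_of_ne, Fin.append_left]
    intro h
    have := congrArg Fin.val h
    simp at this
    omega
  · by_cases h : j = i
    · subst h; simp
    · rw [Fin.append_right, Function.update_of_ne h, Function.update_of_ne, Fin.append_right]
      simpa using h

/-- The form in the first arguments obtained by fixing the last ones. -/
def AlternatingMap.fixRight {d m : ℕ} (Ω : E [⋀^Fin (d + m)]→ₗ[ℝ] ℝ) (a : Fin m → E) :
    E [⋀^Fin d]→ₗ[ℝ] ℝ where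
  toFun v := Ω (Fin.append v a)
  map_update_add' := by
    intro h v i x y
    have : h = instDecidableEqFin d := Subsingleton.elim _ _
    subst this
    simp only [fin_append_update_left, Ω.map_update_add]
  map_update_smul' := by
    intro h v i c x
    have : h = instDecidableEqFin d := Subsingleton.elim _ _
    subst this
    simp only [fin_append_update_left, Ω.map_update_smul]
  map_eq_zero_of_eq' := by
    intro v i j hij hne
    refine Ω.map_eq_zero_of_eq _ (i := Fin.castAdd m i) (j := Fin.castAdd m j)
      (by simpa using hij) ?_
    simpa using hne

/-- The form in the last arguments obtained by fixing the first ones. -/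
def AlternatingMap.fixLeft {d m : ℕ} (Ω : E [⋀^Fin (d + m)]→ₗ[ℝ] ℝ) (v : Fin d → E) :
    E [⋀^Fin m]→ₗ[ℝ] ℝ where
  toFun a := Ω (Fin.append v a)
  map_update_add' := by
    intro h a i x y
    have : h = instDecidableEqFin m := Subsingleton.elim _ _
    subst this
    simp only [fin_append_update_right, Ω.map_update_add]
  map_update_smul' := by
    intro h a i c x
    have : h = instDecidableEqFin m := Subsingleton.elim _ _
    subst this
    simp only [fin_append_update_right, Ω.map_update_smul]
  map_eq_zero_of_eq' := by
    intro a i j hij hne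
    refine Ω.map_eq_zero_of_eq _ (i := Fin.natAdd d i) (j := Fin.natAdd d j) (by simpa using hij) ?_
    simpa using hne

@[simp] theorem AlternatingMap.fixRight_apply {d m : ℕ} (Ω : E [⋀^Fin (d + m)]→ₗ[ℝ] ℝ)
    (a : Fin m → E) (v : Fin d → E) : Ω.fixRight a v = Ω (Fin.append v a) := rfl

@[simp] theorem AlternatingMap.fixLeft_apply {d m : ℕ} (Ω : E [⋀^Fin (d + m)]→ₗ[ℝ] ℝ)
    (v : Fin d → E) (a : Fin m → E) : Ω.fixLeft v a = Ω (Fin.append v a) := rfl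

/-- `Φ` kills the span of `v` and is injective on the span of `a`, so the two spans are disjoint. -/
theorem linearIndependent_append {d m : ℕ} (Φ : E →ₗ[ℝ] K) {v : Fin d → E} {a : Fin m → E}
    (hv : LinearIndependent ℝ v) (hv0 : ∀ i, Φ (v i) = 0)
    (ha : LinearIndependent ℝ fun i => Φ (a i)) : LinearIndependent ℝ (Fin.append v a) := by
  have h2 : LinearIndependent ℝ a := LinearIndependent.of_comp Φ ha
  have key : LinearIndependent ℝ (Sum.elim v a) := by
    refine LinearIndependent.sum_type hv h2 ?_
    rw [Submodule.disjoint_def]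
    intro x hx hx'
    have hx0 : Φ x = 0 := by
      have : Submodule.span ℝ (Set.range v) ≤ LinearMap.ker Φ := by
        rw [Submodule.span_le]
        rintro _ ⟨i, rfl⟩
        exact hv0 i
      exact this hx
    rw [Submodule.mem_span_range_iff_exists_fun] at hx'
    obtain ⟨c, rfl⟩ := hx'
    rw [map_sum] at hx0
    simp only [map_smul] at hx0
    have := Fintype.linearIndependent_iff.1 ha c hx0
    simp [this]
  have : Fin.append v a = Sum.elim v a ∘ finSumFinEquiv.symm := by
    ext j
    refine Fin.addCases (fun j => ?_) (fun j => ?_) j <;> simp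
  rw [this]
  exact key.comp _ finSumFinEquiv.symm.injective

/-- If `v` consists of vectors in the kernel of `Φ`, the numbers `Ω (v, a)` and `δ (Φ a)` are
proportional as functions of `a`. -/
theorem topForm_append_mul {d m : ℕ} [FiniteDimensional ℝ E] [FiniteDimensional ℝ K]
    (hE : Module.finrank ℝ E = d + m) (hK : Module.finrank ℝ K = m)
    (Ω : E [⋀^Fin (d + m)]→ₗ[ℝ] ℝ) (δ : K [⋀^Fin m]→ₗ[ℝ] ℝ) (Φ : E →ₗ[ℝ] K)
    (hΦ : Function.Surjective Φ) {v : Fin d → E} (hv : ∀ i, Φ (v i) = 0) (a b : Fin m → E) :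
    Ω (Fin.append v a) * δ (fun i => Φ (b i)) = Ω (Fin.append v b) * δ (fun i => Φ (a i)) := by
  obtain ⟨σ, hσ⟩ := Φ.exists_rightInverse_of_surjective (LinearMap.range_eq_top.2 hΦ)
  have hσ' : ∀ y, Φ (σ y) = y := fun y => LinearMap.congr_fun hσ y
  have hker : Module.finrank ℝ (LinearMap.ker Φ) = d := by
    have := Φ.finrank_range_add_finrank_ker
    rw [LinearMap.range_eq_top.2 hΦ, finrank_top] at this
    omega
  -- If `a i` is in the kernel of `Φ`, independence of the whole family would put `d + 1`
  -- independent vectors in this `d`-dimensional kernel.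
  have vanish : ∀ (a : Fin m → E) (i : Fin m), Φ (a i) = 0 → Ω (Fin.append v a) = 0 := by
    intro a i hi
    by_contra hne
    have hli : LinearIndependent ℝ (Fin.append v a) := by
      by_contra h
      exact hne (Ω.map_linearDependent _ h)
    let w : Option (Fin d) → LinearMap.ker Φ := fun o => o.elim ⟨a i, hi⟩ fun j => ⟨v j, hv j⟩
    let e : Option (Fin d) → Fin (d + m) := fun o => o.elim (Fin.natAdd d i) (Fin.castAdd m)
    have he : Function.Injective e := by
      rintro (_ | j) (_ | k) h
      · rfl
      · have := congrArg Fin.val h; simp [e] at this; omega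
      · have := congrArg Fin.val h; simp [e] at this; omega
      · simpa [e] using h
    have hw : LinearIndependent ℝ w := by
      apply LinearIndependent.of_comp (LinearMap.ker Φ).subtype
      convert hli.comp e he using 1
      ext o
      cases o <;> simp [w, e]
    have := hw.fintype_card_le_finrank
    rw [hker] at this
    simp at this
  -- Write each `a i` as `σ (Φ (a i))` plus a kernel vector and expand multilinearly; every term
  -- containing a kernel vector vanishes.
  have dep : ∀ a : Fin m → E, Ω (Fin.append v a) = Ω (Fin.append v fun i => σ (Φ (a i))) := by
    intro a
    have h1 := (Ω.fixLeft v).toMultilinearMap.map_add_univ (fun i => σ (Φ (a i)))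
      (fun i => a i - σ (Φ (a i)))
    have h2 : ((fun i => σ (Φ (a i))) + fun i => a i - σ (Φ (a i))) = a := by
      ext i; simp
    rw [h2] at h1
    refine h1.trans ?_
    rw [Finset.sum_eq_single Finset.univ]
    · simp
    · intro s _ hs
      obtain ⟨i, hi⟩ : ∃ i, i ∉ s := by
        by_contra! h
        exact hs (Finset.eq_univ_iff_forall.2 h)
      refine vanish _ i ?_
      rw [Finset.piecewise_eq_of_notMem _ _ _ hi, map_sub, hσ', sub_self]
    · simp
  rw [dep a, dep b]
  exact topForm_proportional hK ((Ω.fixLeft v).compLinearMap σ) δ (fun i => Φ (a i))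
    fun i => Φ (b i)

end TopForms

/-! ### Orientations of manifolds from families of ambient forms. -/

section Frames

variable {d : ℕ} {H : Type*} [TopologicalSpace H]
  {I : ModelWithCorners ℝ (EuclideanSpace ℝ (Fin d)) H}
  {X : Type*} [TopologicalSpace X] [ChartedSpace H X] [IsManifold I ∞ X]
  {E : Type*} [NormedAddCommGroup E] [NormedSpace ℝ E]

/-- The differential of a vector valued map, as a linear map on the model space. -/
noncomputable def ambientDeriv (I : ModelWithCorners ℝ (EuclideanSpace ℝ (Fin d)) H)
    (ι : X → E) (x : X) : EuclideanSpace ℝ (Fin d) →L[ℝ] E :=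
  mfderiv I 𝓘(ℝ, E) ι x

/-- The differential of a vector valued map, in the coordinates given by the chart at `x₀`. -/
noncomputable def differentialInChart (I : ModelWithCorners ℝ (EuclideanSpace ℝ (Fin d)) H)
    [IsManifold I ∞ X] (ι : X → E) (x₀ x : X) : EuclideanSpace ℝ (Fin d) →L[ℝ] E :=
  (ambientDeriv I ι x).comp (tangentCoordChange I x₀ x x)

/-- This is `mfderiv` in tangent coordinates; the coordinate change in the target is trivial because
`E` is a vector space. -/
theorem continuousAt_differentialInChart {ι : X → E} (hι : ContMDiff I 𝓘(ℝ, E) ∞ ι) (x₀ : X) :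
    ContinuousAt (differentialInChart I ι x₀) x₀ := by
  have h1 : ContinuousAt (inTangentCoordinates I 𝓘(ℝ, E) id ι (ambientDeriv I ι) x₀) x₀ :=
    (ContMDiffAt.mfderiv_const (m := 0) (hι x₀) (by simp)).continuousAt
  refine h1.congr ?_
  filter_upwards [(chartAt H x₀).open_source.mem_nhds (mem_chart_source H x₀)] with x hx
  have hx' : ι x ∈ (chartAt E (ι x₀)).source := Set.mem_univ _
  refine (inTangentCoordinates_eq (I := I) (I' := 𝓘(ℝ, E)) id ι (ambientDeriv I ι) hx hx').trans ?_
  simp only [tangentBundleCore_coordChange_model_space]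
  rfl

theorem differentialInChart_self (ι : X → E) (x₀ : X) (v : EuclideanSpace ℝ (Fin d)) :
    differentialInChart I ι x₀ x₀ v = ambientDeriv I ι x₀ v := by
  rw [differentialInChart, ContinuousLinearMap.comp_apply,
    tangentCoordChange_self (mem_extChartAt_source x₀)]

theorem differentialInChart_apply {ι : X → E} {x₀ x : X} (hx : x ∈ (extChartAt I x₀).source)
    (v : EuclideanSpace ℝ (Fin d)) :
    differentialInChart I ι x₀ x (tangentCoordChange I x x₀ x v) = ambientDeriv I ι x v := by
  rw [differentialInChart, ContinuousLinearMap.comp_apply,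
    tangentCoordChange_comp ⟨⟨mem_extChartAt_source x, hx⟩, mem_extChartAt_source x⟩,
    tangentCoordChange_self (mem_extChartAt_source x)]

/-- Pulling back a continuous family of forms gives signs that are locally constant in charts. -/
theorem eventually_sign_pullback_eq {ι : X → E} (hι : ContMDiff I 𝓘(ℝ, E) ∞ ι) {x₀ : X}
    (η : X → E [⋀^Fin d]→ₗ[ℝ] ℝ)
    (hη : ∀ w : X → Fin d → E, ContinuousAt w x₀ → ContinuousAt (fun x => η x (w x)) x₀)
    (h0 : ∃ v : Fin d → EuclideanSpace ℝ (Fin d), η x₀ (fun i => ambientDeriv I ι x₀ (v i)) ≠ 0) :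
    ∀ᶠ x in 𝓝 x₀, ∀ v : Fin d → EuclideanSpace ℝ (Fin d),
      SignType.sign (η x₀ (fun i => ambientDeriv I ι x₀ (tangentCoordChange I x x₀ x (v i)))) =
        SignType.sign (η x (fun i => ambientDeriv I ι x (v i))) := by
  let b := (EuclideanSpace.basisFun (Fin d) ℝ).toBasis
  let D := differentialInChart I ι x₀
  let α : X → EuclideanSpace ℝ (Fin d) [⋀^Fin d]→ₗ[ℝ] ℝ :=
    fun x => (η x).compLinearMap (D x : EuclideanSpace ℝ (Fin d) →ₗ[ℝ] E)
  have hαx₀ : ∀ v : Fin d → EuclideanSpace ℝ (Fin d),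
      α x₀ v = η x₀ (fun i => ambientDeriv I ι x₀ (v i)) := by
    intro v
    change η x₀ (fun i => D x₀ (v i)) = _
    congr 1
    ext i
    exact differentialInChart_self ι x₀ (v i)
  have hb : α x₀ b ≠ 0 := by
    obtain ⟨v, hv⟩ := h0
    refine (topForm_ne_zero_iff (by simp) ?_ _).2 b.linearIndependent
    intro h
    apply hv
    rw [← hαx₀ v, h]
    rfl
  have hcont : ContinuousAt (fun x => α x b) x₀ := by
    refine hη (fun x i => D x (b i)) ?_
    rw [continuousAt_pi]
    intro i
    exact (continuousAt_differentialInChart hι x₀).clm_apply continuousAt_const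
  have hsign : ∀ᶠ x in 𝓝 x₀, SignType.sign (α x b) = SignType.sign (α x₀ b) := by
    have h2 : ContinuousAt SignType.sign (α x₀ b) := continuousAt_sign_of_ne_zero hb
    have h3 := ContinuousAt.comp (f := fun x => α x b) h2 hcont
    exact h3.eventually (isOpen_discrete {SignType.sign (α x₀ b)} |>.mem_nhds rfl)
  filter_upwards [hsign, extChartAt_source_mem_nhds (I := I) x₀] with x hx hxs v
  let w : Fin d → EuclideanSpace ℝ (Fin d) := fun i => tangentCoordChange I x x₀ x (v i)
  have e1 : α x w = η x (fun i => ambientDeriv I ι x (v i)) := by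
    change η x (fun i => D x (w i)) = _
    congr 1
    ext i
    exact differentialInChart_apply hxs (v i)
  -- Both pulled-back forms are multiples of `b.det`, so comparing their signs on the basis `b`
  -- settles all `v` at once.
  rw [← e1, ← hαx₀ w, (α x₀).eq_smul_basis_det b, (α x).eq_smul_basis_det b]
  simp only [AlternatingMap.smul_apply, smul_eq_mul, sign_mul, hx]

/-- An orientation of a manifold at a point, as an orientation of the model space. -/
def ManifoldOrientation.orientAt (o : ManifoldOrientation I X) (x : X) :
    Orientation ℝ (EuclideanSpace ℝ (Fin d)) (Fin d) := o.orient x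

theorem ManifoldOrientation.eventually_orientAt (o : ManifoldOrientation I X) (x₀ : X) :
    ∀ᶠ x in 𝓝 x₀, ∀ v : Fin d → EuclideanSpace ℝ (Fin d),
      orSign (o.orientAt x₀) (fun i => tangentCoordChange I x x₀ x (v i)) =
        orSign (o.orientAt x) v :=
  o.locally_constant x₀

/-- An orientation of a manifold given locally by pulling back continuous families of forms. -/
def ManifoldOrientation.ofForms {ι : X → E} (hι : ContMDiff I 𝓘(ℝ, E) ∞ ι)
    (o : X → Orientation ℝ (EuclideanSpace ℝ (Fin d)) (Fin d))
    (ho : ∀ x₀ : X, ∃ η : X → E [⋀^Fin d]→ₗ[ℝ] ℝ,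
      (∀ w : X → Fin d → E, ContinuousAt w x₀ → ContinuousAt (fun x => η x (w x)) x₀) ∧
      ∀ᶠ x in 𝓝 x₀, ∀ v : Fin d → EuclideanSpace ℝ (Fin d),
        orSign (o x) v = SignType.sign (η x (fun i => ambientDeriv I ι x (v i)))) :
    ManifoldOrientation I X where
  orient := o
  locally_constant x₀ := by
    suffices h : ∀ᶠ x in 𝓝 x₀, ∀ v : Fin d → EuclideanSpace ℝ (Fin d),
        orSign (o x₀) (fun i => tangentCoordChange I x x₀ x (v i)) = orSign (o x) v from h
    obtain ⟨η, hη, hev⟩ := ho x₀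
    have h0 := hev.self_of_nhds
    let b := (EuclideanSpace.basisFun (Fin d) ℝ).toBasis
    have hb : orSign (o x₀) b ≠ 0 := (orSign_ne_zero_iff (by simp) _ _).2 b.linearIndependent
    have h1 : η x₀ (fun i => ambientDeriv I ι x₀ (b i)) ≠ 0 := by
      intro h
      apply hb
      refine (h0 b).trans ?_
      rw [h, sign_zero]
    filter_upwards [hev, eventually_sign_pullback_eq hι η hη ⟨b, h1⟩] with x hx hx' v
    rw [hx v, ← hx' v]
    exact h0 _

/-- An orientation compared with a continuous nowhere vanishing family of forms. -/
theorem ManifoldOrientation.exists_sign {ι : X → E} (hι : ContMDiff I 𝓘(ℝ, E) ∞ ι)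
    (o : ManifoldOrientation I X) (η : X → E [⋀^Fin d]→ₗ[ℝ] ℝ)
    (hη : ∀ x₀, ∀ w : X → Fin d → E, ContinuousAt w x₀ → ContinuousAt (fun x => η x (w x)) x₀)
    (h0 : ∀ x, ∃ v : Fin d → EuclideanSpace ℝ (Fin d),
      η x (fun i => ambientDeriv I ι x (v i)) ≠ 0) :
    ∃ ε : X → SignType, (∀ x, ε x ≠ 0) ∧ (∀ x₀, ∀ᶠ x in 𝓝 x₀, ε x = ε x₀) ∧
      ∀ x (v : Fin d → EuclideanSpace ℝ (Fin d)),
        orSign (o.orientAt x) v =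
          ε x * SignType.sign (η x (fun i => ambientDeriv I ι x (v i))) := by
  let β : X → EuclideanSpace ℝ (Fin d) [⋀^Fin d]→ₗ[ℝ] ℝ := fun x =>
    (η x).compLinearMap (ambientDeriv I ι x : EuclideanSpace ℝ (Fin d) →ₗ[ℝ] E)
  have hβ : ∀ x, β x ≠ 0 := by
    intro x h
    obtain ⟨v, hv⟩ := h0 x
    apply hv
    exact DFunLike.congr_fun h v
  have key : ∀ x, ∃ s : SignType, s ≠ 0 ∧ ∀ v : Fin d → EuclideanSpace ℝ (Fin d),
      orSign (o.orientAt x) v = s * SignType.sign (β x v) :=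
    fun x => exists_orSign_eq (by simp) (o.orientAt x) (hβ x)
  choose ε hε hεo using key
  refine ⟨ε, hε, fun x₀ => ?_, hεo⟩
  filter_upwards [o.eventually_orientAt x₀, eventually_sign_pullback_eq hι η (hη x₀) (h0 x₀)]
    with x hx hx'
  let b := (EuclideanSpace.basisFun (Fin d) ℝ).toBasis
  have hb : β x b ≠ 0 := (topForm_ne_zero_iff (by simp) (hβ x) _).2 b.linearIndependent
  have h1 := hx b
  have h2 : SignType.sign (β x₀ (fun i => tangentCoordChange I x x₀ x (b i))) =
      SignType.sign (β x b) := hx' b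
  rw [hεo x₀, h2, hεo x b] at h1
  have h5 : SignType.sign (β x b) ≠ 0 := by rwa [Ne, sign_eq_zero_iff]
  generalize SignType.sign (β x b) = s at h1 h5
  generalize ε x = e1 at *
  generalize ε x₀ = e2 at *
  revert e1 e2 s
  decide

end Frames

/-! ### Atlases whose charts are restrictions of smooth ambient maps. -/

section LevelCharts

variable {d : ℕ} {H : Type*} [TopologicalSpace H]
  {X : Type*} [TopologicalSpace X] {E : Type*} [NormedAddCommGroup E] [NormedSpace ℝ E]

/-- A chart of `X` given by the restriction of a smooth map from the ambient space `E` to the model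
space, with an inverse that is a smooth map to the ambient space. -/
structure AmbientChart (I : ModelWithCorners ℝ (EuclideanSpace ℝ (Fin d)) H) (ι : X → E) where
  chart : OpenPartialHomeomorph X H
  coord : E → EuclideanSpace ℝ (Fin d)
  param : EuclideanSpace ℝ (Fin d) → E
  contDiff_coord : ContDiff ℝ ∞ coord
  contDiffAt_param : ∀ h ∈ chart.target, ContDiffAt ℝ ∞ param (I h)
  chart_eq : ∀ x ∈ chart.source, I (chart x) = coord (ι x)
  param_eq : ∀ h ∈ chart.target, ι (chart.symm h) = param (I h)

namespace AmbientChart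

variable {I : ModelWithCorners ℝ (EuclideanSpace ℝ (Fin d)) H} {ι : X → E}

/-- The atlas made from an ambient chart at each point. -/
@[reducible] def chartedSpace (c : X → AmbientChart I ι) (hc : ∀ x, x ∈ (c x).chart.source) :
    ChartedSpace H X where
  atlas := Set.range fun x => (c x).chart
  chartAt x := (c x).chart
  mem_chart_source := hc
  chart_mem_atlas x := ⟨x, rfl⟩

/-- A transition map is a restriction of `coord ∘ param`, which is smooth on open subsets of the
whole model vector space, so boundary points need no separate treatment. -/
theorem isManifold (c : X → AmbientChart I ι) (hc : ∀ x, x ∈ (c x).chart.source) :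
    letI := chartedSpace c hc
    IsManifold I ∞ X := by
  let _ : ChartedSpace H X := chartedSpace c hc
  apply isManifold_of_contDiffOn
  rintro _ _ ⟨x, rfl⟩ ⟨y, rfl⟩
  rintro w ⟨hw, ⟨h, rfl⟩⟩
  have key : ∀ h, h ∈ ((c x).chart.symm ≫ₕ (c y).chart).source →
      I (((c x).chart.symm ≫ₕ (c y).chart) h) = (c y).coord ((c x).param (I h)) := by
    intro h hh
    rw [OpenPartialHomeomorph.trans_source] at hh
    simp only [OpenPartialHomeomorph.coe_trans, Function.comp_apply]
    rw [(c y).chart_eq _ hh.2, (c x).param_eq _ hh.1]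
  have hw' : h ∈ ((c x).chart.symm ≫ₕ (c y).chart).source := by simpa using hw
  have ht : h ∈ (c x).chart.target := by
    rw [OpenPartialHomeomorph.trans_source] at hw'
    exact hw'.1
  have h1 : ContDiffAt ℝ ∞ ((c y).coord ∘ (c x).param) (I h) :=
    (c y).contDiff_coord.contDiffAt.comp _ ((c x).contDiffAt_param h ht)
  refine h1.contDiffWithinAt.congr ?_ ?_
  · rintro _ ⟨hz, ⟨k, rfl⟩⟩
    have hk : k ∈ ((c x).chart.symm ≫ₕ (c y).chart).source := by simpa using hz
    simpa using key k hk
  · simpa using key h hw'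

theorem contMDiff_ambient (c : X → AmbientChart I ι) (hc : ∀ x, x ∈ (c x).chart.source)
    (hι : Continuous ι) :
    letI := chartedSpace c hc
    ContMDiff I 𝓘(ℝ, E) ∞ ι := by
  let _ : ChartedSpace H X := chartedSpace c hc
  intro x
  rw [contMDiffAt_iff]
  refine ⟨hι.continuousAt, ?_⟩
  have hx : (c x).chart x ∈ (c x).chart.target := (c x).chart.map_source (hc x)
  have h1 := (c x).contDiffAt_param _ hx
  refine h1.contDiffWithinAt.congr_of_eventuallyEq_of_mem ?_ (Set.mem_range_self _)
  have h2 : I.symm ⁻¹' (c x).chart.target ∈ 𝓝[Set.range I] (I ((c x).chart x)) := by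
    apply mem_nhdsWithin_of_mem_nhds
    apply I.continuous_symm.continuousAt.preimage_mem_nhds
    rw [I.left_inv]
    exact (c x).chart.open_target.mem_nhds hx
  filter_upwards [h2, self_mem_nhdsWithin] with y hy hy'
  obtain ⟨k, rfl⟩ := hy'
  have hk : k ∈ (c x).chart.target := by simpa using hy
  have := (c x).param_eq k hk
  change ι ((c x).chart.symm (I.symm (I k))) = _
  rwa [I.left_inv]

/-- In a chart `a` becomes `coord ∘ ι ∘ a`: smoothness into `X` can be tested after composing with
`ι`. -/
theorem contMDiff_of_ambient (c : X → AmbientChart I ι) (hc : ∀ x, x ∈ (c x).chart.source)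
    {n : ℕ} {H' : Type*} [TopologicalSpace H']
    {J : ModelWithCorners ℝ (EuclideanSpace ℝ (Fin n)) H'} {N : Type*} [TopologicalSpace N]
    [ChartedSpace H' N] {a : N → X} (ha : Continuous a)
    (haι : ContMDiff J 𝓘(ℝ, E) ∞ (ι ∘ a)) :
    letI := chartedSpace c hc
    ContMDiff J I ∞ a := by
  let _ : ChartedSpace H X := chartedSpace c hc
  intro x
  rw [contMDiffAt_iff_target]
  refine ⟨ha.continuousAt, ?_⟩
  have h1 : ContMDiffAt J 𝓘(ℝ, EuclideanSpace ℝ (Fin d)) ∞ ((c (a x)).coord ∘ ι ∘ a) x :=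
    ContMDiffAt.comp x (c (a x)).contDiff_coord.contMDiff.contMDiffAt (haι x)
  refine h1.congr_of_eventuallyEq ?_
  have h2 : a ⁻¹' (c (a x)).chart.source ∈ 𝓝 x :=
    ha.continuousAt.preimage_mem_nhds ((c (a x)).chart.open_source.mem_nhds (hc _))
  filter_upwards [h2] with y hy
  exact (c (a x)).chart_eq _ hy

theorem extChartAt_self (c : X → AmbientChart I ι) (hc : ∀ x, x ∈ (c x).chart.source) (x : X) :
    letI := chartedSpace c hc
    extChartAt I x x = (c x).coord (ι x) := (c x).chart_eq x (hc x)

/-- `coord ∘ ι` is the preferred chart, whose differential is the identity under the identification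
of the tangent space with the model. This gives injectivity of the differential of `ι` and, later,
the coordinates of outward vectors. -/
theorem fderiv_coord_mfderiv (c : X → AmbientChart I ι) (hc : ∀ x, x ∈ (c x).chart.source)
    (hι : Continuous ι) (x : X) :
    letI := chartedSpace c hc
    ∀ v, fderiv ℝ (c x).coord (ι x) (ambientDeriv I ι x v) = v := by
  let _ : ChartedSpace H X := chartedSpace c hc
  have := isManifold c hc
  intro v
  have h1 : mfderiv I 𝓘(ℝ, EuclideanSpace ℝ (Fin d)) (extChartAt I x) x =
      mfderiv I 𝓘(ℝ, EuclideanSpace ℝ (Fin d)) ((c x).coord ∘ ι) x := by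
    apply Filter.EventuallyEq.mfderiv_eq
    filter_upwards [(c x).chart.open_source.mem_nhds (hc x)] with y hy
    exact (c x).chart_eq y hy
  have h2 : mfderiv I 𝓘(ℝ, EuclideanSpace ℝ (Fin d)) ((c x).coord ∘ ι) x v =
      mfderiv 𝓘(ℝ, E) 𝓘(ℝ, EuclideanSpace ℝ (Fin d)) (c x).coord (ι x)
        (mfderiv I 𝓘(ℝ, E) ι x v) := by
    rw [mfderiv_comp x ((c x).contDiff_coord.contMDiff.contMDiffAt.mdifferentiableAt (by simp))
      ((contMDiff_ambient c hc hι x).mdifferentiableAt (by simp))]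
    rfl
  rw [mfderiv_eq_fderiv] at h2
  refine h2.symm.trans ?_
  rw [← h1]
  have h3 : MDifferentiableAt I 𝓘(ℝ, EuclideanSpace ℝ (Fin d)) (extChartAt I x) x :=
    mdifferentiableAt_extChartAt (mem_chart_source H x)
  have h4 := tangentCoordChange_self (I := I) (x := x) (z := x) (v := v) (mem_extChartAt_source x)
  rw [tangentCoordChange_def] at h4
  rw [h3.mfderiv]
  exact h4

end AmbientChart

end LevelCharts

/-! ### Charts of level sets from the inverse function theorem. -/

section LevelSets

/-- The inverse function theorem with a smooth inverse on the whole target. -/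
theorem exists_local_diffeomorphism {E F : Type*} [NormedAddCommGroup E] [NormedSpace ℝ E]
    [FiniteDimensional ℝ E] [NormedAddCommGroup F] [NormedSpace ℝ F] [FiniteDimensional ℝ F]
    {f : E → F} {U : Set E} (hU : IsOpen U) (hf : ContDiffOn ℝ ∞ f U) {p : E} (hp : p ∈ U)
    (hbij : Function.Bijective (fderiv ℝ f p)) :
    ∃ e : OpenPartialHomeomorph E F, p ∈ e.source ∧ e.source ⊆ U ∧ (∀ x, e x = f x) ∧
      ∀ y ∈ e.target, ContDiffAt ℝ ∞ e.symm y := by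
  have := FiniteDimensional.complete ℝ E
  have := FiniteDimensional.complete ℝ F
  have hfp : ContDiffAt ℝ ∞ f p := hf.contDiffAt (hU.mem_nhds hp)
  let A : E ≃L[ℝ] F :=
    (LinearEquiv.ofBijective (fderiv ℝ f p : E →ₗ[ℝ] F) hbij).toContinuousLinearEquiv
  have hA : (A : E →L[ℝ] F) = fderiv ℝ f p := by ext; rfl
  have hder : HasFDerivAt f (A : E →L[ℝ] F) p := by
    rw [hA]; exact (hfp.differentiableAt (by simp)).hasFDerivAt
  let e₀ := hfp.toOpenPartialHomeomorph f hder (by simp)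
  have hcont : ContinuousOn (fderiv ℝ f) U := hf.continuousOn_fderiv_of_isOpen hU (by simp)
  -- Restricting to the open set where the derivative is invertible makes the inverse smooth at
  -- every point of the target, not only at the image of `p`.
  let V : Set E := U ∩ fderiv ℝ f ⁻¹' Set.range ((↑) : (E ≃L[ℝ] F) → E →L[ℝ] F)
  have hV : IsOpen V := hcont.isOpen_inter_preimage hU (ContinuousLinearEquiv.isOpen)
  refine ⟨e₀.restrOpen V hV, ⟨hfp.mem_toOpenPartialHomeomorph_source hder (by simp),
    hp, A, hA⟩, ?_, fun x => rfl, ?_⟩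
  · rintro x ⟨-, hx, -⟩
    exact hx
  · intro y hy
    have hx := (e₀.restrOpen V hV).map_target hy
    obtain ⟨-, hxU, B, hB⟩ := hx
    refine (e₀.restrOpen V hV).contDiffAt_symm hy (f₀' := B) ?_ ?_
    · change HasFDerivAt f _ _
      rw [hB]
      exact ((hf.contDiffAt (hU.mem_nhds hxU)).differentiableAt (by simp)).hasFDerivAt
    · exact hf.contDiffAt (hU.mem_nhds hxU)

/-- The map to the ambient space of a disjoint union of subsets. -/
def ambientMap {k : ℕ} {E : Type*} (S : Set (Fin k × E)) (z : S) : E := z.1.2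

theorem continuous_ambientMap {k : ℕ} {E : Type*} [TopologicalSpace E] (S : Set (Fin k × E)) :
    Continuous (ambientMap S) :=
  continuous_snd.comp continuous_subtype_val

variable {d k : ℕ} {H : Type*} [TopologicalSpace H]
  (I : ModelWithCorners ℝ (EuclideanSpace ℝ (Fin d)) H)
  {E K : Type*} [NormedAddCommGroup E] [NormedSpace ℝ E] [FiniteDimensional ℝ E]
  [NormedAddCommGroup K] [NormedSpace ℝ K] [FiniteDimensional ℝ K]

theorem exists_ambientChart {S : Set (Fin k × E)} (z : S) (Φ : E → K)
    {L : E → EuclideanSpace ℝ (Fin d)} {U : Set E} (hU : IsOpen U) (hz : z.1.2 ∈ U)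
    (hΦ : ContDiffOn ℝ ∞ Φ U) (hL : ContDiff ℝ ∞ L)
    (hbij : Function.Bijective ((fderiv ℝ Φ z.1.2).prod (fderiv ℝ L z.1.2)))
    (hS : ∀ p ∈ U, (z.1.1, p) ∈ S ↔ Φ p = 0 ∧ L p ∈ Set.range I) :
    ∃ c : AmbientChart I (ambientMap S), z ∈ c.chart.source ∧ c.coord = L := by
  classical
  obtain ⟨⟨r, p⟩, hzS⟩ := z
  have hdΦ : DifferentiableAt ℝ Φ p := (hΦ.contDiffAt (hU.mem_nhds hz)).differentiableAt (by simp)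
  have hdL : DifferentiableAt ℝ L p := (hL.differentiable (by simp)) p
  obtain ⟨e, hpe, heU, he, hesymm⟩ := exists_local_diffeomorphism (f := fun x => (Φ x, L x)) hU
    (hΦ.prodMk hL.contDiffOn) hz (by rw [hdΦ.fderiv_prodMk hdL]; exact hbij)
  -- The local diffeomorphism `(Φ, L)` straightens `S` to `{0} × range I`, and `γ` parametrises it
  -- by the coordinates `L`.
  let γ : EuclideanSpace ℝ (Fin d) → E := fun y => e.symm (0, y)
  let T : Set H := {h | ((0 : K), I h) ∈ e.target}
  have hT : IsOpen T := e.open_target.preimage (continuous_const.prodMk I.continuous)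
  have hγS : ∀ h ∈ T, (r, γ (I h)) ∈ S := by
    intro h hh
    have h1 := e.map_target hh
    have h2 := e.right_inv hh
    rw [he] at h2
    refine (hS _ (heU h1)).2 ⟨congrArg Prod.fst h2, ?_⟩
    exact ⟨h, (congrArg Prod.snd h2).symm⟩
  have hLγ : ∀ h ∈ T, L (γ (I h)) = I h := by
    intro h hh
    have h2 := e.right_inv hh
    rw [he] at h2
    exact congrArg Prod.snd h2
  have hsrc : ∀ x : S, x.1.1 = r → x.1.2 ∈ e.source →
      Φ x.1.2 = 0 ∧ L x.1.2 ∈ Set.range I := by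
    rintro ⟨⟨r', q⟩, hq⟩ rfl hqe
    exact (hS q (heU hqe)).1 hq
  let c : OpenPartialHomeomorph S H :=
    { toFun := fun x => I.symm (L x.1.2)
      -- The value outside `T` is irrelevant; the given point of `S` serves as default.
      invFun := fun h => if hh : h ∈ T then ⟨(r, γ (I h)), hγS h hh⟩ else ⟨(r, p), hzS⟩
      source := {x | x.1.1 = r ∧ x.1.2 ∈ e.source}
      target := T
      map_source' := by
        rintro x ⟨hx1, hx2⟩
        obtain ⟨h1, h2⟩ := hsrc x hx1 hx2
        change ((0 : K), I (I.symm (L x.1.2))) ∈ e.target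
        rw [I.right_inv h2, ← h1, ← he]
        exact e.map_source hx2
      map_target' := by
        intro h hh
        rw [dif_pos hh]
        exact ⟨rfl, e.map_target hh⟩
      left_inv' := by
        rintro x ⟨hx1, hx2⟩
        obtain ⟨h1, h2⟩ := hsrc x hx1 hx2
        have h3 : ((0 : K), I (I.symm (L x.1.2))) ∈ e.target := by
          rw [I.right_inv h2, ← h1, ← he]
          exact e.map_source hx2
        rw [dif_pos (show I.symm (L x.1.2) ∈ T from h3)]
        apply Subtype.ext
        refine Prod.ext hx1.symm ?_
        change e.symm (0, I (I.symm (L x.1.2))) = _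
        rw [I.right_inv h2, ← h1, ← he]
        exact e.left_inv hx2
      right_inv' := by
        intro h hh
        rw [dif_pos hh]
        change I.symm (L (γ (I h))) = h
        rw [hLγ h hh, I.left_inv]
      open_source := by
        have h1 : IsOpen {q : Fin k × E | q.1 = r ∧ q.2 ∈ e.source} :=
          ((isOpen_discrete {r}).preimage continuous_fst).inter
            (e.open_source.preimage continuous_snd)
        exact h1.preimage continuous_subtype_val
      open_target := hT
      continuousOn_toFun :=
        (I.continuous_symm.comp (hL.continuous.comp (continuous_ambientMap S))).continuousOn
      continuousOn_invFun := by
        rw [continuousOn_iff_continuous_domRestrict]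
        have h1 : Continuous fun h : T => γ (I h) := by
          have h2 : ContinuousOn (fun h => e.symm ((0 : K), I h)) T :=
            e.continuousOn_symm.comp (continuous_const.prodMk I.continuous).continuousOn
              fun h hh => hh
          exact continuousOn_iff_continuous_domRestrict.1 h2
        have h3 : Continuous fun h : T => (⟨(r, γ (I h)), hγS h h.2⟩ : S) :=
          (continuous_const.prodMk h1).subtype_mk _
        refine h3.congr fun h => ?_
        simp only [Set.domRestrict_apply]
        rw [dif_pos h.2] }
  refine ⟨{ chart := c
            coord := L
            param := γ
            contDiff_coord := hL
            contDiffAt_param := fun h hh => ?_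
            chart_eq := fun x hx => ?_
            param_eq := fun h hh => ?_ }, ⟨rfl, hpe⟩, rfl⟩
  · exact ContDiffAt.comp (I h) (hesymm _ hh) (contDiff_const.prodMk contDiff_id).contDiffAt
  · exact I.right_inv (hsrc x hx.1 hx.2).2
  · change ambientMap S (if hh : h ∈ T then _ else _) = _
    rw [dif_pos hh]
    rfl

end LevelSets

/-! ### Orientations of level sets and their invariance. -/

section LevelOrientation

theorem continuous_topForm {E : Type*} [NormedAddCommGroup E] [NormedSpace ℝ E]
    [FiniteDimensional ℝ E] {n : ℕ} (hn : Module.finrank ℝ E = n) (φ : E [⋀^Fin n]→ₗ[ℝ] ℝ) :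
    Continuous φ := by
  let b := Module.finBasisOfFinrankEq ℝ E hn
  rw [φ.eq_smul_basis_det b]
  have h : Continuous fun v : Fin n → E => b.det v := by
    simp only [Module.Basis.det_apply]
    refine Continuous.matrix_det ?_
    refine continuous_matrix fun i j => ?_
    simp only [Module.Basis.toMatrix_apply]
    exact (LinearMap.continuous_of_finiteDimensional (b.coord i)).comp (continuous_apply j)
  exact continuous_const.mul h

theorem exists_orientation_of_sign {W : Type*} [AddCommGroup W] [Module ℝ W] {n : ℕ}
    {φ : W [⋀^Fin n]→ₗ[ℝ] ℝ} (hφ : φ ≠ 0) {s : SignType} (hs : s ≠ 0) :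
    ∃ o : Orientation ℝ W (Fin n), ∀ v, orSign o v = s * SignType.sign (φ v) := by
  rcases s with _ | _ | _
  · exact absurd rfl hs
  · refine ⟨rayOfNeZero ℝ (-φ) (neg_ne_zero.2 hφ), fun v => ?_⟩
    rw [orSign_rayOfNeZero, AlternatingMap.neg_apply, Left.sign_neg]
    generalize SignType.sign (φ v) = t
    revert t; decide
  · refine ⟨rayOfNeZero ℝ φ hφ, fun v => ?_⟩
    rw [orSign_rayOfNeZero]
    generalize SignType.sign (φ v) = t
    revert t; decide

variable {d m : ℕ} {H : Type*} [TopologicalSpace H]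
  {I : ModelWithCorners ℝ (EuclideanSpace ℝ (Fin d)) H}
  {X : Type*} [TopologicalSpace X] [ChartedSpace H X] [IsManifold I ∞ X]
  {E K : Type*} [NormedAddCommGroup E] [NormedSpace ℝ E] [FiniteDimensional ℝ E]
  [NormedAddCommGroup K] [NormedSpace ℝ K] [FiniteDimensional ℝ K]

/-- The orientation of a manifold immersed in `E` with tangent spaces the kernels of the surjective
maps `D x : E → K`. -/
theorem exists_levelOrientation {ι : X → E} (hι : ContMDiff I 𝓘(ℝ, E) ∞ ι)
    (hE : Module.finrank ℝ E = d + m) (hK : Module.finrank ℝ K = m)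
    {Ω : E [⋀^Fin (d + m)]→ₗ[ℝ] ℝ} (hΩ : Ω ≠ 0) {δ : K [⋀^Fin m]→ₗ[ℝ] ℝ} (hδ : δ ≠ 0)
    {D : X → E →L[ℝ] K} (hD : Continuous D) (hsurj : ∀ x, Function.Surjective (D x))
    (hker : ∀ x v, D x (ambientDeriv I ι x v) = 0)
    (hinj : ∀ x, Function.Injective (ambientDeriv I ι x))
    {ε : X → SignType} (hε : ∀ x, ε x ≠ 0) (hεc : ∀ x₀, ∀ᶠ x in 𝓝 x₀, ε x = ε x₀) :
    ∃ o : ManifoldOrientation I X, ∀ x v a,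
      SignType.sign (Ω (Fin.append (fun i => ambientDeriv I ι x (v i)) a)) =
        orSign (o.orientAt x) v * (ε x * SignType.sign (δ fun i => D x (a i))) := by
  let bK := Module.finBasisOfFinrankEq ℝ K hK
  have hδb : δ bK ≠ 0 := (topForm_ne_zero_iff hK hδ bK).2 bK.linearIndependent
  -- A tangent frame is completed by vectors that `D x` maps to a fixed basis of `K`; by
  -- `topForm_append_mul` the choice of these vectors does not affect the sign.
  have ha : ∀ x, ∃ a : Fin m → E, (fun i => D x (a i)) = bK := by
    intro x
    choose a ha using hsurj x
    exact ⟨fun i => a (bK i), funext fun i => ha _⟩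
  choose a ha using ha
  let φ : X → EuclideanSpace ℝ (Fin d) [⋀^Fin d]→ₗ[ℝ] ℝ := fun x =>
    (Ω.fixRight (a x)).compLinearMap (ambientDeriv I ι x : EuclideanSpace ℝ (Fin d) →ₗ[ℝ] E)
  have hφ : ∀ x, φ x ≠ 0 := by
    intro x h
    let b := (EuclideanSpace.basisFun (Fin d) ℝ).toBasis
    have h1 : φ x b = 0 := by rw [h]; rfl
    refine (topForm_ne_zero_iff hE hΩ _).2 (linearIndependent_append (D x : E →ₗ[ℝ] K)
      (v := fun i => ambientDeriv I ι x (b i)) (a := a x) ?_ (fun i => hker x _) ?_) h1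
    · exact b.linearIndependent.map' (ambientDeriv I ι x : EuclideanSpace ℝ (Fin d) →ₗ[ℝ] E)
        (LinearMap.ker_eq_bot.2 (hinj x))
    · have : (fun i => (D x : E →ₗ[ℝ] K) (a x i)) = bK := ha x
      rw [this]
      exact bK.linearIndependent
  let t : SignType := SignType.sign (δ bK)
  have ht : t ≠ 0 := by rwa [Ne, sign_eq_zero_iff]
  have hst : ∀ x, ε x * t ≠ 0 := fun x => mul_ne_zero (hε x) ht
  choose o ho using fun x => exists_orientation_of_sign (hφ x) (hst x)
  have key : ∀ x v a',
      SignType.sign (Ω (Fin.append (fun i => ambientDeriv I ι x (v i)) a')) =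
        orSign (o x) v * (ε x * SignType.sign (δ fun i => D x (a' i))) := by
    intro x v a'
    have h1 := topForm_append_mul hE hK Ω δ (D x : E →ₗ[ℝ] K) (hsurj x)
      (v := fun i => ambientDeriv I ι x (v i)) (fun i => hker x _) a' (a x)
    have h2 : (fun i => (D x : E →ₗ[ℝ] K) (a x i)) = bK := ha x
    rw [h2] at h1
    have h3 := congrArg SignType.sign h1
    rw [sign_mul, sign_mul] at h3
    rw [ho x v]
    change _ * t = SignType.sign (φ x v) * SignType.sign (δ fun i => D x (a' i)) at h3
    have h5 := SignType.mul_self_of_ne_zero ht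
    have h6 := SignType.mul_self_of_ne_zero (hε x)
    generalize SignType.sign (Ω (Fin.append (fun i => ambientDeriv I ι x (v i)) a')) = s1 at *
    generalize SignType.sign (φ x v) = s2 at *
    generalize SignType.sign (δ fun i => D x (a' i)) = s3 at *
    clear_value t
    generalize ε x = e at *
    clear * - h3 ht h6
    revert s1 s2 s3 e t
    decide
  refine ⟨ManifoldOrientation.ofForms hι o fun x₀ => ?_, key⟩
  obtain ⟨c, hc⟩ : ∃ c : ℝ, SignType.sign c = ε x₀ * t := by
    have := hst x₀
    generalize ε x₀ * t = s at *
    rcases s with _ | _ | _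
    · exact absurd rfl this
    · exact ⟨-1, by simp⟩
    · exact ⟨1, by simp⟩
  -- The choice `a x` need not be continuous in `x`. Near `x₀` the vectors `a x₀` can be kept, since
  -- `δ (D x (a x₀))` does not change sign there.
  refine ⟨fun _ => c • Ω.fixRight (a x₀), fun w hw => ?_, ?_⟩
  · have h1 : ContinuousAt (fun x => Fin.append (w x) (a x₀)) x₀ := by
      rw [continuousAt_pi] at hw ⊢
      intro i
      refine Fin.addCases (fun j => ?_) (fun j => ?_) i
      · simpa using hw j
      · simpa using continuousAt_const
    exact ((continuous_topForm hE Ω).continuousAt.comp h1).const_smul c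
  · have h1 : ContinuousAt (fun x => δ fun i => D x (a x₀ i)) x₀ := by
      refine (continuous_topForm hK δ).continuousAt.comp ?_
      exact (continuous_pi fun i => hD.clm_apply continuous_const).continuousAt
    have h2 : (fun i => D x₀ (a x₀ i)) = bK := ha x₀
    have h3 : ∀ᶠ x in 𝓝 x₀, SignType.sign (δ fun i => D x (a x₀ i)) = t := by
      have h4 : ContinuousAt SignType.sign (δ fun i => D x₀ (a x₀ i)) :=
        continuousAt_sign_of_ne_zero (by rw [h2]; exact hδb)
      have h5 := ContinuousAt.comp (f := fun x => δ fun i => D x (a x₀ i)) h4 h1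
      have h6 := h5.eventually (isOpen_discrete {t} |>.mem_nhds (by
        simp only [Function.comp_apply]; rw [h2]; rfl))
      exact h6
    filter_upwards [h3, hεc x₀] with x hx hx' v
    have h4 := key x v (a x₀)
    rw [hx, hx'] at h4
    rw [AlternatingMap.smul_apply, smul_eq_mul, sign_mul, hc, AlternatingMap.fixRight_apply, h4,
      mul_left_comm, SignType.mul_self_of_ne_zero (hst x₀), mul_one]

/-- A diffeomorphism whose differential is induced by a linear map of the ambient space compatible
with the maps `D x` preserves the orientation of a level set. -/
theorem orSign_eq_of_ambient {ι : X → E}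
    (hE : Module.finrank ℝ E = d + m) (hK : Module.finrank ℝ K = m)
    {Ω : E [⋀^Fin (d + m)]→ₗ[ℝ] ℝ} {δ : K [⋀^Fin m]→ₗ[ℝ] ℝ} (hδ : δ ≠ 0)
    {D : X → E →L[ℝ] K} (hsurj : ∀ x, Function.Surjective (D x))
    {ε : X → SignType} (hε : ∀ x, ε x ≠ 0) (o : ManifoldOrientation I X)
    (ho : ∀ x v a, SignType.sign (Ω (Fin.append (fun i => ambientDeriv I ι x (v i)) a)) =
        orSign (o.orientAt x) v * (ε x * SignType.sign (δ fun i => D x (a i))))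
    {x y : X} (A : E →ₗ[ℝ] E) (C : K →ₗ[ℝ] K) (T : EuclideanSpace ℝ (Fin d) →
      EuclideanSpace ℝ (Fin d))
    (hT : ∀ v, ambientDeriv I ι y (T v) = A (ambientDeriv I ι x v))
    (hC : ∀ v, D y (A v) = C (D x v)) (hdetC : 0 < LinearMap.det C)
    (hdetA : SignType.sign (LinearMap.det A) = ε x * ε y)
    (v : Fin d → EuclideanSpace ℝ (Fin d)) :
    orSign (o.orientAt y) (fun i => T (v i)) = orSign (o.orientAt x) v := by
  let bK := Module.finBasisOfFinrankEq ℝ K hK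
  have hδb : δ bK ≠ 0 := (topForm_ne_zero_iff hK hδ bK).2 bK.linearIndependent
  choose a ha using hsurj x
  let a' : Fin m → E := fun i => a (bK i)
  have ha' : (fun i => D x (a' i)) = bK := funext fun i => ha _
  have h1 := ho x v a'
  -- The identity at `y` is evaluated on the image under `A` of the frame at `x`: the left side
  -- gains `det A`, of sign `ε x * ε y`, and the right side the positive factor `det C`.
  have h2 := ho y (fun i => T (v i)) (fun i => A (a' i))
  have h3 : Fin.append (fun i => ambientDeriv I ι y (T (v i))) (fun i => A (a' i)) =
      fun i => A (Fin.append (fun i => ambientDeriv I ι x (v i)) a' i) := by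
    ext i
    refine Fin.addCases (fun j => ?_) (fun j => ?_) i
    · simp [hT]
    · simp
  have h4 : (fun i => D y (A (a' i))) = fun i => C (bK i) := by
    ext i
    rw [hC, ← ha']
  rw [h3, topForm_comp hE, h4, topForm_comp hK, sign_mul, sign_mul, sign_pos hdetC, h1, ha',
    one_mul, hdetA] at h2
  have h5 : SignType.sign (δ bK) ≠ 0 := by rwa [Ne, sign_eq_zero_iff]
  have h6 := hε x
  have h7 := hε y
  generalize orSign (o.orientAt y) _ = s1 at *
  generalize orSign (o.orientAt x) v = s2 at *
  generalize SignType.sign (δ bK) = s3 at *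
  generalize ε x = e1 at *
  generalize ε y = e2 at *
  clear * - h2 h5 h6 h7
  revert s1 s2 s3 e1 e2
  decide

end LevelOrientation

/-! ### Calculus on the sphere in the punctured space `ℝ⁴`. -/

section SphereCalculus

/-- The Euclidean space `ℝ⁴`. -/
abbrev Euclid4 : Type := EuclideanSpace ℝ (Fin (3 + 1))

theorem fact_finrank_euclid4 : Fact (Module.finrank ℝ Euclid4 = 3 + 1) :=
  ⟨finrank_euclideanSpace_fin⟩

/-- The inclusion of the sphere. -/
def sphereIncl (x : Sphere3) : Euclid4 := x

theorem contMDiff_sphereIncl : ContMDiff (𝓡 3) 𝓘(ℝ, Euclid4) ∞ sphereIncl :=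
  have := fact_finrank_euclid4
  contMDiff_coe_sphere

theorem norm_sphereIncl (x : Sphere3) : ‖sphereIncl x‖ = 1 := norm_eq_of_mem_sphere x

theorem sphereIncl_ne_zero (x : Sphere3) : sphereIncl x ≠ 0 := by
  rw [← norm_ne_zero_iff, norm_sphereIncl]
  exact one_ne_zero

theorem inner_sphereIncl_self (x : Sphere3) : inner ℝ (sphereIncl x) (sphereIncl x) = 1 := by
  rw [real_inner_self_eq_norm_sq, norm_sphereIncl, one_pow]

theorem normalize_mem_sphere {y : Euclid4} (hy : y ≠ 0) :
    ‖y‖⁻¹ • y ∈ Metric.sphere (0 : Euclid4) 1 := by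
  rw [mem_sphere_zero_iff_norm, norm_smul, norm_inv, norm_norm,
    inv_mul_cancel₀ (norm_ne_zero_iff.2 hy)]

noncomputable instance instInhabitedSphere3 : Inhabited Sphere3 :=
  ⟨⟨EuclideanSpace.single 0 1, by simp⟩⟩

open Classical in
/-- The radial retraction to the sphere (with an arbitrary value at the origin). -/
noncomputable def toSphere (y : Euclid4) : Sphere3 :=
  if hy : y = 0 then default else ⟨‖y‖⁻¹ • y, normalize_mem_sphere hy⟩

theorem sphereIncl_toSphere {y : Euclid4} (hy : y ≠ 0) : sphereIncl (toSphere y) = ‖y‖⁻¹ • y := by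
  rw [toSphere, dif_neg hy]; rfl

theorem toSphere_sphereIncl (x : Sphere3) : toSphere (sphereIncl x) = x := by
  apply Subtype.ext
  have := sphereIncl_toSphere (sphereIncl_ne_zero x)
  rw [norm_sphereIncl, inv_one, one_smul] at this
  exact this

theorem toSphere_smul {c : ℝ} (hc : 0 < c) {y : Euclid4} (hy : y ≠ 0) :
    toSphere (c • y) = toSphere y := by
  apply Subtype.ext
  have h1 := sphereIncl_toSphere hy
  have h2 := sphereIncl_toSphere (smul_ne_zero hc.ne' hy)
  refine h2.trans (Eq.trans ?_ h1.symm)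
  rw [norm_smul, Real.norm_of_nonneg hc.le, smul_smul]
  congr 1
  field_simp

/-- Extending `f` to be constant on rays turns differentiation on `S³` into differentiation in an
open subset of `ℝ⁴`. -/
theorem contDiffOn_comp_toSphere {V : Type*} [NormedAddCommGroup V] [NormedSpace ℝ V]
    {f : Sphere3 → V} (hf : ContMDiff (𝓡 3) 𝓘(ℝ, V) ∞ f) :
    ContDiffOn ℝ ∞ (fun y => f (toSphere y)) {0}ᶜ := by
  let U : TopologicalSpace.Opens Euclid4 := ⟨{0}ᶜ, isOpen_compl_singleton⟩
  have h1 : ContMDiff 𝓘(ℝ, Euclid4) 𝓘(ℝ, Euclid4) ∞ fun u : U =>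
      ‖(u : Euclid4)‖⁻¹ • (u : Euclid4) := by
    intro u
    have hu : (u : Euclid4) ≠ 0 := u.2
    refine (contMDiffAt_subtype_iff (U := U) (f := fun y : Euclid4 => ‖y‖⁻¹ • y)).2 ?_
    apply ContDiffAt.contMDiffAt
    exact ((contDiffAt_norm ℝ hu).inv (norm_ne_zero_iff.2 hu)).smul contDiffAt_id
  have h2 : ContMDiff 𝓘(ℝ, Euclid4) (𝓡 3) ∞ fun u : U => toSphere (u : Euclid4) := by
    have := fact_finrank_euclid4
    have h3 := h1.codRestrict_sphere (n := 3) fun u => normalize_mem_sphere u.2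
    refine ContMDiff.congr h3 fun u => ?_
    have hu : (u : Euclid4) ≠ 0 := u.2
    rw [toSphere, dif_neg hu]
    rfl
  intro y hy
  apply ContDiffAt.contDiffWithinAt
  rw [← contMDiffAt_iff_contDiffAt]
  exact (contMDiffAt_subtype_iff (U := U) (x := ⟨y, hy⟩) (f := fun y : Euclid4 => f (toSphere y))).1
    ((hf.comp h2) ⟨y, hy⟩)

theorem hasFDerivAt_comp_toSphere {V : Type*} [NormedAddCommGroup V] [NormedSpace ℝ V]
    {f : Sphere3 → V} (hf : ContMDiff (𝓡 3) 𝓘(ℝ, V) ∞ f) {y : Euclid4} (hy : y ≠ 0) :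
    HasFDerivAt (fun y => f (toSphere y)) (fderiv ℝ (fun y => f (toSphere y)) y) y :=
  (((contDiffOn_comp_toSphere hf).contDiffAt (isOpen_compl_singleton.mem_nhds hy)).differentiableAt
    (by simp)).hasFDerivAt

/-- The differential of the inclusion of the sphere. -/
noncomputable abbrev sphereTangent (x : Sphere3) : EuclideanSpace ℝ (Fin 3) →L[ℝ] Euclid4 :=
  ambientDeriv (𝓡 3) sphereIncl x

theorem fderiv_comp_toSphere {V : Type*} [NormedAddCommGroup V] [NormedSpace ℝ V]
    {f : Sphere3 → V} (hf : ContMDiff (𝓡 3) 𝓘(ℝ, V) ∞ f) (x : Sphere3)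
    (u : EuclideanSpace ℝ (Fin 3)) :
    fderiv ℝ (fun y => f (toSphere y)) (sphereIncl x) (sphereTangent x u) =
      ambientDeriv (𝓡 3) f x u := by
  have h1 : f = (fun y => f (toSphere y)) ∘ sphereIncl := by
    funext x
    simp [toSphere_sphereIncl]
  have h2 : MDifferentiableAt 𝓘(ℝ, Euclid4) 𝓘(ℝ, V) (fun y => f (toSphere y)) (sphereIncl x) :=
    (hasFDerivAt_comp_toSphere hf (sphereIncl_ne_zero x)).differentiableAt.mdifferentiableAt
  have h3 := mfderiv_comp x h2 ((contMDiff_sphereIncl x).mdifferentiableAt (by simp))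
  rw [← h1, mfderiv_eq_fderiv] at h3
  exact (DFunLike.congr_fun h3 u).symm

theorem range_sphereTangent (x : Sphere3) (w : Euclid4) :
    (∃ u, sphereTangent x u = w) ↔ inner ℝ (sphereIncl x) w = 0 := by
  have := fact_finrank_euclid4
  have h := range_mvfderiv_subtypeVal (n := 3) x
  have h2 : w ∈ (ℝ ∙ (x : Euclid4))ᗮ ↔ inner ℝ (sphereIncl x) w = 0 :=
    Submodule.mem_orthogonal_singleton_iff_inner_right
  rw [← h2, ← h]
  rfl

theorem inner_sphereTangent (x : Sphere3) (u : EuclideanSpace ℝ (Fin 3)) :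
    inner ℝ (sphereIncl x) (sphereTangent x u) = 0 :=
  (range_sphereTangent x _).1 ⟨u, rfl⟩

theorem injective_sphereTangent (x : Sphere3) : Function.Injective (sphereTangent x) :=
  have := fact_finrank_euclid4
  injective_mvfderiv_subtypeVal_sphere (n := 3) x

/-- The determinant on `ℝ⁴`. -/
noncomputable def det4 : Euclid4 [⋀^Fin (3 + 1)]→ₗ[ℝ] ℝ :=
  (EuclideanSpace.basisFun (Fin (3 + 1)) ℝ).toBasis.det

theorem det4_ne_zero : det4 ≠ 0 := Module.Basis.det_ne_zero _

/-- An orientation of the sphere is, up to a locally constant sign, given by the determinant with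
the outer normal as the last vector. -/
theorem exists_sphere_sign (oS : ManifoldOrientation (𝓡 3) Sphere3) :
    ∃ ε : Sphere3 → SignType, (∀ x, ε x ≠ 0) ∧ (∀ x₀, ∀ᶠ x in 𝓝 x₀, ε x = ε x₀) ∧
      ∀ x (v : Fin 3 → EuclideanSpace ℝ (Fin 3)), orSign (oS.orientAt x) v =
        ε x * SignType.sign
          (det4 (Fin.append (fun i => sphereTangent x (v i)) ![sphereIncl x])) := by
  refine ManifoldOrientation.exists_sign contMDiff_sphereIncl oS
    (fun x => det4.fixRight ![sphereIncl x]) (fun x₀ w hw => ?_) fun x => ?_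
  · refine (continuous_topForm (by simp) det4).continuousAt.comp
      (f := fun x => Fin.append (w x) ![sphereIncl x]) ?_
    rw [continuousAt_pi] at hw ⊢
    intro i
    refine Fin.addCases (fun j => ?_) (fun j => ?_) i
    · simpa using hw j
    · simpa using contMDiff_sphereIncl.continuous.continuousAt
  · let b := (EuclideanSpace.basisFun (Fin 3) ℝ).toBasis
    refine ⟨b, (topForm_ne_zero_iff (by simp) det4_ne_zero _).2
      (linearIndependent_append (innerₛₗ ℝ (sphereIncl x)) ?_ (fun i => ?_) ?_)⟩
    · exact b.linearIndependent.map' (sphereTangent x : EuclideanSpace ℝ (Fin 3) →ₗ[ℝ] Euclid4)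
        (LinearMap.ker_eq_bot.2 (injective_sphereTangent x))
    · exact inner_sphereTangent x _
    · refine LinearIndependent.of_subsingleton 0 ?_
      simp [sphereIncl_ne_zero]

/-- The extension of a self-map of the sphere to `ℝ⁴` which is homogeneous of degree one. -/
noncomputable def coneMap (φ : Sphere3 → Sphere3) (y : Euclid4) : Euclid4 :=
  ‖y‖ • sphereIncl (φ (toSphere y))

section ConeMap

variable {φ : Sphere3 → Sphere3}

theorem coneMap_sphereIncl (φ : Sphere3 → Sphere3) (x : Sphere3) :
    coneMap φ (sphereIncl x) = sphereIncl (φ x) := by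
  rw [coneMap, norm_sphereIncl, one_smul, toSphere_sphereIncl]

theorem norm_coneMap (φ : Sphere3 → Sphere3) (y : Euclid4) : ‖coneMap φ y‖ = ‖y‖ := by
  rw [coneMap, norm_smul, norm_norm, norm_sphereIncl, mul_one]

theorem toSphere_coneMap (φ : Sphere3 → Sphere3) {y : Euclid4} (hy : y ≠ 0) :
    toSphere (coneMap φ y) = φ (toSphere y) := by
  rw [coneMap, toSphere_smul (norm_pos_iff.2 hy) (sphereIncl_ne_zero _), toSphere_sphereIncl]

theorem contDiffOn_coneMap (hφ : ContMDiff (𝓡 3) (𝓡 3) ∞ φ) :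
    ContDiffOn ℝ ∞ (coneMap φ) {0}ᶜ := by
  intro y hy
  exact (contDiffAt_norm ℝ hy).contDiffWithinAt.smul
    (contDiffOn_comp_toSphere (contMDiff_sphereIncl.comp hφ) y hy)

theorem hasFDerivAt_coneMap (hφ : ContMDiff (𝓡 3) (𝓡 3) ∞ φ) {y : Euclid4} (hy : y ≠ 0) :
    HasFDerivAt (coneMap φ) (fderiv ℝ (coneMap φ) y) y :=
  (((contDiffOn_coneMap hφ).contDiffAt (isOpen_compl_singleton.mem_nhds hy)).differentiableAt
    (by simp)).hasFDerivAt

/-- By homogeneity the cone map is linear along the ray through `x`. -/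
theorem fderiv_coneMap_self (hφ : ContMDiff (𝓡 3) (𝓡 3) ∞ φ) (x : Sphere3) :
    fderiv ℝ (coneMap φ) (sphereIncl x) (sphereIncl x) = sphereIncl (φ x) := by
  have h1 : HasDerivAt (fun c : ℝ => c • sphereIncl x) (sphereIncl x) 1 := by
    simpa using (hasDerivAt_id (1 : ℝ)).smul_const (sphereIncl x)
  have h2 := hasFDerivAt_coneMap hφ (sphereIncl_ne_zero x)
  have h3 : HasDerivAt (fun c : ℝ => coneMap φ (c • sphereIncl x))
      (fderiv ℝ (coneMap φ) (sphereIncl x) (sphereIncl x)) 1 := by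
    have h5 : HasFDerivAt (coneMap φ) (fderiv ℝ (coneMap φ) (sphereIncl x))
        ((fun c : ℝ => c • sphereIncl x) 1) := by simpa using h2
    exact h5.comp_hasDerivAt (1 : ℝ) h1
  have h4 : HasDerivAt (fun c : ℝ => c • sphereIncl (φ x)) (sphereIncl (φ x)) 1 := by
    simpa using (hasDerivAt_id (1 : ℝ)).smul_const (sphereIncl (φ x))
  refine h3.unique (h4.congr_of_eventuallyEq ?_)
  filter_upwards [lt_mem_nhds (zero_lt_one' ℝ)] with c hc
  rw [coneMap, toSphere_smul hc (sphereIncl_ne_zero x), toSphere_sphereIncl, norm_smul,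
    norm_sphereIncl, mul_one, Real.norm_of_nonneg hc.le]

/-- Differentiate `‖coneMap φ y‖² = ‖y‖²`. This says that the cone map respects the differential of
the sphere's equation, which `diff_smul` needs. -/
theorem inner_fderiv_coneMap (hφ : ContMDiff (𝓡 3) (𝓡 3) ∞ φ) (x : Sphere3) (w : Euclid4) :
    inner ℝ (sphereIncl (φ x)) (fderiv ℝ (coneMap φ) (sphereIncl x) w) =
      inner ℝ (sphereIncl x) w := by
  have h2 := (hasFDerivAt_coneMap hφ (sphereIncl_ne_zero x)).norm_sq
  have h3 : HasFDerivAt (fun y : Euclid4 => ‖y‖ ^ 2) (2 • innerSL ℝ (sphereIncl x))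
    (sphereIncl x) := (hasStrictFDerivAt_norm_sq (sphereIncl x)).hasFDerivAt
  have h4 : (fun y => ‖coneMap φ y‖ ^ 2) = fun y : Euclid4 => ‖y‖ ^ 2 := by
    funext y; rw [norm_coneMap]
  rw [h4] at h2
  have h5 := DFunLike.congr_fun (h2.unique h3) w
  simpa [coneMap_sphereIncl] using h5

theorem sphereTangent_ambient (hφ : ContMDiff (𝓡 3) (𝓡 3) ∞ φ) (x : Sphere3)
    (u : TangentSpace (𝓡 3) x) :
    sphereTangent (φ x) (mfderiv (𝓡 3) (𝓡 3) φ x u) =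
      fderiv ℝ (coneMap φ) (sphereIncl x) (sphereTangent x u) := by
  have h1 : sphereIncl ∘ φ = coneMap φ ∘ sphereIncl := by
    funext x; simp [coneMap_sphereIncl]
  have h2 := mfderiv_comp x ((contMDiff_sphereIncl (φ x)).mdifferentiableAt (by simp))
    ((hφ x).mdifferentiableAt (by simp))
  have h3 := mfderiv_comp (I' := 𝓘(ℝ, Euclid4)) x
    (hasFDerivAt_coneMap hφ (sphereIncl_ne_zero x)).differentiableAt.mdifferentiableAt
    ((contMDiff_sphereIncl x).mdifferentiableAt (by simp))
  rw [← h1, h2, mfderiv_eq_fderiv] at h3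
  exact DFunLike.congr_fun h3 u

/-- The differential of the cone map carries a frame of tangent vectors and the normal at `x` to
such a frame at `φ x`. As `φ` preserves `oS`, the sign of its determinant only records the change of
the comparison sign `ε`. -/
theorem sign_det_fderiv_coneMap (oS : ManifoldOrientation (𝓡 3) Sphere3)
    {ε : Sphere3 → SignType} (hε : ∀ x, ε x ≠ 0)
    (hεo : ∀ x (v : Fin 3 → EuclideanSpace ℝ (Fin 3)), orSign (oS.orientAt x) v =
        ε x * SignType.sign
          (det4 (Fin.append (fun i => sphereTangent x (v i)) ![sphereIncl x])))
    (hφ : ContMDiff (𝓡 3) (𝓡 3) ∞ φ)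
    (hpres : ∀ (x : Sphere3) (v : Fin 3 → TangentSpace (𝓡 3) x),
      orSign (oS.orient (φ x)) (fun i => mfderiv (𝓡 3) (𝓡 3) φ x (v i)) = orSign (oS.orient x) v)
    (x : Sphere3) :
    SignType.sign (LinearMap.det (fderiv ℝ (coneMap φ) (sphereIncl x) : Euclid4 →ₗ[ℝ] Euclid4)) =
      ε x * ε (φ x) := by
  let b := (EuclideanSpace.basisFun (Fin 3) ℝ).toBasis
  let T : EuclideanSpace ℝ (Fin 3) → EuclideanSpace ℝ (Fin 3) := mfderiv (𝓡 3) (𝓡 3) φ x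
  let A : Euclid4 →ₗ[ℝ] Euclid4 := fderiv ℝ (coneMap φ) (sphereIncl x)
  have h1 : orSign (oS.orientAt (φ x)) (fun i => T (b i)) = orSign (oS.orientAt x) b := hpres x b
  have hb : orSign (oS.orientAt x) b ≠ 0 :=
    (orSign_ne_zero_iff (by simp) _ _).2 b.linearIndependent
  have h3 : Fin.append (fun i => sphereTangent (φ x) (T (b i))) ![sphereIncl (φ x)] =
      fun i => A (Fin.append (fun i => sphereTangent x (b i)) ![sphereIncl x] i) := by
    ext1 i
    refine Fin.addCases (fun j => ?_) (fun j => ?_) i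
    · rw [Fin.append_left, Fin.append_left]
      exact sphereTangent_ambient hφ x (b j)
    · rw [Fin.append_right, Fin.append_right]
      fin_cases j
      exact (fderiv_coneMap_self hφ x).symm
  rw [hεo, h3, topForm_comp (by simp) det4, sign_mul, hεo x] at h1
  rw [hεo x] at hb
  change SignType.sign (LinearMap.det A) = _
  have h6 := hε x
  have h7 := hε (φ x)
  generalize SignType.sign (LinearMap.det A) = s1 at *
  generalize SignType.sign (det4 _) = s2 at *
  generalize ε x = e1 at *
  generalize ε (φ x) = e2 at *
  clear * - h1 hb h6 h7
  revert s1 s2 e1 e2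
  decide

end ConeMap

end SphereCalculus

/-! ### Equivariant systems of equations and their zero sets. -/

section LevelSystems

/-- The determinant on `ℝ²`. -/
noncomputable def det2 : (Fin 2 → ℝ) [⋀^Fin 2]→ₗ[ℝ] ℝ := Matrix.detRowAlternating

theorem det2_apply (a b : Fin 2 → ℝ) : det2 ![a, b] = a 0 * b 1 - a 1 * b 0 := by
  change Matrix.det (Matrix.of ![a, b]) = _
  rw [Matrix.det_fin_two]
  simp

/-- The determinant on `ℝ² × ℝ`. -/
noncomputable def det21 : ((Fin 2 → ℝ) × ℝ) [⋀^Fin 3]→ₗ[ℝ] ℝ :=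
  (Matrix.detRowAlternating (n := Fin 3) (R := ℝ)).compLinearMap
    { toFun := fun p => ![p.1 0, p.1 1, p.2]
      map_add' := fun p q => by ext i; fin_cases i <;> simp
      map_smul' := fun c p => by ext i; fin_cases i <;> simp }

/-- The matrix is block triangular. The third vector will be the radial one, so that the sphere's
equation drops out of orientation computations. -/
theorem det21_apply (a b : Fin 2 → ℝ) (p : (Fin 2 → ℝ) × ℝ) :
    det21 ![(a, 0), (b, 0), p] = det2 ![a, b] * p.2 := by
  rw [det2_apply]
  let e : (Fin 2 → ℝ) × ℝ → Fin 3 → ℝ := fun q => ![q.1 0, q.1 1, q.2]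
  change Matrix.det (Matrix.of fun i => e (![(a, 0), (b, 0), p] i)) = _
  rw [Matrix.det_fin_three]
  simp [e]
  ring

theorem det21_ne_zero : det21 ≠ 0 := by
  intro h
  have h1 := det21_apply ![1, 0] ![0, 1] (0, 1)
  rw [h, det2_apply] at h1
  simp at h1

/-- A family of equivariant equations on the sphere, with parameters in a subset of the vector
space `B`, with values in `ℝ²` and regular zeros. -/
structure LevelSystem (G : Type*) [Group G] [MulAction G Sphere3] (B : Type)
    [NormedAddCommGroup B] [NormedSpace ℝ B] (k : ℕ) [MulAction G (Fin k)] where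
  base : Set B
  isCompact_base : IsCompact base
  eqn : Fin k → B → Sphere3 → Fin 2 → ℝ
  contDiffOn : ∀ r, ContDiffOn ℝ ∞ (fun p : B × Euclid4 => eqn r p.1 (toSphere p.2))
    (Set.univ ×ˢ {0}ᶜ)
  equivariant : ∀ (g : G) r, ∃ C : (Fin 2 → ℝ) →L[ℝ] (Fin 2 → ℝ),
    0 < LinearMap.det (C : (Fin 2 → ℝ) →ₗ[ℝ] (Fin 2 → ℝ)) ∧
      ∀ b x, eqn (g • r) b (g • x) = C (eqn r b x)
  regular : ∀ r, ∀ b ∈ base, ∀ x, eqn r b x = 0 → ∀ v, ∃ w : B × Euclid4,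
    inner ℝ (sphereIncl x) w.2 = 0 ∧
      fderiv ℝ (fun p : B × Euclid4 => eqn r p.1 (toSphere p.2)) (b, sphereIncl x) w = v

namespace LevelSystem

variable {G : Type*} [Group G] [MulAction G Sphere3] {B : Type}
    [NormedAddCommGroup B] [NormedSpace ℝ B] {k : ℕ} [MulAction G (Fin k)]
    (L : LevelSystem G B k)

/-- The extension of the equations to the ambient space. -/
noncomputable def extEqn (r : Fin k) (p : B × Euclid4) : Fin 2 → ℝ := L.eqn r p.1 (toSphere p.2)

/-- The disjoint union of the zero sets of the equations. -/
def zeroSet : Set (Fin k × (B × Euclid4)) :=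
  -- The index is kept as a coordinate, so zero sets of different equations are disjoint here even
  -- where they meet in `B × S³`.
  {z | z.2.1 ∈ L.base ∧ z.2.2 ∈ Metric.sphere (0 : Euclid4) 1 ∧ L.extEqn z.1 z.2 = 0}

/-- The point of the sphere below a point of the zero set. -/
def spherePoint (z : L.zeroSet) : Sphere3 := ⟨z.1.2.2, z.2.2.1⟩

theorem sphereIncl_spherePoint (z : L.zeroSet) : sphereIncl (L.spherePoint z) = z.1.2.2 := rfl

theorem toSphere_spherePoint (z : L.zeroSet) : toSphere z.1.2.2 = L.spherePoint z := by
  rw [← L.sphereIncl_spherePoint, toSphere_sphereIncl]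

theorem eqn_eq_zero (z : L.zeroSet) : L.eqn z.1.1 z.1.2.1 (L.spherePoint z) = 0 := by
  rw [← toSphere_spherePoint]
  exact z.2.2.2

theorem continuous_spherePoint : Continuous L.spherePoint :=
  (continuous_snd.comp (continuous_snd.comp continuous_subtype_val)).subtype_mk _

theorem extEqn_contDiffOn (r : Fin k) :
    ContDiffOn ℝ ∞ (L.extEqn r) (Set.univ ×ˢ {0}ᶜ) := L.contDiffOn r

theorem isOpen_domain {B : Type*} [TopologicalSpace B] :
    IsOpen (Set.univ ×ˢ {0}ᶜ : Set (B × Euclid4)) :=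
  isOpen_univ.prod isOpen_compl_singleton

theorem mem_domain (z : L.zeroSet) : z.1.2 ∈ (Set.univ ×ˢ {0}ᶜ : Set (B × Euclid4)) :=
  ⟨trivial, sphereIncl_ne_zero (L.spherePoint z)⟩

/-- All the equations of the zero set, including that of the sphere. -/
noncomputable def fullEqn (r : Fin k) (p : B × Euclid4) : (Fin 2 → ℝ) × ℝ :=
  -- The factor `1 / 2` makes the differential of the second component the inner product with `p.2`.
  (L.extEqn r p, (‖p.2‖ ^ 2 - 1) / 2)

theorem fullEqn_contDiffOn (r : Fin k) :
    ContDiffOn ℝ ∞ (L.fullEqn r) (Set.univ ×ˢ {0}ᶜ) := by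
  refine (L.extEqn_contDiffOn r).prodMk (ContDiff.contDiffOn ?_)
  exact ((contDiff_snd.norm_sq ℝ).sub contDiff_const).div_const _

theorem mem_zeroSet_iff (r : Fin k) (p : B × Euclid4) :
    (r, p) ∈ L.zeroSet ↔ p.1 ∈ L.base ∧ L.fullEqn r p = 0 := by
  have h : p.2 ∈ Metric.sphere (0 : Euclid4) 1 ↔ (‖p.2‖ ^ 2 - 1) / 2 = 0 := by
    rw [mem_sphere_zero_iff_norm]
    constructor
    · intro h; rw [h]; norm_num
    · intro h
      have h1 : ‖p.2‖ ^ 2 = 1 := by linarith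
      nlinarith [norm_nonneg p.2]
  simp only [zeroSet, Set.mem_ofPred_eq, fullEqn, Prod.mk_eq_zero, h]
  tauto

/-- The differential of the equations at a point of the zero set. -/
noncomputable def diff (z : L.zeroSet) : B × Euclid4 →L[ℝ] (Fin 2 → ℝ) × ℝ :=
  (fderiv ℝ (L.extEqn z.1.1) z.1.2).prod
    ((innerSL ℝ z.1.2.2).comp (ContinuousLinearMap.snd ℝ B Euclid4))

theorem diff_apply (z : L.zeroSet) (w : B × Euclid4) :
    L.diff z w = (fderiv ℝ (L.extEqn z.1.1) z.1.2 w, inner ℝ z.1.2.2 w.2) := rfl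

theorem hasFDerivAt_extEqn (z : L.zeroSet) :
    HasFDerivAt (L.extEqn z.1.1) (fderiv ℝ (L.extEqn z.1.1) z.1.2) z.1.2 :=
  (((L.extEqn_contDiffOn z.1.1).contDiffAt (isOpen_domain.mem_nhds
    (L.mem_domain z))).differentiableAt (by simp)).hasFDerivAt

theorem hasFDerivAt_fullEqn (z : L.zeroSet) :
    HasFDerivAt (L.fullEqn z.1.1) (L.diff z) z.1.2 := by
  refine (L.hasFDerivAt_extEqn z).prodMk ?_
  have h := (((hasFDerivAt_snd (𝕜 := ℝ) (p := z.1.2)).norm_sq).sub_const 1).const_mul (1 / 2 : ℝ)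
  refine (h.congr_of_eventuallyEq ?_).congr_fderiv ?_
  · exact Filter.Eventually.of_forall fun p => by simp; ring
  · ext w <;> simp

/-- Regularity provides a vector tangent to the sphere for the first component; a radial vector
adjusts the second, its effect on the first being subtracted beforehand. -/
theorem surjective_diff (z : L.zeroSet) : Function.Surjective (L.diff z) := by
  rintro ⟨v, c⟩
  obtain ⟨w, hw, hv⟩ := L.regular z.1.1 z.1.2.1 z.2.1 (L.spherePoint z) (L.eqn_eq_zero z)
    (v - fderiv ℝ (L.extEqn z.1.1) z.1.2 (0, c • z.1.2.2))
  refine ⟨w + (0, c • z.1.2.2), ?_⟩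
  rw [map_add, diff_apply, diff_apply]
  have h1 : fderiv ℝ (L.extEqn z.1.1) z.1.2 w =
    v - fderiv ℝ (L.extEqn z.1.1) z.1.2 (0, c • z.1.2.2) := hv
  have h2 : inner ℝ z.1.2.2 w.2 = 0 := hw
  have h3 : inner ℝ z.1.2.2 z.1.2.2 = (1 : ℝ) := inner_sphereIncl_self (L.spherePoint z)
  rw [h1, h2]
  simp only [real_inner_smul_right, h3]
  ext <;> simp

theorem continuous_diff : Continuous L.diff := by
  have h1 : ∀ r, ContinuousOn (fderiv ℝ (L.extEqn r)) (Set.univ ×ˢ {0}ᶜ) := fun r =>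
    (L.extEqn_contDiffOn r).continuousOn_fderiv_of_isOpen isOpen_domain (by simp)
  have h2 : Continuous fun z : L.zeroSet => fderiv ℝ (L.extEqn z.1.1) z.1.2 := by
    rw [continuous_iff_continuousAt]
    intro z
    have h3 : ContinuousAt (fun y : L.zeroSet => fderiv ℝ (L.extEqn z.1.1) y.1.2) z :=
      ContinuousAt.comp (f := fun y : L.zeroSet => y.1.2)
        ((h1 z.1.1).continuousAt (isOpen_domain.mem_nhds (L.mem_domain z)))
        (continuous_ambientMap L.zeroSet).continuousAt
    refine h3.congr ?_
    -- The index is locally constant on the zero set, so near `z` a single equation suffices.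
    have h4 : ∀ᶠ y : L.zeroSet in 𝓝 z, y.1.1 = z.1.1 :=
      (continuous_fst.comp continuous_subtype_val).continuousAt.eventually
        ((isOpen_discrete {z.1.1}).mem_nhds rfl)
    filter_upwards [h4] with y hy
    rw [hy]
  have h5 : Continuous fun z : L.zeroSet =>
      (innerSL ℝ z.1.2.2).comp (ContinuousLinearMap.snd ℝ B Euclid4) :=
    (((innerSL ℝ).continuous.comp (continuous_snd.comp (continuous_ambientMap L.zeroSet)))).clm_comp
      continuous_const
  let e : (B × Euclid4 →L[ℝ] Fin 2 → ℝ) × (B × Euclid4 →L[ℝ] ℝ) ≃ₗᵢ[ℝ]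
    B × Euclid4 →L[ℝ] (Fin 2 → ℝ) × ℝ := ContinuousLinearMap.prodₗᵢ ℝ
  exact e.continuous.comp (h2.prodMk h5)

theorem isCompact_zeroSet : IsCompact L.zeroSet := by
  have h1 : IsCompact ((Set.univ : Set (Fin k)) ×ˢ (L.base ×ˢ Metric.sphere (0 : Euclid4) 1)) :=
    isCompact_univ.prod (L.isCompact_base.prod (isCompact_sphere _ _))
  have h2 : L.zeroSet = ((Set.univ : Set (Fin k)) ×ˢ (L.base ×ˢ Metric.sphere (0 : Euclid4) 1)) ∩
      {z | L.extEqn z.1 z.2 = 0} := by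
    ext z
    simp [zeroSet, and_assoc]
  rw [h2]
  refine h1.of_isClosed_subset ?_ Set.inter_subset_left
  have h3 : ContinuousOn (fun z : Fin k × (B × Euclid4) => L.extEqn z.1 z.2)
      ((Set.univ : Set (Fin k)) ×ˢ (L.base ×ˢ Metric.sphere (0 : Euclid4) 1)) := by
    rintro ⟨r, p⟩ ⟨-, hp⟩
    have hp' : p ∈ (Set.univ ×ˢ {0}ᶜ : Set (B × Euclid4)) :=
      ⟨trivial, sphereIncl_ne_zero ⟨p.2, hp.2⟩⟩
    have h4 : ContinuousAt (fun z : Fin k × (B × Euclid4) => L.extEqn r z.2) (r, p) :=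
      ContinuousAt.comp (f := fun z : Fin k × (B × Euclid4) => z.2)
        ((L.extEqn_contDiffOn r).continuousOn.continuousAt (isOpen_domain.mem_nhds hp'))
        continuousAt_snd
    refine (h4.congr ?_).continuousWithinAt
    filter_upwards [continuousAt_fst.eventually ((isOpen_discrete {r}).mem_nhds rfl)] with y hy
    have : y.1 = r := hy
    rw [this]
  exact h3.preimage_isClosed_of_isClosed h1.isClosed isClosed_singleton

theorem extEqn_coneMap (g : G) (r : Fin k) {C : (Fin 2 → ℝ) →L[ℝ] (Fin 2 → ℝ)}
    (hC : ∀ b x, L.eqn (g • r) b (g • x) = C (L.eqn r b x)) {p : B × Euclid4} (hp : p.2 ≠ 0) :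
    L.extEqn (g • r) (p.1, coneMap (fun x => g • x) p.2) = C (L.extEqn r p) := by
  simp only [extEqn]
  rw [toSphere_coneMap _ hp, hC]

/-- The group permutes the indices, moves the point of the sphere and fixes the parameter. Zeros go
to zeros because the equations at `r` and `g • r` differ by a linear map. -/
instance instMulActionZeroSet : MulAction G L.zeroSet where
  smul g z := ⟨(g • z.1.1, (z.1.2.1, sphereIncl (g • L.spherePoint z))), by
    obtain ⟨C, -, hC⟩ := L.equivariant g z.1.1
    refine ⟨z.2.1, (g • L.spherePoint z).2, ?_⟩
    change L.eqn _ _ (toSphere (sphereIncl _)) = 0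
    rw [toSphere_sphereIncl, hC]
    change C (L.eqn z.1.1 z.1.2.1 (L.spherePoint z)) = 0
    rw [L.eqn_eq_zero, map_zero]⟩
  one_smul z := by
    apply Subtype.ext
    change ((1 : G) • z.1.1, (z.1.2.1, sphereIncl ((1 : G) • L.spherePoint z))) = z.1
    rw [one_smul, one_smul]
    rfl
  mul_smul g h z := by
    apply Subtype.ext
    change ((g * h) • z.1.1, (z.1.2.1, sphereIncl ((g * h) • L.spherePoint z))) =
      (g • h • z.1.1, (z.1.2.1, sphereIncl (g • h • L.spherePoint z)))
    rw [mul_smul, mul_smul]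

theorem spherePoint_smul (g : G) (z : L.zeroSet) :
    L.spherePoint (g • z) = g • L.spherePoint z := rfl

end LevelSystem

end LevelSystems

/-! ### Zero sets of level systems as oriented `G`-manifolds. -/

namespace LevelSystem

variable {G : Type*} [Group G] [MulAction G Sphere3] {B : Type}
    [NormedAddCommGroup B] [NormedSpace ℝ B] {k : ℕ} [MulAction G (Fin k)]
    (L : LevelSystem G B k)

theorem contMDiff_spherePoint {n : ℕ} {H : Type*} [TopologicalSpace H]
    {I : ModelWithCorners ℝ (EuclideanSpace ℝ (Fin n)) H} {N : Type*} [TopologicalSpace N]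
    [ChartedSpace H N] [IsManifold I ∞ N] {a : N → L.zeroSet}
    (ha : ContMDiff I 𝓘(ℝ, B × Euclid4) ∞ fun x => ambientMap L.zeroSet (a x)) :
    ContMDiff I (𝓡 3) ∞ fun x => L.spherePoint (a x) := by
  have := fact_finrank_euclid4
  have h1 : ContMDiff I 𝓘(ℝ, Euclid4) ∞ fun x => (a x).1.2.2 :=
    contDiff_snd.contMDiff.comp ha
  exact h1.codRestrict_sphere (n := 3) fun x => (a x).2.2.1

theorem contMDiff_ambientMap_smul {n : ℕ} {H : Type*} [TopologicalSpace H]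
    {I : ModelWithCorners ℝ (EuclideanSpace ℝ (Fin n)) H} {N : Type*} [TopologicalSpace N]
    [ChartedSpace H N] [IsManifold I ∞ N] {a : N → L.zeroSet}
    (ha : ContMDiff I 𝓘(ℝ, B × Euclid4) ∞ fun x => ambientMap L.zeroSet (a x))
    {g : G} (hg : ContMDiff (𝓡 3) (𝓡 3) ∞ fun x : Sphere3 => g • x) :
    ContMDiff I 𝓘(ℝ, B × Euclid4) ∞ fun x => ambientMap L.zeroSet (g • a x) := by
  have h1 : ContMDiff I 𝓘(ℝ, B) ∞ fun x => (a x).1.2.1 := contDiff_fst.contMDiff.comp ha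
  exact h1.prodMk_space (contMDiff_sphereIncl.comp (hg.comp (L.contMDiff_spherePoint ha)))

theorem continuous_smul_zeroSet {g : G} (hg : Continuous fun x : Sphere3 => g • x) :
    Continuous fun z : L.zeroSet => g • z := by
  refine Continuous.subtype_mk (f := fun z : L.zeroSet =>
    (g • z.1.1, (z.1.2.1, sphereIncl (g • L.spherePoint z)))) ?_ _
  refine ((continuous_of_discreteTopology (f := fun r : Fin k => g • r)).comp
    (continuous_fst.comp continuous_subtype_val)).prodMk
    ((continuous_fst.comp (continuous_ambientMap L.zeroSet)).prodMk
      (contMDiff_sphereIncl.continuous.comp (hg.comp L.continuous_spherePoint)))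

/-- The linear map of the ambient space induced by the action of a group element. -/
noncomputable def ambientAction (g : G) (z : L.zeroSet) : B × Euclid4 →L[ℝ] B × Euclid4 :=
  (ContinuousLinearMap.id ℝ B).prodMap
    (fderiv ℝ (coneMap fun x : Sphere3 => g • x) (sphereIncl (L.spherePoint z)))

theorem det_ambientAction [FiniteDimensional ℝ B] (g : G) (z : L.zeroSet) :
    LinearMap.det (L.ambientAction g z : B × Euclid4 →ₗ[ℝ] B × Euclid4) =
      LinearMap.det (fderiv ℝ (coneMap fun x : Sphere3 => g • x) (sphereIncl (L.spherePoint z)) :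
        Euclid4 →ₗ[ℝ] Euclid4) := by
  have : (L.ambientAction g z : B × Euclid4 →ₗ[ℝ] B × Euclid4) =
      LinearMap.prodMap LinearMap.id (fderiv ℝ (coneMap fun x : Sphere3 => g • x)
        (sphereIncl (L.spherePoint z)) : Euclid4 →ₗ[ℝ] Euclid4) := rfl
  rw [this, LinearMap.det_prodMap, LinearMap.det_id, one_mul]

theorem hasFDerivAt_ambientAction {g : G} (hg : ContMDiff (𝓡 3) (𝓡 3) ∞ fun x : Sphere3 => g • x)
    (z : L.zeroSet) :
    HasFDerivAt (Prod.map id (coneMap fun x : Sphere3 => g • x) : B × Euclid4 → B × Euclid4)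
      (L.ambientAction g z) z.1.2 :=
  HasFDerivAt.prodMap z.1.2 (hasFDerivAt_id _)
    (hasFDerivAt_coneMap hg (sphereIncl_ne_zero (L.spherePoint z)))

/-- Differentiate the equivariance relation `extEqn_coneMap`. The factor on the sphere's equation is
the identity, so the determinant is that of the map of `ℝ²`. -/
theorem diff_smul {g : G} (hg : ContMDiff (𝓡 3) (𝓡 3) ∞ fun x : Sphere3 => g • x)
    (z : L.zeroSet) : ∃ C : (Fin 2 → ℝ) × ℝ →ₗ[ℝ] (Fin 2 → ℝ) × ℝ, 0 < LinearMap.det C ∧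
      ∀ v, L.diff (g • z) (L.ambientAction g z v) = C (L.diff z v) := by
  obtain ⟨C, hdet, hC⟩ := L.equivariant g z.1.1
  refine ⟨LinearMap.prodMap (C : (Fin 2 → ℝ) →ₗ[ℝ] Fin 2 → ℝ) LinearMap.id, ?_, fun v => ?_⟩
  · rw [LinearMap.det_prodMap, LinearMap.det_id, mul_one]
    exact hdet
  · rw [diff_apply, diff_apply]
    refine Prod.ext ?_ ?_
    · have h1 := L.hasFDerivAt_extEqn (g • z)
      have h2 : (g • z).1.2 = Prod.map id (coneMap fun x : Sphere3 => g • x) z.1.2 := by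
        refine Prod.ext rfl ?_
        exact (coneMap_sphereIncl (fun x : Sphere3 => g • x) (L.spherePoint z)).symm
      rw [h2] at h1
      have h3 := h1.comp z.1.2 (L.hasFDerivAt_ambientAction hg z)
      have h4 := (C.hasFDerivAt).comp z.1.2 (L.hasFDerivAt_extEqn z)
      have h5 : (L.extEqn (g • z).1.1 ∘ Prod.map id (coneMap fun x : Sphere3 => g • x)) =ᶠ[𝓝 z.1.2]
          C ∘ L.extEqn z.1.1 := by
        filter_upwards [isOpen_domain.mem_nhds (L.mem_domain z)] with p hp
        exact L.extEqn_coneMap g z.1.1 hC hp.2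
      have h6 := DFunLike.congr_fun (h3.unique (h4.congr_of_eventuallyEq h5)) v
      rw [h2]
      exact h6
    · exact inner_fderiv_coneMap hg (L.spherePoint z) v.2

section Charts

variable {d : ℕ} {H : Type} [TopologicalSpace H]
  {I : ModelWithCorners ℝ (EuclideanSpace ℝ (Fin d)) H}

theorem diff_ambientDeriv [ChartedSpace H L.zeroSet]
    (hι : ContMDiff I 𝓘(ℝ, B × Euclid4) ∞ (ambientMap L.zeroSet)) (z : L.zeroSet)
    (v : EuclideanSpace ℝ (Fin d)) :
    L.diff z (ambientDeriv I (ambientMap L.zeroSet) z v) = 0 := by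
  have h1 : HasMFDerivAt 𝓘(ℝ, B × Euclid4) 𝓘(ℝ, (Fin 2 → ℝ) × ℝ) (L.fullEqn z.1.1)
      (ambientMap L.zeroSet z) (L.diff z) := (L.hasFDerivAt_fullEqn z).hasMFDerivAt
  have h2 := h1.comp z ((hι z).mdifferentiableAt (by simp)).hasMFDerivAt
  have h3 : (L.fullEqn z.1.1 ∘ ambientMap L.zeroSet) =ᶠ[𝓝 z] fun _ => 0 := by
    have h4 : ∀ᶠ y : L.zeroSet in 𝓝 z, y.1.1 = z.1.1 :=
      (continuous_fst.comp continuous_subtype_val).continuousAt.eventually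
        ((isOpen_discrete {z.1.1}).mem_nhds rfl)
    filter_upwards [h4] with y hy
    rw [← hy]
    exact ((L.mem_zeroSet_iff y.1.1 y.1.2).1 y.2).2
  have h5 := (hasMFDerivAt_const (I := I) (I' := 𝓘(ℝ, (Fin 2 → ℝ) × ℝ))
    (0 : (Fin 2 → ℝ) × ℝ) z).congr_of_eventuallyEq h3
  exact DFunLike.congr_fun (hasMFDerivAt_unique h2 h5) v

theorem ambientDeriv_smul [ChartedSpace H L.zeroSet]
    (hι : ContMDiff I 𝓘(ℝ, B × Euclid4) ∞ (ambientMap L.zeroSet)) {g : G}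
    (hg : ContMDiff (𝓡 3) (𝓡 3) ∞ fun x : Sphere3 => g • x)
    (hg' : ContMDiff I I ∞ fun z : L.zeroSet => g • z) (z : L.zeroSet)
    (v : EuclideanSpace ℝ (Fin d)) :
    ambientDeriv I (ambientMap L.zeroSet) (g • z) (mfderiv I I (fun z : L.zeroSet => g • z) z v) =
      L.ambientAction g z (ambientDeriv I (ambientMap L.zeroSet) z v) := by
  have h1 := ((hι (g • z)).mdifferentiableAt (by simp)).hasMFDerivAt.comp z
    ((hg' z).mdifferentiableAt (by simp)).hasMFDerivAt
  have h2 : HasMFDerivAt 𝓘(ℝ, B × Euclid4) 𝓘(ℝ, B × Euclid4) _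
      (ambientMap L.zeroSet z) (L.ambientAction g z) :=
    (L.hasFDerivAt_ambientAction hg z).hasMFDerivAt
  have h3 := h2.comp z ((hι z).mdifferentiableAt (by simp)).hasMFDerivAt
  have h4 : ambientMap L.zeroSet ∘ (fun z : L.zeroSet => g • z) =
      Prod.map id (coneMap fun x : Sphere3 => g • x) ∘ ambientMap L.zeroSet := by
    funext y
    refine Prod.ext rfl ?_
    exact (coneMap_sphereIncl (fun x : Sphere3 => g • x) (L.spherePoint y)).symm
  rw [h4] at h1
  exact DFunLike.congr_fun (hasMFDerivAt_unique h1 h3) v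

/-- The zero set of a level system is an oriented `G`-manifold. -/
theorem exists_orientedGManifold [FiniteDimensional ℝ B] (hd : Module.finrank ℝ B + 1 = d)
    (oS : ManifoldOrientation (𝓡 3) Sphere3) (hS : IsFreeOrientedAction G (𝓡 3) oS)
    {ε : Sphere3 → SignType} (hε : ∀ x, ε x ≠ 0) (hεc : ∀ x₀, ∀ᶠ x in 𝓝 x₀, ε x = ε x₀)
    (hεo : ∀ x (v : Fin 3 → EuclideanSpace ℝ (Fin 3)), orSign (oS.orientAt x) v =
        ε x * SignType.sign
          (det4 (Fin.append (fun i => sphereTangent x (v i)) ![sphereIncl x])))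
    {Ω : (B × Euclid4) [⋀^Fin (d + 3)]→ₗ[ℝ] ℝ} (hΩ : Ω ≠ 0)
    (c : L.zeroSet → AmbientChart I (ambientMap L.zeroSet)) (hc : ∀ z, z ∈ (c z).chart.source) :
    ∃ (M : OrientedGManifold G I) (φ : M.carrier ≃ₜ L.zeroSet),
      ContMDiff I 𝓘(ℝ, B × Euclid4) ∞ (fun x => ambientMap L.zeroSet (φ x)) ∧
      (∀ (N : OrientedGManifold G (𝓡 1)) (a : N.carrier → M.carrier), Continuous a →
        ContMDiff (𝓡 1) 𝓘(ℝ, B × Euclid4) ∞ (fun x => ambientMap L.zeroSet (φ (a x))) →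
        ContMDiff (𝓡 1) I ∞ a) ∧
      (∀ (g : G) (x : M.carrier), φ (g • x) = g • φ x) ∧
      (∀ (x : M.carrier) v a,
        SignType.sign (Ω (Fin.append (fun i => ambientDeriv I
          (fun x => ambientMap L.zeroSet (φ x)) x (v i)) a)) =
          orSign (M.orientation.orientAt x) v *
            (ε (L.spherePoint (φ x)) * SignType.sign (det21 fun i => L.diff (φ x) (a i)))) ∧
      (∀ x : M.carrier, extChartAt I x x = (c (φ x)).coord (ambientMap L.zeroSet (φ x))) ∧
      (∀ (x : M.carrier) v, fderiv ℝ (c (φ x)).coord (ambientMap L.zeroSet (φ x))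
        (ambientDeriv I (fun x => ambientMap L.zeroSet (φ x)) x v) = v) := by
  let _ : ChartedSpace H L.zeroSet := AmbientChart.chartedSpace c hc
  have : IsManifold I ∞ L.zeroSet := AmbientChart.isManifold c hc
  have : CompactSpace L.zeroSet := isCompact_iff_compactSpace.1 L.isCompact_zeroSet
  have hι : ContMDiff I 𝓘(ℝ, B × Euclid4) ∞ (ambientMap L.zeroSet) :=
    AmbientChart.contMDiff_ambient c hc (continuous_ambientMap _)
  have hleft : ∀ (x : L.zeroSet) v, fderiv ℝ (c x).coord (ambientMap L.zeroSet x)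
        (ambientDeriv I (ambientMap L.zeroSet) x v) = v :=
    AmbientChart.fderiv_coord_mfderiv c hc (continuous_ambientMap _)
  have hE : Module.finrank ℝ (B × Euclid4) = d + 3 := by
    rw [Module.finrank_prod, finrank_euclideanSpace_fin]
    omega
  have hK : Module.finrank ℝ ((Fin 2 → ℝ) × ℝ) = 3 := by simp
  have hε' : ∀ z, ε (L.spherePoint z) ≠ 0 := fun z => hε _
  obtain ⟨o, ho⟩ := exists_levelOrientation hι hE hK hΩ det21_ne_zero L.continuous_diff
    L.surjective_diff (L.diff_ambientDeriv hι)
    (fun x => Function.LeftInverse.injective (hleft x)) hε'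
    (fun z => L.continuous_spherePoint.continuousAt.eventually (hεc (L.spherePoint z)))
  have hsmooth : ∀ g : G, ContMDiff I I ∞ fun z : L.zeroSet => g • z := fun g =>
    AmbientChart.contMDiff_of_ambient c hc (L.continuous_smul_zeroSet (hS.smooth g).continuous)
      (L.contMDiff_ambientMap_smul hι (hS.smooth g))
  let M : OrientedGManifold G I :=
    { carrier := L.zeroSet
      orientation := o
      isFreeOrientedAction :=
        { smooth := hsmooth
          free := fun g z h => hS.free g (L.spherePoint z) (congrArg L.spherePoint h)
          preserves := fun g z v => by
            obtain ⟨C, hC0, hC⟩ := L.diff_smul (hS.smooth g) z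
            refine orSign_eq_of_ambient hE hK det21_ne_zero L.surjective_diff hε' o ho
              (x := z) (y := g • z) (L.ambientAction g z) C _
              (L.ambientDeriv_smul hι (hS.smooth g) (hsmooth g) z) hC hC0 ?_ v
            -- The parameter directions are fixed, so only the determinant of the cone map of `g`
            -- remains.
            rw [det_ambientAction]
            exact sign_det_fderiv_coneMap oS hε hεo (hS.smooth g) (hS.preserves g) _ } }
  exact ⟨M, Homeomorph.refl _, hι,
    fun N a ha ha' => AmbientChart.contMDiff_of_ambient c hc ha ha', fun g x => rfl, ho,
    fun x => AmbientChart.extChartAt_self c hc x, hleft⟩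

end Charts

end LevelSystem

/-! ### Charts of zero sets, in the interior and at the boundary. -/

/-- `Λ` is a projection onto `ker D` followed by linear coordinates there. It supplies the
coordinates of a chart of a level set whose equations have differential `D`. -/
theorem exists_bijective_prod {E K : Type*} [NormedAddCommGroup E] [NormedSpace ℝ E]
    [FiniteDimensional ℝ E] [NormedAddCommGroup K] [NormedSpace ℝ K] [FiniteDimensional ℝ K]
    {d : ℕ} (D : E →L[ℝ] K) (hD : Function.Surjective D)
    (hd : Module.finrank ℝ E = d + Module.finrank ℝ K) :
    ∃ Λ : E →L[ℝ] EuclideanSpace ℝ (Fin d), Function.Bijective (D.prod Λ) := by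
  let N := LinearMap.ker (D : E →ₗ[ℝ] K)
  have hN : Module.finrank ℝ N = d := by
    have : _ + Module.finrank ℝ N = _ := (D : E →ₗ[ℝ] K).finrank_range_add_finrank_ker
    rw [LinearMap.range_eq_top.2 hD, finrank_top] at this
    omega
  obtain ⟨p, hp⟩ := N.subtype.exists_leftInverse_of_injective (Submodule.ker_subtype N)
  let e : N ≃ₗ[ℝ] EuclideanSpace ℝ (Fin d) :=
    LinearEquiv.ofFinrankEq _ _ (by rw [hN, finrank_euclideanSpace_fin])
  let Λ : E →L[ℝ] EuclideanSpace ℝ (Fin d) := LinearMap.toContinuousLinearMap (e.toLinearMap ∘ₗ p)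
  have hinj : Function.Injective (D.prod Λ : E →ₗ[ℝ] K × EuclideanSpace ℝ (Fin d)) := by
    rw [← LinearMap.ker_eq_bot, LinearMap.ker_eq_bot']
    intro w hw
    have h1 : D w = 0 := congrArg Prod.fst hw
    have h2 : e (p w) = 0 := congrArg Prod.snd hw
    have h3 : p (N.subtype ⟨w, h1⟩) = ⟨w, h1⟩ := LinearMap.congr_fun hp ⟨w, h1⟩
    rw [e.map_eq_zero_iff] at h2
    have h4 : (⟨w, h1⟩ : N) = 0 := h3.symm.trans h2
    exact congrArg Subtype.val h4
  refine ⟨Λ, hinj, (LinearMap.injective_iff_surjective_of_finrank_eq_finrank ?_).1 hinj⟩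
  rw [Module.finrank_prod, hd, finrank_euclideanSpace_fin, add_comm]

namespace LevelSystem

variable {G : Type*} [Group G] [MulAction G Sphere3] {k : ℕ} [MulAction G (Fin k)]

theorem exists_ambientChart_of_base_univ {B : Type} [NormedAddCommGroup B] [NormedSpace ℝ B]
    [FiniteDimensional ℝ B] (L : LevelSystem G B k) (hL : L.base = Set.univ) {d : ℕ}
    (hd : Module.finrank ℝ B + 1 = d) (z : L.zeroSet) :
    ∃ c : AmbientChart (𝓡 d) (ambientMap L.zeroSet), z ∈ c.chart.source := by
  obtain ⟨Λ, hΛ⟩ := exists_bijective_prod (d := d) (L.diff z) (L.surjective_diff z) (by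
    rw [Module.finrank_prod, finrank_euclideanSpace_fin, Module.finrank_prod]
    simp
    omega)
  obtain ⟨c, hc, -⟩ := exists_ambientChart (𝓡 d) z (L.fullEqn z.1.1) isOpen_domain
    (L.mem_domain z) (L.fullEqn_contDiffOn _) Λ.contDiff (by
      rw [(L.hasFDerivAt_fullEqn z).fderiv, Λ.fderiv]
      exact hΛ) (fun p _ => by
      rw [L.mem_zeroSet_iff, hL]
      simp)
  exact ⟨c, hc⟩

/-- The level system over the interval is regular along the boundary of the interval. -/
def IsRegularAt (L : LevelSystem G ℝ k) (t : ℝ) : Prop :=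
  ∀ r x, L.eqn r t x = 0 → ∀ v, ∃ w : Euclid4,
    inner ℝ (sphereIncl x) w = 0 ∧ fderiv ℝ (L.extEqn r) (t, sphereIncl x) (0, w) = v

/-- Regularity of the slice makes the parameter independent of the equations, so that it can serve
as a coordinate on the zero set. -/
theorem surjective_diff_prod_fst (L : LevelSystem G ℝ k) (z : L.zeroSet)
    (hz : L.IsRegularAt z.1.2.1) :
    Function.Surjective ((L.diff z).prod (ContinuousLinearMap.fst ℝ ℝ Euclid4)) := by
  rintro ⟨v, τ⟩
  -- `w₀` gives the equations the right value but may move the parameter; regularity of the slice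
  -- yields a replacement with the same effect and no parameter component.
  obtain ⟨w₀, hw₀⟩ := L.surjective_diff z (v - L.diff z (τ, 0))
  rw [diff_apply] at hw₀
  let s : ℝ := inner ℝ z.1.2.2 w₀.2
  obtain ⟨w, hw, hv⟩ := hz z.1.1 (L.spherePoint z) (L.eqn_eq_zero z)
    (fderiv ℝ (L.extEqn z.1.1) z.1.2 w₀ - fderiv ℝ (L.extEqn z.1.1) z.1.2 (0, s • z.1.2.2))
  have hw' : inner ℝ z.1.2.2 w = 0 := hw
  have hv' : fderiv ℝ (L.extEqn z.1.1) z.1.2 (0, w) = _ := hv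
  have h3 : inner ℝ z.1.2.2 z.1.2.2 = (1 : ℝ) := inner_sphereIncl_self (L.spherePoint z)
  refine ⟨(τ, 0) + (0, w + s • z.1.2.2), ?_⟩
  refine Prod.ext ?_ ?_
  · have h4 : L.diff z (0, w + s • z.1.2.2) = v - L.diff z (τ, 0) := by
      rw [← hw₀, diff_apply]
      refine Prod.ext ?_ ?_
      · have h5 : ((0 : ℝ), w + s • z.1.2.2) = (0, w) + (0, s • z.1.2.2) := by simp
        simp only [h5, map_add, hv']
        abel
      · change inner ℝ z.1.2.2 (w + s • z.1.2.2) = s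
        rw [inner_add_right, real_inner_smul_right, hw', h3, zero_add, mul_one]
    change L.diff z _ = v
    rw [map_add, h4]
    abel
  · change τ + 0 = τ
    rw [add_zero]

/-- The linear map to the plane with the given components. -/
noncomputable def planeMap {E : Type*} [NormedAddCommGroup E] [NormedSpace ℝ E] (a b : E →L[ℝ] ℝ) :
    E →L[ℝ] EuclideanSpace ℝ (Fin 2) :=
  (EuclideanSpace.equiv (Fin 2) ℝ).symm.toContinuousLinearMap.comp
    (ContinuousLinearMap.pi ![a, b])

@[simp] theorem planeMap_zero {E : Type*} [NormedAddCommGroup E] [NormedSpace ℝ E]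
    (a b : E →L[ℝ] ℝ) (w : E) : planeMap a b w 0 = a w := rfl

/-- The parameter has nonzero differential on the two-dimensional kernel of `L.diff z`, and `b` is a
second coordinate there. The scalar `σ` will be `1` at the lower end and `-1` at the upper end, so
that the first coordinate grows inwards. -/
theorem exists_planeMap_bijective (L : LevelSystem G ℝ k) (z : L.zeroSet)
    (hz : L.IsRegularAt z.1.2.1) {σ : ℝ} (hσ : σ ≠ 0) :
    ∃ b : ℝ × Euclid4 →L[ℝ] ℝ, Function.Bijective
      ((L.diff z).prod (planeMap (σ • ContinuousLinearMap.fst ℝ ℝ Euclid4) b)) := by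
  obtain ⟨Λ, hΛ⟩ := exists_bijective_prod (d := 1) _ (L.surjective_diff_prod_fst z hz) (by
    simp only [Module.finrank_prod, finrank_euclideanSpace_fin]
    simp)
  let b : ℝ × Euclid4 →L[ℝ] ℝ := (EuclideanSpace.proj (0 : Fin 1)).comp Λ
  have hinj : Function.Injective ((L.diff z).prod
      (planeMap (σ • ContinuousLinearMap.fst ℝ ℝ Euclid4) b) :
        ℝ × Euclid4 →ₗ[ℝ] ((Fin 2 → ℝ) × ℝ) × EuclideanSpace ℝ (Fin 2)) := by
    rw [← LinearMap.ker_eq_bot, LinearMap.ker_eq_bot']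
    intro w hw
    have h1 : L.diff z w = 0 := congrArg Prod.fst hw
    have h2 : planeMap (σ • ContinuousLinearMap.fst ℝ ℝ Euclid4) b w = 0 := congrArg Prod.snd hw
    have h3 : σ * w.1 = 0 := congrArg (fun q : EuclideanSpace ℝ (Fin 2) => q 0) h2
    have h4 : Λ w 0 = 0 := congrArg (fun q : EuclideanSpace ℝ (Fin 2) => q 1) h2
    apply hΛ.1
    rw [map_zero]
    refine Prod.ext (Prod.ext h1 ?_) ?_
    · exact (mul_eq_zero.1 h3).resolve_left hσ
    · ext i
      rw [Subsingleton.elim i 0]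
      exact h4
  refine ⟨b, hinj, (LinearMap.injective_iff_surjective_of_finrank_eq_finrank ?_).1 hinj⟩
  simp only [Module.finrank_prod, finrank_euclideanSpace_fin]
  simp

/-- The first coordinate is `t` at the lower end, `1 - t` at the upper end and a locally positive
function elsewhere, so the half-plane condition reproduces `t ∈ [0, 1]`. The last two clauses will
decide the orientation of the boundary. -/
theorem exists_ambientChart_of_base_Icc (L : LevelSystem G ℝ k) (hL : L.base = Set.Icc 0 1)
    (h0 : L.IsRegularAt 0) (h1 : L.IsRegularAt 1) (z : L.zeroSet) :
    ∃ c : AmbientChart (𝓡∂ 2) (ambientMap L.zeroSet), z ∈ c.chart.source ∧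
      (c.coord z.1.2 0 = 0 ↔ z.1.2.1 = 0 ∨ z.1.2.1 = 1) ∧
      (z.1.2.1 = 0 → ∀ w, fderiv ℝ c.coord z.1.2 w 0 = w.1) ∧
      (z.1.2.1 = 1 → ∀ w, fderiv ℝ c.coord z.1.2 w 0 = - w.1) := by
  have key : ∀ (Λ : ℝ × Euclid4 →L[ℝ] EuclideanSpace ℝ (Fin 2)) (b : EuclideanSpace ℝ (Fin 2))
      (U : Set (ℝ × Euclid4)), Function.Bijective ((L.diff z).prod Λ) → IsOpen U → z.1.2 ∈ U →
      (∀ p ∈ U, p.1 ∈ Set.Icc (0 : ℝ) 1 ↔ 0 ≤ (Λ p + b) 0) →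
      ∃ c : AmbientChart (𝓡∂ 2) (ambientMap L.zeroSet), z ∈ c.chart.source ∧
        c.coord = fun p => Λ p + b := by
    intro Λ b U hΛ hU hz hUb
    refine exists_ambientChart (𝓡∂ 2) z (L.fullEqn z.1.1) (hU.inter isOpen_domain)
      ⟨hz, L.mem_domain z⟩ ((L.fullEqn_contDiffOn _).mono Set.inter_subset_right)
      (Λ.contDiff.add contDiff_const) ?_ fun p hp => ?_
    · rw [(L.hasFDerivAt_fullEqn z).fderiv, fderiv_add_const, Λ.fderiv]
      exact hΛ
    · rw [L.mem_zeroSet_iff, hL, hUb p hp.1, range_modelWithCornersEuclideanHalfSpace, and_comm]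
      rfl
  have hfd : ∀ (Λ : ℝ × Euclid4 →L[ℝ] EuclideanSpace ℝ (Fin 2)) (b : EuclideanSpace ℝ (Fin 2)) p,
      fderiv ℝ (fun p => Λ p + b) p = Λ := by
    intro Λ b p
    rw [fderiv_add_const, Λ.fderiv]
  have hzI : z.1.2.1 ∈ Set.Icc (0 : ℝ) 1 := by rw [← hL]; exact z.2.1
  rcases eq_or_lt_of_le hzI.1 with ht0 | ht0
  · obtain ⟨b, hb⟩ := L.exists_planeMap_bijective z (by rw [← ht0]; exact h0) one_ne_zero
    obtain ⟨c, hc, hcc⟩ := key _ 0 {p | p.1 < 1} hb (isOpen_lt continuous_fst continuous_const)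
      (by simp [← ht0]) (fun p hp => by
        have hp : p.1 < 1 := hp
        simp [hp.le])
    refine ⟨c, hc, ?_, fun _ w => ?_, fun h => ?_⟩
    · rw [hcc]; simp [← ht0]
    · rw [hcc, hfd]; simp
    · rw [← ht0] at h; norm_num at h
  rcases eq_or_lt_of_le hzI.2 with ht1 | ht1
  · obtain ⟨b, hb⟩ := L.exists_planeMap_bijective z (by rw [ht1]; exact h1)
      (neg_ne_zero.2 one_ne_zero)
    -- With `σ = -1` this shift makes the first coordinate `1 - t`.
    obtain ⟨c, hc, hcc⟩ := key _ (EuclideanSpace.single 0 1) {p | 0 < p.1} hb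
      (isOpen_lt continuous_const continuous_fst) ht0 (fun p hp => by
        have hp : 0 < p.1 := hp
        simp [hp.le])
    refine ⟨c, hc, ?_, fun h => ?_, fun _ w => ?_⟩
    · rw [hcc]; simp [ht1]
    · exact absurd h ht0.ne'
    · rw [hcc, hfd]; simp
  · obtain ⟨Λ, hΛ⟩ := exists_bijective_prod (d := 2) (L.diff z) (L.surjective_diff z) (by
      simp only [Module.finrank_prod, finrank_euclideanSpace_fin]
      simp)
    -- The shift gives the first coordinate the value `1` at `z`, away from the edge of the
    -- half-plane.
    let b : EuclideanSpace ℝ (Fin 2) := EuclideanSpace.single 0 (1 - Λ z.1.2 0)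
    have hb : (Λ z.1.2 + b) 0 = 1 := by simp [b]
    have hcont : Continuous fun p : ℝ × Euclid4 => (Λ p + b) 0 := by
      have h2 : Continuous fun q : EuclideanSpace ℝ (Fin 2) => q 0 :=
        (EuclideanSpace.proj (𝕜 := ℝ) (0 : Fin 2)).continuous
      exact h2.comp (Λ.continuous.add continuous_const)
    obtain ⟨c, hc, hcc⟩ := key Λ b {p | (0 < p.1 ∧ p.1 < 1) ∧ 0 < (Λ p + b) 0} hΛ
      (((isOpen_lt continuous_const continuous_fst).inter
        (isOpen_lt continuous_fst continuous_const)).inter (isOpen_lt continuous_const hcont))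
      ⟨⟨ht0, ht1⟩, by rw [hb]; exact one_pos⟩
      (fun p hp => by
        obtain ⟨⟨hp1, hp2⟩, hp3⟩ := hp
        exact iff_of_true ⟨hp1.le, hp2.le⟩ hp3.le)
    refine ⟨c, hc, ?_, fun h => absurd h ht0.ne', fun h => absurd h ht1.ne⟩
    rw [hcc]
    refine iff_of_false ?_ ?_
    · intro h
      rw [hb] at h
      exact one_ne_zero h
    · rintro (h | h)
      · exact ht0.ne' h
      · exact ht1.ne h

end LevelSystem

/-! ### Parametric transversality by counting dimensions. -/

section ParametricTransversality

variable {Y V S : Type*} [NormedAddCommGroup Y] [NormedSpace ℝ Y] [FiniteDimensional ℝ Y]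
  [NormedAddCommGroup V] [NormedSpace ℝ V] [FiniteDimensional ℝ V]
  [NormedAddCommGroup S] [NormedSpace ℝ S] [FiniteDimensional ℝ S]

theorem finrank_continuousLinearMap :
    Module.finrank ℝ (Y →L[ℝ] V) = Module.finrank ℝ Y * Module.finrank ℝ V := by
  rw [← (LinearMap.toContinuousLinearMap (𝕜 := ℝ) (E := Y) (F' := V)).finrank_eq,
    Module.finrank_linearMap]

/-- A family of maps containing all affine perturbations: the set of the parameters for which the
differential at a zero of the first and second components of `π` is degenerate in a prescribed way
has positive codimension. -/
theorem dimH_degenerate_le {O : Set Y} (hO : IsOpen O) (hOc : Convex ℝ O) {H : S → Y → V}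
    (hH : ContDiffOn ℝ 2 (fun z : S × Y => H z.1 z.2) (Set.univ ×ˢ O))
    (κ : V × (Y →L[ℝ] V) →L[ℝ] S) (q : S →L[ℝ] V × (Y →L[ℝ] V)) (hqκ : ∀ c, q (κ c) = c)
    (hadd : ∀ s c, ∀ y ∈ O, H (s + κ c) y = H s y + c.1 + c.2 y)
    (π : V →L[ℝ] Fin 2 → ℝ) (hπ : Function.Surjective π) {i j : Fin 2} (hij : i ≠ j) :
    dimH {s | ∃ y ∈ O, π (H s y) = 0 ∧
      ∃ c : ℝ, ∀ w, π (fderiv ℝ (H s) y w) j = c * π (fderiv ℝ (H s) y w) i} <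
      Module.finrank ℝ S := by
  let P := LinearMap.ker (π : V →ₗ[ℝ] Fin 2 → ℝ)
  let Q := LinearMap.ker (q : S →ₗ[ℝ] V × (Y →L[ℝ] V))
  have hP : Module.finrank ℝ P + 2 = Module.finrank ℝ V := by
    have h : _ + Module.finrank ℝ P = _ := (π : V →ₗ[ℝ] Fin 2 → ℝ).finrank_range_add_finrank_ker
    rw [LinearMap.range_eq_top.2 hπ, finrank_top] at h
    simp at h
    omega
  have hQ : Module.finrank ℝ Q + (Module.finrank ℝ V + Module.finrank ℝ Y * Module.finrank ℝ V) =
      Module.finrank ℝ S := by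
    have h : _ + Module.finrank ℝ Q = _ :=
      (q : S →ₗ[ℝ] V × (Y →L[ℝ] V)).finrank_range_add_finrank_ker
    have hq : Function.Surjective (q : S →ₗ[ℝ] V × (Y →L[ℝ] V)) := fun c => ⟨κ c, hqκ c⟩
    rw [LinearMap.range_eq_top.2 hq, finrank_top, Module.finrank_prod,
      finrank_continuousLinearMap] at h
    omega
  choose e he using hπ
  let ei : V := e (Pi.single i 1)
  let ej : V := e (Pi.single j 1)
  let pr : V →L[ℝ] V := ContinuousLinearMap.id ℝ V -
    ((ContinuousLinearMap.proj i).comp π).smulRight ei -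
    ((ContinuousLinearMap.proj j).comp π).smulRight ej
  have hpr : ∀ v, pr v = v - π v i • ei - π v j • ej := fun v => rfl
  have hprP : ∀ v, pr v ∈ P := by
    intro v
    change π (pr v) = 0
    rw [hpr, map_sub, map_sub, map_smul, map_smul, he, he]
    ext l
    have hl : l = i ∨ l = j := by omega
    rcases hl with rfl | rfl
    · simp [hij]
    · simp [hij.symm]
  let prP : V →L[ℝ] P := pr.codRestrict P hprP
  -- The data of a degenerate zero: the point, the ratio `c`, the value in `P`, the derivative
  -- through its `P`-part and its `i`-th normal component, and the part of the parameter in `ker q`.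
  let X := Y × ℝ × P × ((Y →L[ℝ] P) × (Y →L[ℝ] ℝ)) × Q
  let B : X → (Y →L[ℝ] V) := fun z =>
    P.subtypeL.comp z.2.2.2.1.1 + z.2.2.2.1.2.smulRight (ei + z.2.1 • ej) -
      fderiv ℝ (H z.2.2.2.2) z.1
  -- The remaining, affine part of the parameter is forced by the prescribed value and derivative at
  -- the point.
  let Θ : X → S := fun z =>
    (z.2.2.2.2 : S) + κ ((z.2.2.1 : V) - H z.2.2.2.2 z.1 - B z z.1, B z)
  let dom : Set X := O ×ˢ Set.univ
  have hpart : ∀ s, ∀ y ∈ O, fderiv ℝ (H s) y =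
      (fderiv ℝ (fun z : S × Y => H z.1 z.2) (s, y)).comp (ContinuousLinearMap.inr ℝ S Y) := by
    intro s y hy
    have h1 := ((hH.contDiffAt ((isOpen_univ.prod hO).mem_nhds (⟨trivial, hy⟩ :
      (s, y) ∈ Set.univ ×ˢ O))).differentiableAt (by simp)).hasFDerivAt
    exact (h1.comp y (hasFDerivAt_prodMk_right s y)).fderiv
  have hmap : Set.MapsTo (fun z : X => ((z.2.2.2.2 : S), z.1)) dom (Set.univ ×ˢ O) :=
    fun z hz => ⟨trivial, hz.1⟩
  have hsmap : ContDiff ℝ 1 fun z : X => ((z.2.2.2.2 : S), z.1) := by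
    refine ContDiff.prodMk ?_ contDiff_fst
    exact Q.subtypeL.contDiff.comp (contDiff_snd.comp (contDiff_snd.comp
      (contDiff_snd.comp contDiff_snd)))
  have hHX : ContDiffOn ℝ 1 (fun z : X => H z.2.2.2.2 z.1) dom :=
    (hH.of_le (by norm_num)).comp hsmap.contDiffOn hmap
  have hDX : ContDiffOn ℝ 1 (fun z : X => fderiv ℝ (H z.2.2.2.2) z.1) dom := by
    have h1 : ContDiffOn ℝ 1 (fderiv ℝ fun z : S × Y => H z.1 z.2) (Set.univ ×ˢ O) :=
      hH.fderiv_of_isOpen (isOpen_univ.prod hO) (by norm_num)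
    have h2 := (h1.comp hsmap.contDiffOn hmap).clm_comp
      (contDiffOn_const (c := ContinuousLinearMap.inr ℝ S Y))
    exact h2.congr fun z hz => hpart _ _ hz.1
  have hB : ContDiffOn ℝ 1 B dom := by
    refine ContDiffOn.sub (ContDiff.contDiffOn ?_) hDX
    refine ContDiff.add ?_ ?_
    · exact contDiff_const.clm_comp (contDiff_fst.comp (contDiff_fst.comp (contDiff_snd.comp
        (contDiff_snd.comp contDiff_snd))))
    · have h1 : ContDiff ℝ 1 fun z : X => z.2.2.2.1.2 := contDiff_snd.comp (contDiff_fst.comp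
        (contDiff_snd.comp (contDiff_snd.comp contDiff_snd)))
      have h2 : ContDiff ℝ 1 fun z : X => ei + z.2.1 • ej :=
        contDiff_const.add ((contDiff_fst.comp contDiff_snd).smul contDiff_const)
      exact h1.smulRight h2
  have hΘ : ContDiffOn ℝ 1 Θ dom := by
    refine ContDiffOn.add (ContDiff.contDiffOn (contDiff_fst.comp hsmap)) ?_
    refine κ.contDiff.comp_contDiffOn (ContDiffOn.prodMk ?_ hB)
    refine ContDiffOn.sub (ContDiffOn.sub (ContDiff.contDiffOn ?_) hHX)
      (hB.clm_apply contDiffOn_fst)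
    exact P.subtypeL.contDiff.comp (contDiff_fst.comp (contDiff_snd.comp contDiff_snd))
  have hdom : Convex ℝ dom := hOc.prod convex_univ
  have hsub : {s | ∃ y ∈ O, π (H s y) = 0 ∧
      ∃ c : ℝ, ∀ w, π (fderiv ℝ (H s) y w) j = c * π (fderiv ℝ (H s) y w) i} ⊆ Θ '' dom := by
    rintro s ⟨y, hy, h0, c, hc⟩
    let s' : Q := ⟨s - κ (q s), by
      change q (s - κ (q s)) = 0
      rw [map_sub, hqκ, sub_self]⟩
    have hs' : (s' : S) + κ (q s) = s := sub_add_cancel _ _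
    have hval : ∀ y ∈ O, H s y = H s' y + (q s).1 + (q s).2 y := by
      intro y hy
      rw [← hadd _ _ _ hy, hs']
    have hder : fderiv ℝ (H s) y = fderiv ℝ (H s') y + (q s).2 := by
      have h1 : H s =ᶠ[𝓝 y] fun y => H s' y + (q s).1 + (q s).2 y := by
        filter_upwards [hO.mem_nhds hy] with x hx using hval x hx
      have h2 : HasFDerivAt (H s') (fderiv ℝ (H s') y) y := by
        have h1 := (hH.contDiffAt ((isOpen_univ.prod hO).mem_nhds (⟨trivial, hy⟩ :
          ((s' : S), y) ∈ Set.univ ×ˢ O))).differentiableAt (by simp)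
        exact (h1.comp y (hasFDerivAt_prodMk_right (s' : S) y).differentiableAt).hasFDerivAt
      exact (((h2.add_const _).add (q s).2.hasFDerivAt).congr_of_eventuallyEq h1).fderiv
    let A := fderiv ℝ (H s) y
    let z : X := (y, c, ⟨H s y, h0⟩, (prP.comp A, ((ContinuousLinearMap.proj i).comp π).comp A), s')
    have hBz : B z = (q s).2 := by
      have h1 : P.subtypeL.comp (prP.comp A) +
          (((ContinuousLinearMap.proj i).comp π).comp A).smulRight (ei + c • ej) = A := by
        ext w
        change pr (A w) + π (A w) i • (ei + c • ej) = A w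
        rw [hpr, hc w, smul_add, smul_smul, mul_comm c]
        abel
      change P.subtypeL.comp (prP.comp A) +
          (((ContinuousLinearMap.proj i).comp π).comp A).smulRight (ei + c • ej) -
          fderiv ℝ (H s') y = _
      rw [h1]
      change fderiv ℝ (H s) y - _ = _
      rw [hder]
      abel
    refine ⟨z, ⟨hy, trivial⟩, ?_⟩
    change (s' : S) + κ (H s y - H s' y - B z y, B z) = s
    have h2 : H s y - H s' y - (q s).2 y = (q s).1 := by
      rw [hval y hy]
      abel
    rw [hBz, h2]
    exact hs'
  calc dimH _ ≤ dimH (Θ '' dom) := dimH_mono hsub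
    _ ≤ dimH dom := hΘ.dimH_image_le hdom subset_rfl
    _ ≤ dimH (Set.univ : Set X) := dimH_mono (Set.subset_univ _)
    _ = Module.finrank ℝ X := Real.dimH_univ_eq_finrank X
    -- Compared with `S`, the value loses `2` and the derivative loses `dim Y`, while the point and
    -- the ratio contribute `dim Y + 1`: the codimension is one.
    _ < Module.finrank ℝ S := by
      have h1 : Module.finrank ℝ X = Module.finrank ℝ Y + (1 + (Module.finrank ℝ P +
          ((Module.finrank ℝ Y * Module.finrank ℝ P + Module.finrank ℝ Y * 1) +
            Module.finrank ℝ Q))) := by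
        simp only [X, Module.finrank_prod, finrank_continuousLinearMap, Module.finrank_self]
      have h2 : Module.finrank ℝ Y * Module.finrank ℝ V =
          Module.finrank ℝ Y * Module.finrank ℝ P + Module.finrank ℝ Y * 2 := by
        rw [← hP, mul_add]
      have h3 : Module.finrank ℝ X < Module.finrank ℝ S := by
        rw [h1]
        omega
      exact_mod_cast h3

/-- The range lies in a line of `ℝ²`, and a line is a graph over one of the two axes. -/
theorem exists_mul_eq_of_not_surjective {Y : Type*} [NormedAddCommGroup Y] [NormedSpace ℝ Y]
    {A : Y →L[ℝ] Fin 2 → ℝ} (hA : ¬ Function.Surjective A) :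
    (∃ c : ℝ, ∀ w, A w 1 = c * A w 0) ∨ ∃ c : ℝ, ∀ w, A w 0 = c * A w 1 := by
  have h1 : LinearMap.range (A : Y →ₗ[ℝ] Fin 2 → ℝ) ≠ ⊤ := by
    intro h
    exact hA (LinearMap.range_eq_top.1 h)
  obtain ⟨l, hl, hle⟩ := Submodule.exists_le_ker_of_lt_top _ (lt_top_iff_ne_top.2 h1)
  have h2 : ∀ y : Fin 2 → ℝ, l y = y 0 * l (Pi.single 0 1) + y 1 * l (Pi.single 1 1) := by
    intro y
    have h3 : y = y 0 • Pi.single 0 1 + y 1 • Pi.single 1 1 := by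
      ext i; fin_cases i <;> simp
    conv_lhs => rw [h3]
    rw [map_add, map_smul, map_smul, smul_eq_mul, smul_eq_mul]
  have h3 : ∀ w, A w 0 * l (Pi.single 0 1) + A w 1 * l (Pi.single 1 1) = 0 := by
    intro w
    rw [← h2]
    exact hle ⟨w, rfl⟩
  by_cases h4 : l (Pi.single 1 1) = 0
  · right
    have h5 : l (Pi.single 0 1) ≠ 0 := by
      intro h5
      apply hl
      ext i
      fin_cases i
      · simpa using h5
      · simpa using h4
    refine ⟨0, fun w => ?_⟩
    have := h3 w
    rw [h4, mul_zero, add_zero] at this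
    rw [zero_mul]
    exact (mul_eq_zero.1 this).resolve_right h5
  · left
    refine ⟨-(l (Pi.single 0 1)) / l (Pi.single 1 1), fun w => ?_⟩
    have := h3 w
    field_simp
    linarith

theorem dimH_nonregular_lt {O : Set Y} (hO : IsOpen O) (hOc : Convex ℝ O) {H : S → Y → V}
    (hH : ContDiffOn ℝ 2 (fun z : S × Y => H z.1 z.2) (Set.univ ×ˢ O))
    (κ : V × (Y →L[ℝ] V) →L[ℝ] S) (q : S →L[ℝ] V × (Y →L[ℝ] V)) (hqκ : ∀ c, q (κ c) = c)
    (hadd : ∀ s c, ∀ y ∈ O, H (s + κ c) y = H s y + c.1 + c.2 y)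
    (π : V →L[ℝ] Fin 2 → ℝ) (hπ : Function.Surjective π) :
    dimH {s | ∃ y ∈ O, π (H s y) = 0 ∧ ¬ Function.Surjective (π.comp (fderiv ℝ (H s) y))} <
      Module.finrank ℝ S := by
  have h1 := dimH_degenerate_le hO hOc hH κ q hqκ hadd π hπ (i := 0) (j := 1) (by simp)
  have h2 := dimH_degenerate_le hO hOc hH κ q hqκ hadd π hπ (i := 1) (j := 0) (by simp)
  refine lt_of_le_of_lt (dimH_mono ?_) (lt_of_eq_of_lt (dimH_union _ _) (max_lt h1 h2))
  rintro s ⟨y, hy, h0, hs⟩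
  rcases exists_mul_eq_of_not_surjective hs with ⟨c, hc⟩ | ⟨c, hc⟩
  · exact Or.inl ⟨y, hy, h0, c, hc⟩
  · exact Or.inr ⟨y, hy, h0, c, hc⟩

end ParametricTransversality

/-! ### Symmetrisation over the group and bump functions. -/

section EquivariantPerturbation

variable {G V : Type*} [Group G] [MulAction G Sphere3]
  [NormedAddCommGroup V] [NormedSpace ℝ V]

/-- The sum of the translates of a map from the sphere to a representation. -/
noncomputable def equivariantSum [Fintype G] (ρ : Representation ℝ G V) (a : Sphere3 → V)
    (x : Sphere3) : V := ∑ g : G, ρ g (a (g⁻¹ • x))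

theorem equivariantSum_smul [Fintype G] (ρ : Representation ℝ G V) (a : Sphere3 → V) (h : G)
    (x : Sphere3) : equivariantSum ρ a (h • x) = ρ h (equivariantSum ρ a x) := by
  rw [equivariantSum, equivariantSum, map_sum]
  refine Fintype.sum_equiv (Equiv.mulLeft h⁻¹) _ _ fun g => ?_
  simp only [Equiv.coe_mulLeft, mul_inv_rev, inv_inv]
  rw [mul_smul, ← Module.End.mul_apply, ← map_mul, mul_inv_cancel_left, smul_smul]

theorem contMDiff_equivariantSum [FiniteDimensional ℝ V] [Fintype G]
    (hG : ∀ g : G, ContMDiff (𝓡 3) (𝓡 3) ∞ fun x : Sphere3 => g • x)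
    (ρ : Representation ℝ G V) {a : Sphere3 → V} (ha : ContMDiff (𝓡 3) 𝓘(ℝ, V) ∞ a) :
    ContMDiff (𝓡 3) 𝓘(ℝ, V) ∞ (equivariantSum ρ a) := by
  refine contMDiff_finsetSum fun g _ => ?_
  exact (LinearMap.toContinuousLinearMap (ρ g)).contDiff.contMDiff.comp (ha.comp (hG g⁻¹))

theorem equivariantSum_add [Fintype G] (ρ : Representation ℝ G V) (a b : Sphere3 → V)
    (x : Sphere3) :
    equivariantSum ρ (fun y => a y + b y) x = equivariantSum ρ a x + equivariantSum ρ b x := by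
  simp [equivariantSum, Finset.sum_add_distrib]

/-- Where the nontrivial translates vanish, symmetrising changes nothing. -/
theorem equivariantSum_eq [Fintype G] (ρ : Representation ℝ G V) {a : Sphere3 → V}
    {x : Sphere3} (h : ∀ g : G, g ≠ 1 → a (g • x) = 0) : equivariantSum ρ a x = a x := by
  rw [equivariantSum, Finset.sum_eq_single 1]
  · simp
  · intro g _ hg
    rw [h _ (inv_ne_one.2 hg), map_zero]
  · simp

/-- The homotopy from `f` to `f'` perturbed by `u` and `w` in the interior. -/
noncomputable def perturbedHomotopy (f f' u w : Sphere3 → V) (t : ℝ) (x : Sphere3) : V :=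
  (1 - t) • f x + t • f' x + (t * (1 - t)) • (u x + t • w x)

theorem contDiffOn_perturbedHomotopy {f f' u w : Sphere3 → V}
    (hf : ContMDiff (𝓡 3) 𝓘(ℝ, V) ∞ f) (hf' : ContMDiff (𝓡 3) 𝓘(ℝ, V) ∞ f')
    (hu : ContMDiff (𝓡 3) 𝓘(ℝ, V) ∞ u) (hw : ContMDiff (𝓡 3) 𝓘(ℝ, V) ∞ w) :
    ContDiffOn ℝ ∞ (fun p : ℝ × Euclid4 => perturbedHomotopy f f' u w p.1 (toSphere p.2))
      (Set.univ ×ˢ {0}ᶜ) := by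
  have h : ∀ {a : Sphere3 → V}, ContMDiff (𝓡 3) 𝓘(ℝ, V) ∞ a →
      ContDiffOn ℝ ∞ (fun p : ℝ × Euclid4 => a (toSphere p.2)) (Set.univ ×ˢ {0}ᶜ) := fun ha =>
    (contDiffOn_comp_toSphere ha).comp contDiffOn_snd fun p hp => hp.2
  have ht : ContDiffOn ℝ ∞ (fun p : ℝ × Euclid4 => p.1) (Set.univ ×ˢ {0}ᶜ) := contDiffOn_fst
  have h1 : ContDiffOn ℝ ∞ (fun p : ℝ × Euclid4 => 1 - p.1) (Set.univ ×ˢ {0}ᶜ) :=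
    contDiffOn_const.sub ht
  exact ((h1.smul (h hf)).add (ht.smul (h hf'))).add
    ((ht.mul h1).smul ((h hu).add (ht.smul (h hw))))

/-- By freeness and finiteness, `x₀` has a neighbourhood disjoint from its nontrivial translates,
and the bump is supported there. -/
theorem exists_bump_disjoint_translates [Finite G]
    (hG : ∀ g : G, Continuous fun x : Sphere3 => g • x)
    (hfree : ∀ (g : G) (x : Sphere3), g • x = x → g = 1) (x₀ : Sphere3) :
    ∃ φ : SmoothBumpFunction (𝓡 3) x₀, ∀ g : G, g ≠ 1 → ∀ x, φ x ≠ 0 → φ (g • x) = 0 := by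
  have h1 : ∀ g : G, g ≠ 1 → ∀ᶠ p : Sphere3 × Sphere3 in 𝓝 (x₀, x₀), g • p.1 ≠ p.2 := by
    intro g hg
    have hc : Continuous fun p : Sphere3 × Sphere3 => g • p.1 := (hG g).comp continuous_fst
    exact (isOpen_ne_fun hc continuous_snd).mem_nhds fun h => hg (hfree g x₀ h)
  have h2 : ∀ᶠ p : Sphere3 × Sphere3 in 𝓝 (x₀, x₀), ∀ g : G, g ≠ 1 → g • p.1 ≠ p.2 := by
    rw [Filter.eventually_all]
    intro g
    by_cases hg : g = 1
    · simp [hg]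
    · simpa [hg] using h1 g hg
  rw [nhds_prod_eq, Filter.eventually_prod_self_iff'] at h2
  obtain ⟨U, hU, hUd⟩ := h2
  obtain ⟨φ, -, hφ⟩ := (SmoothBumpFunction.nhds_basis_tsupport (I := 𝓡 3) x₀).mem_iff.1 hU
  refine ⟨φ, fun g hg x hx => ?_⟩
  by_contra hne
  exact hUd x (hφ (subset_tsupport _ hx)) (g • x) (hφ (subset_tsupport _ hne)) g hg rfl

end EquivariantPerturbation

/-! ### Localised affine perturbations of a homotopy. -/

section Perturbation

variable {G V : Type*} [Group G] [MulAction G Sphere3]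
  [NormedAddCommGroup V] [NormedSpace ℝ V]

/-- The inverse of the preferred chart of the sphere. -/
noncomputable def chartInv (c : Sphere3) (y : EuclideanSpace ℝ (Fin 3)) : Sphere3 :=
  (extChartAt (𝓡 3) c).symm y

theorem contDiffOn_comp_chartInv {Z : Type*} [NormedAddCommGroup Z] [NormedSpace ℝ Z]
    {a : Sphere3 → Z} (ha : ContMDiff (𝓡 3) 𝓘(ℝ, Z) ∞ a) (c : Sphere3) :
    ContDiffOn ℝ ∞ (fun y => a (chartInv c y)) (extChartAt (𝓡 3) c).target := by
  rw [← contMDiffOn_iff_contDiffOn]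
  exact ha.comp_contMDiffOn (contMDiffOn_extChartAt_symm c)

/-- The localised coordinates of the preferred chart. -/
noncomputable def bumpCoord {c : Sphere3} (φ : SmoothBumpFunction (𝓡 3) c) (x : Sphere3) :
    EuclideanSpace ℝ (Fin 3) := φ x • extChartAt (𝓡 3) c x

theorem contMDiff_bumpCoord {c : Sphere3} (φ : SmoothBumpFunction (𝓡 3) c) :
    ContMDiff (𝓡 3) 𝓘(ℝ, EuclideanSpace ℝ (Fin 3)) ∞ (bumpCoord φ) :=
  φ.contMDiff_smul contMDiffOn_extChartAt

/-- The parameters of a local affine perturbation. -/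
abbrev AffineParam (V : Type*) [NormedAddCommGroup V] [NormedSpace ℝ V] : Type _ :=
  V × (ℝ × EuclideanSpace ℝ (Fin 3) →L[ℝ] V)

variable {J : Type*} [Fintype J] {c : J → Sphere3}

/-- The constant term in `t` of the sum of the localised affine perturbations. -/
noncomputable def localTerm (φ : ∀ j, SmoothBumpFunction (𝓡 3) (c j)) (s : J → AffineParam V)
    (x : Sphere3) : V := ∑ j, (φ j x • (s j).1 + (s j).2 (0, bumpCoord (φ j) x))

/-- The linear term in `t` of the sum of the localised affine perturbations. -/
noncomputable def localTermT (φ : ∀ j, SmoothBumpFunction (𝓡 3) (c j)) (s : J → AffineParam V)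
    (x : Sphere3) : V := ∑ j, φ j x • (s j).2 (1, 0)

variable (φ : ∀ j, SmoothBumpFunction (𝓡 3) (c j))

theorem contMDiff_localTerm (s : J → AffineParam V) :
    ContMDiff (𝓡 3) 𝓘(ℝ, V) ∞ (localTerm φ s) := by
  refine contMDiff_finsetSum fun j _ => ?_
  refine ((φ j).contMDiff.smul contMDiff_const).add ?_
  exact (s j).2.contDiff.contMDiff.comp (contMDiff_const.prodMk_space (contMDiff_bumpCoord (φ j)))

theorem contMDiff_localTermT (s : J → AffineParam V) :
    ContMDiff (𝓡 3) 𝓘(ℝ, V) ∞ (localTermT φ s) :=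
  contMDiff_finsetSum fun j _ => (φ j).contMDiff.smul contMDiff_const

theorem localTerm_add_single [DecidableEq J] (s : J → AffineParam V) (j : J) (p : AffineParam V)
    (x : Sphere3) :
    localTerm φ (s + Pi.single j p) x =
      localTerm φ s x + (φ j x • p.1 + p.2 (0, bumpCoord (φ j) x)) := by
  have h : ∀ i, φ i x • ((s + Pi.single j p : J → AffineParam V) i).1 +
      ((s + Pi.single j p : J → AffineParam V) i).2 (0, bumpCoord (φ i) x) =
        (φ i x • (s i).1 + (s i).2 (0, bumpCoord (φ i) x)) +
        if i = j then (φ j x • p.1 + p.2 (0, bumpCoord (φ j) x)) else 0 := by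
    intro i
    by_cases h : i = j
    · subst h
      simp only [Pi.add_apply, Pi.single_eq_same, Prod.fst_add, Prod.snd_add, smul_add,
        add_apply, if_true]
      abel
    · simp [h]
  simp only [localTerm, h, Finset.sum_add_distrib, Finset.sum_ite_eq', Finset.mem_univ, if_true]

theorem localTermT_add_single [DecidableEq J] (s : J → AffineParam V) (j : J) (p : AffineParam V)
    (x : Sphere3) :
    localTermT φ (s + Pi.single j p) x = localTermT φ s x + φ j x • p.2 (1, 0) := by
  have h : ∀ i, φ i x • ((s + Pi.single j p : J → AffineParam V) i).2 (1, 0) =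
      φ i x • (s i).2 (1, 0) +
        if i = j then φ j x • p.2 (1, 0) else 0 := by
    intro i
    by_cases h : i = j
    · subst h
      simp only [Pi.add_apply, Pi.single_eq_same, Prod.snd_add, smul_add,
        add_apply, if_true]
    · simp [h]
  simp only [localTermT, h, Finset.sum_add_distrib, Finset.sum_ite_eq', Finset.mem_univ, if_true]

variable [Fintype G] (ρ : Representation ℝ G V) (f f' : Sphere3 → V)

/-- The perturbed homotopy, divided by `t (1 - t)`, in the chart around `c j`. -/
noncomputable def patchFamily (j : J) (s : J → AffineParam V)
    (y : ℝ × EuclideanSpace ℝ (Fin 3)) : V :=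
  y.1⁻¹ • f (chartInv (c j) y.2) + (1 - y.1)⁻¹ • f' (chartInv (c j) y.2) +
    (equivariantSum ρ (localTerm φ s) (chartInv (c j) y.2) +
      y.1 • equivariantSum ρ (localTermT φ s) (chartInv (c j) y.2))

theorem contDiffOn_patchFamily [FiniteDimensional ℝ V]
    (hG : ∀ g : G, ContMDiff (𝓡 3) (𝓡 3) ∞ fun x : Sphere3 => g • x)
    (hf : ContMDiff (𝓡 3) 𝓘(ℝ, V) ∞ f) (hf' : ContMDiff (𝓡 3) 𝓘(ℝ, V) ∞ f') (j : J) :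
    ContDiffOn ℝ ∞ (fun z : (J → AffineParam V) × (ℝ × EuclideanSpace ℝ (Fin 3)) =>
      patchFamily φ ρ f f' j z.1 z.2)
      (Set.univ ×ˢ (Set.Ioo 0 1 ×ˢ (extChartAt (𝓡 3) (c j)).target)) := by
  set D : Set ((J → AffineParam V) × (ℝ × EuclideanSpace ℝ (Fin 3))) :=
    Set.univ ×ˢ (Set.Ioo 0 1 ×ˢ (extChartAt (𝓡 3) (c j)).target) with hD
  have hx : ∀ {Z : Type _} [NormedAddCommGroup Z] [NormedSpace ℝ Z] {a : Sphere3 → Z},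
      ContMDiff (𝓡 3) 𝓘(ℝ, Z) ∞ a → ContDiffOn ℝ ∞
        (fun z : (J → AffineParam V) × (ℝ × EuclideanSpace ℝ (Fin 3)) =>
          a (chartInv (c j) z.2.2)) D := fun ha =>
    (contDiffOn_comp_chartInv ha (c j)).comp (contDiff_snd.comp contDiff_snd).contDiffOn
      fun z hz => hz.2.2
  have hxR : ∀ {a : Sphere3 → ℝ},
      ContMDiff (𝓡 3) 𝓘(ℝ, ℝ) ∞ a → ContDiffOn ℝ ∞
        (fun z : (J → AffineParam V) × (ℝ × EuclideanSpace ℝ (Fin 3)) =>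
          a (chartInv (c j) z.2.2)) D := fun ha =>
    (contDiffOn_comp_chartInv ha (c j)).comp (contDiff_snd.comp contDiff_snd).contDiffOn
      fun z hz => hz.2.2
  have hxE : ∀ {a : Sphere3 → EuclideanSpace ℝ (Fin 3)},
      ContMDiff (𝓡 3) 𝓘(ℝ, EuclideanSpace ℝ (Fin 3)) ∞ a → ContDiffOn ℝ ∞
        (fun z : (J → AffineParam V) × (ℝ × EuclideanSpace ℝ (Fin 3)) =>
          a (chartInv (c j) z.2.2)) D := fun ha =>
    (contDiffOn_comp_chartInv ha (c j)).comp (contDiff_snd.comp contDiff_snd).contDiffOn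
      fun z hz => hz.2.2
  have ht : ContDiffOn ℝ ∞ (fun z : (J → AffineParam V) × (ℝ × EuclideanSpace ℝ (Fin 3)) => z.2.1)
      D := (contDiff_fst.comp contDiff_snd).contDiffOn
  have hs : ∀ i, ContDiffOn ℝ ∞
      (fun z : (J → AffineParam V) × (ℝ × EuclideanSpace ℝ (Fin 3)) => z.1 i) D := fun i =>
    ((contDiff_apply ℝ (AffineParam V) i).comp contDiff_fst).contDiffOn
  have hs1 : ∀ i, ContDiffOn ℝ ∞
      (fun z : (J → AffineParam V) × (ℝ × EuclideanSpace ℝ (Fin 3)) => (z.1 i).1) D := fun i =>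
    contDiff_fst.comp_contDiffOn (hs i)
  have hs2 : ∀ i, ContDiffOn ℝ ∞
      (fun z : (J → AffineParam V) × (ℝ × EuclideanSpace ℝ (Fin 3)) => (z.1 i).2) D := fun i =>
    contDiff_snd.comp_contDiffOn (hs i)
  have hsum : ContDiffOn ℝ ∞ (fun z : (J → AffineParam V) × (ℝ × EuclideanSpace ℝ (Fin 3)) =>
      equivariantSum ρ (localTerm φ z.1) (chartInv (c j) z.2.2)) D := by
    refine ContDiffOn.sum fun g _ => ?_
    refine (LinearMap.toContinuousLinearMap (ρ g)).contDiff.comp_contDiffOn ?_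
    refine ContDiffOn.sum fun i _ => ?_
    refine ((hxR ((φ i).contMDiff.comp (hG g⁻¹))).smul (hs1 i)).add ?_
    exact (hs2 i).clm_apply
      (contDiffOn_const.prodMk (hxE ((contMDiff_bumpCoord (φ i)).comp (hG g⁻¹))))
  have hsumT : ContDiffOn ℝ ∞ (fun z : (J → AffineParam V) × (ℝ × EuclideanSpace ℝ (Fin 3)) =>
      equivariantSum ρ (localTermT φ z.1) (chartInv (c j) z.2.2)) D := by
    refine ContDiffOn.sum fun g _ => ?_
    refine (LinearMap.toContinuousLinearMap (ρ g)).contDiff.comp_contDiffOn ?_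
    refine ContDiffOn.sum fun i _ => ?_
    exact (hxR ((φ i).contMDiff.comp (hG g⁻¹))).smul ((hs2 i).clm_apply contDiffOn_const)
  refine (((ht.inv fun z hz => hz.2.1.1.ne').smul (hx hf)).add
    (((contDiffOn_const.sub ht).inv fun z hz => ?_).smul (hx hf'))).add (hsum.add (ht.smul hsumT))
  exact sub_ne_zero.2 hz.2.1.2.ne'

/-- On the inner ball the bump is `1` and its translates vanish, so changing the `j`-th parameter
adds exactly an affine map of `(t, y)`. This is the hypothesis `hadd` of the dimension count; the
division by `t (1 - t)` in `patchFamily` is what makes it exact. -/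
theorem patchFamily_add_single [DecidableEq J]
    (hφ : ∀ j, ∀ g : G, g ≠ 1 → ∀ x, φ j x ≠ 0 → φ j (g • x) = 0) (j : J)
    (s : J → AffineParam V) (p : AffineParam V) {y : ℝ × EuclideanSpace ℝ (Fin 3)}
    (hy : y.2 ∈ Metric.ball (extChartAt (𝓡 3) (c j) (c j)) (φ j).rIn) :
    patchFamily φ ρ f f' j (s + Pi.single j p) y = patchFamily φ ρ f f' j s y + p.1 + p.2 y := by
  have hyt : y.2 ∈ (extChartAt (𝓡 3) (c j)).target :=
    (φ j).ball_subset ⟨Metric.ball_subset_ball (φ j).rIn_lt_rOut.le hy, by simp⟩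
  have hx1 : φ j (chartInv (c j) y.2) = 1 := by
    refine (φ j).one_of_dist_le ?_ ?_
    · rw [← extChartAt_source (𝓡 3)]
      exact (extChartAt (𝓡 3) (c j)).map_target hyt
    · rw [chartInv, (extChartAt (𝓡 3) (c j)).right_inv hyt]
      exact (Metric.mem_ball.1 hy).le
  have hcoord : bumpCoord (φ j) (chartInv (c j) y.2) = y.2 := by
    rw [bumpCoord, hx1, one_smul, chartInv, (extChartAt (𝓡 3) (c j)).right_inv hyt]
  have hgx : ∀ g : G, g ≠ 1 → φ j (g • chartInv (c j) y.2) = 0 := fun g hg =>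
    hφ j g hg _ (by rw [hx1]; exact one_ne_zero)
  have h1 : equivariantSum ρ (localTerm φ (s + Pi.single j p)) (chartInv (c j) y.2) =
      equivariantSum ρ (localTerm φ s) (chartInv (c j) y.2) + (p.1 + p.2 (0, y.2)) := by
    have : localTerm φ (s + Pi.single j p) = fun x =>
        localTerm φ s x + (φ j x • p.1 + p.2 (0, bumpCoord (φ j) x)) :=
      funext (localTerm_add_single φ s j p)
    rw [this, equivariantSum_add, equivariantSum_eq ρ
      (a := fun x => φ j x • p.1 + p.2 (0, bumpCoord (φ j) x)) (fun g hg => ?_), hx1, hcoord,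
      one_smul]
    simp only [bumpCoord, hgx g hg, zero_smul, zero_add]
    exact map_zero p.2
  have h2 : equivariantSum ρ (localTermT φ (s + Pi.single j p)) (chartInv (c j) y.2) =
      equivariantSum ρ (localTermT φ s) (chartInv (c j) y.2) + p.2 (1, 0) := by
    have : localTermT φ (s + Pi.single j p) = fun x => localTermT φ s x + φ j x • p.2 (1, 0) :=
      funext (localTermT_add_single φ s j p)
    rw [this, equivariantSum_add, equivariantSum_eq ρ
      (a := fun x => φ j x • p.2 (1, 0)) (fun g hg => ?_), hx1, one_smul]
    rw [hgx g hg, zero_smul]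
  have h3 : p.2 y = p.2 (0, y.2) + y.1 • p.2 (1, 0) := by
    rw [← map_smul, ← map_add]
    congr 1
    ext <;> simp
  rw [patchFamily, patchFamily, h1, h2, h3, smul_add]
  abel

end Perturbation

/-! ### Existence of a generic equivariant homotopy. -/

section GenericHomotopy

variable {G V : Type*} [Group G] [MulAction G Sphere3]
  [NormedAddCommGroup V] [NormedSpace ℝ V]

theorem patchFamily_smul {J : Type*} [Fintype J] {c : J → Sphere3}
    (φ : ∀ j, SmoothBumpFunction (𝓡 3) (c j)) [Fintype G] (ρ : Representation ℝ G V)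
    (f f' : Sphere3 → V) (j : J) (s : J → AffineParam V) {y : ℝ × EuclideanSpace ℝ (Fin 3)}
    (hy : y.1 ∈ Set.Ioo (0 : ℝ) 1) :
    perturbedHomotopy f f' (equivariantSum ρ (localTerm φ s)) (equivariantSum ρ (localTermT φ s))
      y.1 (chartInv (c j) y.2) = (y.1 * (1 - y.1)) • patchFamily φ ρ f f' j s y := by
  have h0 : y.1 ≠ 0 := hy.1.ne'
  have h1 : 1 - y.1 ≠ 0 := sub_ne_zero.2 hy.2.ne'
  rw [perturbedHomotopy, patchFamily, smul_add _ _ (_ + _), smul_add _ (_ • _) (_ • _), smul_smul,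
    smul_smul]
  congr 3
  · field_simp
  · field_simp

theorem hasFDerivAt_sphereIncl_chartInv (c : Sphere3) {y : EuclideanSpace ℝ (Fin 3)}
    (hy : y ∈ (extChartAt (𝓡 3) c).target) :
    HasFDerivAt (fun y => sphereIncl (chartInv c y))
      (fderiv ℝ (fun y => sphereIncl (chartInv c y)) y) y :=
  (((contDiffOn_comp_chartInv contMDiff_sphereIncl c).contDiffAt
    ((isOpen_extChartAt_target c).mem_nhds hy)).differentiableAt (by simp)).hasFDerivAt

theorem inner_fderiv_sphereIncl_chartInv (c : Sphere3) {y : EuclideanSpace ℝ (Fin 3)}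
    (hy : y ∈ (extChartAt (𝓡 3) c).target) (η : EuclideanSpace ℝ (Fin 3)) :
    inner ℝ (sphereIncl (chartInv c y)) (fderiv ℝ (fun y => sphereIncl (chartInv c y)) y η) =
      0 := by
  have h1 := (hasFDerivAt_sphereIncl_chartInv c hy).norm_sq
  have h2 : (fun y => ‖sphereIncl (chartInv c y)‖ ^ 2) = fun _ => (1 : ℝ) := by
    funext y
    rw [norm_sphereIncl, one_pow]
  rw [h2] at h1
  have h3 := DFunLike.congr_fun (h1.unique (hasFDerivAt_const (1 : ℝ) y)) η
  simpa using h3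

/-- Regularity of the zeros of `π ∘ F` can be checked in a chart of the sphere, up to a
nonvanishing scalar factor. -/
theorem regular_of_chart {F : ℝ → Sphere3 → V} {π : V →L[ℝ] Fin 2 → ℝ} {c : Sphere3}
    {H : ℝ × EuclideanSpace ℝ (Fin 3) → V} {a : ℝ → ℝ} {y : ℝ × EuclideanSpace ℝ (Fin 3)}
    (hF : DifferentiableAt ℝ (fun p : ℝ × Euclid4 => F p.1 (toSphere p.2))
      (y.1, sphereIncl (chartInv c y.2)))
    (hy : y.2 ∈ (extChartAt (𝓡 3) c).target) (hH : DifferentiableAt ℝ H y)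
    (ha : DifferentiableAt ℝ a y.1) (ha0 : a y.1 ≠ 0)
    (hFH : ∀ᶠ z in 𝓝 y, F z.1 (chartInv c z.2) = a z.1 • H z)
    (h0 : π (H y) = 0) (hs : Function.Surjective (π.comp (fderiv ℝ H y))) (v : Fin 2 → ℝ) :
    ∃ w : ℝ × Euclid4, inner ℝ (sphereIncl (chartInv c y.2)) w.2 = 0 ∧
      fderiv ℝ (fun p : ℝ × Euclid4 => π (F p.1 (toSphere p.2)))
        (y.1, sphereIncl (chartInv c y.2)) w = v := by
  obtain ⟨η, hη⟩ := hs ((a y.1)⁻¹ • v)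
  refine ⟨(η.1, fderiv ℝ (fun y => sphereIncl (chartInv c y)) y.2 η.2),
    inner_fderiv_sphereIncl_chartInv c hy _, ?_⟩
  have h1 : HasFDerivAt (fun z : ℝ × EuclideanSpace ℝ (Fin 3) =>
      (z.1, sphereIncl (chartInv c z.2)))
      ((ContinuousLinearMap.fst ℝ _ _).prod
        ((fderiv ℝ (fun y => sphereIncl (chartInv c y)) y.2).comp
          (ContinuousLinearMap.snd ℝ _ _))) y :=
    hasFDerivAt_fst.prodMk ((hasFDerivAt_sphereIncl_chartInv c hy).comp y hasFDerivAt_snd)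
  have hK : DifferentiableAt ℝ (fun p : ℝ × Euclid4 => π (F p.1 (toSphere p.2)))
      (y.1, sphereIncl (chartInv c y.2)) := π.differentiableAt.comp _ hF
  have h2 := HasFDerivAt.comp (f := fun z : ℝ × EuclideanSpace ℝ (Fin 3) =>
      (z.1, sphereIncl (chartInv c z.2))) y hK.hasFDerivAt h1
  -- The derivative of the factor `a` is multiplied by `π (H y) = 0` and drops out.
  have h3 : HasFDerivAt (fun z : ℝ × EuclideanSpace ℝ (Fin 3) => a z.1 • π (H z)) _ y :=
    (ha.hasFDerivAt.comp y hasFDerivAt_fst).smul (π.hasFDerivAt.comp y hH.hasFDerivAt)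
  have h4 := h2.unique (h3.congr_of_eventuallyEq (by
    filter_upwards [hFH] with z hz
    simp only [Function.comp_apply, toSphere_sphereIncl, hz, map_smul]))
  have h5 := DFunLike.congr_fun h4 η
  refine Eq.trans h5 ?_
  have hη' : π (fderiv ℝ H y η) = (a y.1)⁻¹ • v := hη
  simp [h0, hη', smul_smul, ha0]

/-- The Hausdorff dimension of a finite union is the largest one, and a set of dimension below that
of the space has dense complement. -/
theorem exists_notMem_iUnion_of_dimH_lt {S : Type*} [NormedAddCommGroup S] [NormedSpace ℝ S]
    [FiniteDimensional ℝ S] {ι : Type*} [Finite ι] (B : ι → Set S)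
    (h : ∀ i, dimH (B i) < Module.finrank ℝ S) : ∃ s, ∀ i, s ∉ B i := by
  cases isEmpty_or_nonempty ι with
  | inl _ => exact ⟨0, fun i => isEmptyElim i⟩
  | inr _ =>
    obtain ⟨i, hi⟩ := exists_eq_ciSup_of_finite (f := fun i => dimH (B i))
    have h1 : dimH (⋃ i, B i) < Module.finrank ℝ S := by
      rw [dimH_iUnion, ← hi]
      exact h i
    obtain ⟨s, hs⟩ := (dense_compl_of_dimH_lt_finrank h1).nonempty
    exact ⟨s, fun i hi => hs (Set.mem_iUnion.2 ⟨i, hi⟩)⟩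

/-- Compactness leaves finitely many charts, hence with the `k` equations finitely many bad sets of
parameters, each of positive codimension; any parameter outside them works. The ends are excluded
because the perturbation vanishes there. -/
theorem exists_generic_homotopy [FiniteDimensional ℝ V] [Fintype G]
    (hG : ∀ g : G, ContMDiff (𝓡 3) (𝓡 3) ∞ fun x : Sphere3 => g • x)
    (hfree : ∀ (g : G) (x : Sphere3), g • x = x → g = 1) (ρ : Representation ℝ G V)
    {f f' : Sphere3 → V} (hf : ContMDiff (𝓡 3) 𝓘(ℝ, V) ∞ f)
    (hf' : ContMDiff (𝓡 3) 𝓘(ℝ, V) ∞ f') {k : ℕ} (π : Fin k → V →L[ℝ] Fin 2 → ℝ)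
    (hπ : ∀ r, Function.Surjective (π r)) :
    ∃ u w : Sphere3 → V, ContMDiff (𝓡 3) 𝓘(ℝ, V) ∞ u ∧ ContMDiff (𝓡 3) 𝓘(ℝ, V) ∞ w ∧
      (∀ (g : G) x, u (g • x) = ρ g (u x)) ∧ (∀ (g : G) x, w (g • x) = ρ g (w x)) ∧
      ∀ r, ∀ t ∈ Set.Ioo (0 : ℝ) 1, ∀ x, π r (perturbedHomotopy f f' u w t x) = 0 →
        ∀ v, ∃ z : ℝ × Euclid4, inner ℝ (sphereIncl x) z.2 = 0 ∧
          fderiv ℝ (fun p : ℝ × Euclid4 => π r (perturbedHomotopy f f' u w p.1 (toSphere p.2)))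
            (t, sphereIncl x) z = v := by
  classical
  choose φ hφ using exists_bump_disjoint_translates (fun g : G => (hG g).continuous) hfree
  let U : Sphere3 → Set Sphere3 := fun c => (extChartAt (𝓡 3) c).source ∩
    extChartAt (𝓡 3) c ⁻¹' Metric.ball (extChartAt (𝓡 3) c c) (φ c).rIn
  have hU : ∀ c, U c ∈ 𝓝 c := fun c =>
    Filter.inter_mem (extChartAt_source_mem_nhds (I := 𝓡 3) c)
      ((continuousAt_extChartAt c).preimage_mem_nhds (Metric.ball_mem_nhds _ (φ c).rIn_pos))
  obtain ⟨J, hJ⟩ := CompactSpace.elim_nhds_subcover U hU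
  let c : J → Sphere3 := fun j => j
  let ψ : ∀ j : J, SmoothBumpFunction (𝓡 3) (c j) := fun j => φ j
  have hψ : ∀ j, ∀ g : G, g ≠ 1 → ∀ x, ψ j x ≠ 0 → ψ j (g • x) = 0 := fun j => hφ j
  let O : J → Set (ℝ × EuclideanSpace ℝ (Fin 3)) := fun j =>
    Set.Ioo 0 1 ×ˢ Metric.ball (extChartAt (𝓡 3) (c j) (c j)) (ψ j).rIn
  have hO : ∀ j, IsOpen (O j) := fun j => isOpen_Ioo.prod Metric.isOpen_ball
  -- Balls are used because the dimension bound for a `C¹` image is applied on a convex domain.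
  have hOc : ∀ j, Convex ℝ (O j) := fun j => (convex_Ioo _ _).prod (convex_ball _ _)
  have hOt : ∀ j, O j ⊆ Set.Ioo 0 1 ×ˢ (extChartAt (𝓡 3) (c j)).target := fun j y hy =>
    ⟨hy.1, (ψ j).ball_subset ⟨Metric.ball_subset_ball (ψ j).rIn_lt_rOut.le hy.2, by simp⟩⟩
  let H := patchFamily ψ ρ f f'
  have hH : ∀ j, ContDiffOn ℝ 2 (fun z : (J → AffineParam V) × (ℝ × EuclideanSpace ℝ (Fin 3)) =>
      H j z.1 z.2) (Set.univ ×ˢ O j) := fun j =>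
    ((contDiffOn_patchFamily ψ ρ f f' hG hf hf' j).mono
      (Set.prod_mono_right (hOt j))).of_le (WithTop.coe_le_coe.2 le_top)
  obtain ⟨s, hs⟩ := exists_notMem_iUnion_of_dimH_lt (fun i : J × Fin k =>
    {s | ∃ y ∈ O i.1, π i.2 (H i.1 s y) = 0 ∧
      ¬ Function.Surjective ((π i.2).comp (fderiv ℝ (H i.1 s) y))}) fun i =>
    dimH_nonregular_lt (hO i.1) (hOc i.1) (hH i.1)
      (ContinuousLinearMap.single ℝ (fun _ : J => AffineParam V) i.1)
      (ContinuousLinearMap.proj i.1) (fun p => by simp)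
      (fun s p y hy => patchFamily_add_single ψ ρ f f' hψ i.1 s p hy.2) (π i.2) (hπ i.2)
  refine ⟨equivariantSum ρ (localTerm ψ s), equivariantSum ρ (localTermT ψ s),
    contMDiff_equivariantSum hG ρ (contMDiff_localTerm ψ s),
    contMDiff_equivariantSum hG ρ (contMDiff_localTermT ψ s),
    equivariantSum_smul ρ _, equivariantSum_smul ρ _, fun r t ht x h0 => ?_⟩
  obtain ⟨j, hj, hx⟩ := Set.mem_iUnion₂.1 (hJ ▸ Set.mem_univ x : x ∈ ⋃ x ∈ J, U x)
  let i : J := ⟨j, hj⟩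
  let y : ℝ × EuclideanSpace ℝ (Fin 3) := (t, extChartAt (𝓡 3) j x)
  have hyO : y ∈ O i := ⟨ht, hx.2⟩
  have hyt := (hOt i hyO).2
  have hxy : chartInv (c i) y.2 = x := (extChartAt (𝓡 3) j).left_inv hx.1
  have heq : ∀ z ∈ O i, perturbedHomotopy f f' (equivariantSum ρ (localTerm ψ s))
      (equivariantSum ρ (localTermT ψ s)) z.1 (chartInv (c i) z.2) =
        (z.1 * (1 - z.1)) • H i s z := fun z hz => patchFamily_smul ψ ρ f f' i s hz.1
  have ht0 : t * (1 - t) ≠ 0 := mul_ne_zero ht.1.ne' (sub_ne_zero.2 ht.2.ne')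
  have h0' : π r (H i s y) = 0 := by
    have h1 := heq y hyO
    rw [hxy] at h1
    rw [h1, map_smul] at h0
    exact (smul_eq_zero.1 h0).resolve_left ht0
  have hsurj : Function.Surjective ((π r).comp (fderiv ℝ (H i s) y)) := by
    by_contra h
    exact hs (i, r) ⟨y, hyO, h0', h⟩
  have h2 := regular_of_chart (π := π r) (a := fun t => t * (1 - t)) (y := y) (c := c i)
    (F := perturbedHomotopy f f' (equivariantSum ρ (localTerm ψ s))
      (equivariantSum ρ (localTermT ψ s))) (H := H i s) ?_ hyt ?_ (by fun_prop) ht0 ?_ h0' hsurj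
  · rwa [hxy] at h2
  · exact ((contDiffOn_perturbedHomotopy hf hf'
      (contMDiff_equivariantSum hG ρ (contMDiff_localTerm ψ s))
      (contMDiff_equivariantSum hG ρ (contMDiff_localTermT ψ s))).contDiffAt
      ((isOpen_univ.prod isOpen_compl_singleton).mem_nhds
        (⟨trivial, sphereIncl_ne_zero _⟩ : ((y.1, sphereIncl (chartInv (c i) y.2)) : ℝ × Euclid4) ∈
          Set.univ ×ˢ {0}ᶜ))).differentiableAt (by simp)
  · have h1 := ((hH i).contDiffAt ((isOpen_univ.prod (hO i)).mem_nhds (⟨trivial, hyO⟩ :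
      (s, y) ∈ Set.univ ×ˢ O i))).differentiableAt (by simp)
    exact (h1.hasFDerivAt.comp y (hasFDerivAt_prodMk_right s y)).differentiableAt
  · filter_upwards [(hO i).mem_nhds hyO] with z hz using heq z hz

end GenericHomotopy

/-! ### Oriented equations of a subspace of codimension two. -/

section OrientedQuotient

variable {V : Type*} [NormedAddCommGroup V] [NormedSpace ℝ V] [FiniteDimensional ℝ V]

/-- The map `π` identifies the quotient of `V` by the subspace `P` with `ℝ²`, in such a way that `V`
is oriented as the sum of `P` and the quotient. -/
structure IsOrientedQuotient (oV : Orientation ℝ V (Fin (Module.finrank ℝ V)))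
    {P : Submodule ℝ V} (oP : Orientation ℝ P (Fin (Module.finrank ℝ P)))
    (π : V →L[ℝ] Fin 2 → ℝ) : Prop where
  surjective : Function.Surjective π
  eq_zero_iff : ∀ v, π v = 0 ↔ v ∈ P
  sign_eq : ∀ (h : Module.finrank ℝ V = Module.finrank ℝ P + 2)
    (p : Fin (Module.finrank ℝ P) → P), LinearIndependent ℝ p → ∀ a b : V,
      orSign oP p * orSign oV (Fin.append (fun i => (p i : V)) ![a, b] ∘ Fin.cast h) =
        SignType.sign (det2 ![π a, π b])

theorem matrix_vec_two_eq {α β : Type*} (f : α → β) (a b : α) :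
    (fun i => f (![a, b] i)) = ![f a, f b] := by
  funext i; fin_cases i <;> rfl

theorem det2_swap (a b : Fin 2 → ℝ) :
    det2 ![fun i => a (Equiv.swap 0 1 i), fun i => b (Equiv.swap 0 1 i)] = -det2 ![a, b] := by
  rw [det2_apply, det2_apply]
  simp

/-- For fixed `p`, the determinant of `V` and that of `ℝ²` are proportional as functions of `(a,
b)`, and the sign of the factor changes with `p` as `orSign oP p` does. One sign remains. -/
theorem exists_sign_quotient (oV : Orientation ℝ V (Fin (Module.finrank ℝ V)))
    {P : Submodule ℝ V} (hP : Module.finrank ℝ P + 2 = Module.finrank ℝ V)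
    (oP : Orientation ℝ P (Fin (Module.finrank ℝ P)))
    {π : V →L[ℝ] Fin 2 → ℝ} (hπ : Function.Surjective π) (hπP : ∀ v, π v = 0 ↔ v ∈ P) :
    ∃ s : SignType, s ≠ 0 ∧ ∀ (h : Module.finrank ℝ V = Module.finrank ℝ P + 2)
      (p : Fin (Module.finrank ℝ P) → P), LinearIndependent ℝ p → ∀ a b : V,
      orSign oP p * orSign oV (Fin.append (fun i => (p i : V)) ![a, b] ∘ Fin.cast h) =
        s * SignType.sign (det2 ![π a, π b]) := by
  let Ω : V [⋀^Fin (Module.finrank ℝ P + 2)]→ₗ[ℝ] ℝ :=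
    oV.someVector.domDomCongr (finCongr hP.symm)
  have hΩ : Ω ≠ 0 := by
    intro h
    apply oV.someVector_ne_zero
    ext v
    have h1 := DFunLike.congr_fun h (v ∘ Fin.cast hP)
    simpa [Ω, AlternatingMap.domDomCongr_apply, Function.comp_def] using h1
  obtain ⟨a₀, ha₀⟩ := hπ ![1, 0]
  obtain ⟨b₀, hb₀⟩ := hπ ![0, 1]
  have hδ : det2 ![π a₀, π b₀] = 1 := by
    rw [det2_apply, ha₀, hb₀]
    simp
  have hLI : ∀ p : Fin (Module.finrank ℝ P) → P, LinearIndependent ℝ p →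
      Ω (Fin.append (fun i => (p i : V)) ![a₀, b₀]) ≠ 0 := by
    intro p hp
    refine (topForm_ne_zero_iff hP.symm hΩ _).2 ?_
    refine linearIndependent_append (π : V →ₗ[ℝ] Fin 2 → ℝ) (hp.map' P.subtype P.ker_subtype)
      (fun i => (hπP _).2 (p i).2) ?_
    refine (topForm_ne_zero_iff (by simp) (φ := det2) ?_ _).1 ?_
    · intro h
      rw [h] at hδ
      simp at hδ
    · have h1 := matrix_vec_two_eq (π : V →ₗ[ℝ] Fin 2 → ℝ) a₀ b₀
      rw [h1]
      exact hδ.symm ▸ one_ne_zero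
  have hψ : (Ω.fixRight ![a₀, b₀]).compLinearMap P.subtype ≠ 0 := by
    intro h
    exact hLI _ (Module.finBasis ℝ P).linearIndependent
      (DFunLike.congr_fun h fun i => Module.finBasis ℝ P i)
  obtain ⟨s, hs, hsψ⟩ := exists_orSign_eq rfl oP hψ
  refine ⟨s, hs, fun h p hp a b => ?_⟩
  have h1 : orSign oV (Fin.append (fun i => (p i : V)) ![a, b] ∘ Fin.cast h) =
      SignType.sign (Ω (Fin.append (fun i => (p i : V)) ![a, b])) := rfl
  have h2 := topForm_append_mul hP.symm (by simp) Ω det2 (π : V →ₗ[ℝ] Fin 2 → ℝ) hπ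
    (v := fun i => (p i : V)) (fun i => (hπP _).2 (p i).2) ![a, b] ![a₀, b₀]
  rw [matrix_vec_two_eq, matrix_vec_two_eq] at h2
  have h3 : Ω (Fin.append (fun i => (p i : V)) ![a, b]) =
      Ω (Fin.append (fun i => (p i : V)) ![a₀, b₀]) * det2 ![π a, π b] := by
    rw [← mul_one (Ω (Fin.append _ ![a, b])), ← hδ]
    exact h2
  have h4 : orSign oP p =
      s * SignType.sign (Ω (Fin.append (fun i => (p i : V)) ![a₀, b₀])) := hsψ p
  have h5 : SignType.sign (Ω (Fin.append (fun i => (p i : V)) ![a₀, b₀])) ≠ 0 := by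
    rw [Ne, sign_eq_zero_iff]
    exact hLI p hp
  rw [h1, h3, h4, sign_mul, mul_assoc, ← mul_assoc (SignType.sign (Ω _)) (SignType.sign (Ω _)),
    SignType.mul_self_of_ne_zero h5, one_mul]

/-- If the remaining sign is `-1`, swapping the two coordinates of `ℝ²` corrects it. -/
theorem exists_isOrientedQuotient (oV : Orientation ℝ V (Fin (Module.finrank ℝ V)))
    {P : Submodule ℝ V} (hP : Module.finrank ℝ P + 2 = Module.finrank ℝ V)
    (oP : Orientation ℝ P (Fin (Module.finrank ℝ P))) :
    ∃ π : V →L[ℝ] Fin 2 → ℝ, IsOrientedQuotient oV oP π := by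
  have h1 : Module.finrank ℝ (V ⧸ P) = Module.finrank ℝ (Fin 2 → ℝ) := by
    have := P.finrank_quotient_add_finrank
    simp
    omega
  let E := LinearEquiv.ofFinrankEq _ _ h1
  let π : V →L[ℝ] Fin 2 → ℝ := LinearMap.toContinuousLinearMap (E.toLinearMap ∘ₗ P.mkQ)
  have hπ : Function.Surjective π := E.surjective.comp P.mkQ_surjective
  have hπP : ∀ v, π v = 0 ↔ v ∈ P := by
    intro v
    change E (P.mkQ v) = 0 ↔ _
    simp
  obtain ⟨s, hs, h⟩ := exists_sign_quotient oV hP oP hπ hπP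
  have hs' : s = 1 ∨ s = -1 := by
    clear h
    revert s
    decide
  rcases hs' with rfl | rfl
  · exact ⟨π, hπ, hπP, by simpa using h⟩
  · let σ : (Fin 2 → ℝ) →L[ℝ] Fin 2 → ℝ :=
      ContinuousLinearMap.pi fun i => ContinuousLinearMap.proj (Equiv.swap 0 1 i)
    have hσ : ∀ x i, σ x i = x (Equiv.swap 0 1 i) := fun _ _ => rfl
    refine ⟨σ.comp π, ?_, fun v => ?_, fun h' p hp a b => ?_⟩
    · refine Function.Surjective.comp (g := σ) (fun y => ⟨σ y, ?_⟩) hπ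
      funext i
      simp [hσ]
    · rw [← hπP, ContinuousLinearMap.comp_apply]
      constructor
      · intro h0
        funext i
        have := congrFun h0 (Equiv.swap 0 1 i)
        rw [hσ] at this
        simpa using this
      · intro h0
        rw [h0, map_zero]
    · rw [h h' p hp a b]
      have h2 : det2 ![σ (π a), σ (π b)] = -det2 ![π a, π b] := det2_swap (π a) (π b)
      rw [ContinuousLinearMap.comp_apply, ContinuousLinearMap.comp_apply, h2, Left.sign_neg,
        neg_one_mul]

/-- `π' ∘ ρ g` vanishes on `P`, so it factors through `π`. Since `ρ g` preserves the orientations of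
`V` and of the maximal elements, it preserves those of the quotients. -/
theorem exists_det_pos_of_isOrientedQuotient {G : Type*} [Group G] {ρ : Representation ℝ G V}
    {oV : Orientation ℝ V (Fin (Module.finrank ℝ V))} (hoV : PreservesOrientation ρ oV)
    {A : Set (Submodule ℝ V)}
    {oA : ∀ P : Submodule ℝ V, Orientation ℝ P (Fin (Module.finrank ℝ P))}
    (hoA : CompatibleOrientations ρ A oA) {P : Submodule ℝ V} (hP : Maximal (· ∈ A) P)
    (hPV : Module.finrank ℝ P + 2 = Module.finrank ℝ V)
    {π π' : V →L[ℝ] Fin 2 → ℝ} (hπ : IsOrientedQuotient oV (oA P) π) (g : G)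
    (hπ' : IsOrientedQuotient oV (oA (P.map (ρ g))) π') :
    ∃ C : (Fin 2 → ℝ) →L[ℝ] Fin 2 → ℝ,
      0 < LinearMap.det (C : (Fin 2 → ℝ) →ₗ[ℝ] Fin 2 → ℝ) ∧ ∀ v, π' (ρ g v) = C (π v) := by
  obtain ⟨σ, hσ⟩ := (π : V →ₗ[ℝ] Fin 2 → ℝ).exists_rightInverse_of_surjective
    (LinearMap.range_eq_top.2 hπ.surjective)
  have hσ' : ∀ y, π (σ y) = y := fun y => LinearMap.congr_fun hσ y
  let C : (Fin 2 → ℝ) →L[ℝ] Fin 2 → ℝ :=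
    LinearMap.toContinuousLinearMap ((π' : V →ₗ[ℝ] Fin 2 → ℝ) ∘ₗ ρ g ∘ₗ σ)
  have hC : ∀ v, π' (ρ g v) = C (π v) := by
    intro v
    change _ = π' (ρ g (σ (π v)))
    rw [← sub_eq_zero, ← map_sub, ← map_sub, hπ'.eq_zero_iff]
    refine Submodule.mem_map_of_mem ((hπ.eq_zero_iff _).1 ?_)
    rw [map_sub, hσ', sub_self]
  refine ⟨C, ?_, hC⟩
  have hinj : Function.Injective (ρ g) := (ρ.apply_bijective g).1
  have hfr : Module.finrank ℝ (P.map (ρ g)) = Module.finrank ℝ P :=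
    (LinearEquiv.finrank_eq (Submodule.equivMapOfInjective (ρ g) hinj P)).symm
  let p := Module.finBasis ℝ P
  obtain ⟨a, ha⟩ := hπ.surjective ![1, 0]
  obtain ⟨b, hb⟩ := hπ.surjective ![0, 1]
  let q : Fin (Module.finrank ℝ (P.map (ρ g))) → P.map (ρ g) := fun i =>
    ⟨ρ g (p (Fin.cast hfr i)), Submodule.mem_map_of_mem (p (Fin.cast hfr i)).2⟩
  have hq : LinearIndependent ℝ q := by
    refine LinearIndependent.of_comp (P.map (ρ g)).subtype ?_
    refine LinearIndependent.map' (v := fun i => ((p (Fin.cast hfr i) : P) : V)) ?_ (ρ g)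
      (LinearMap.ker_eq_bot.2 hinj)
    exact (p.linearIndependent.map' P.subtype P.ker_subtype).comp _ (Fin.cast_injective hfr)
  have h1 := hπ.sign_eq hPV.symm p p.linearIndependent a b
  have h2 := hπ'.sign_eq (by rw [hfr, hPV]) q hq (ρ g a) (ρ g b)
  have h3 : Fin.append (fun i => (q i : V)) ![ρ g a, ρ g b] ∘ Fin.cast (by rw [hfr, hPV]) =
      fun i => ρ g ((Fin.append (fun i => (p i : V)) ![a, b] ∘ Fin.cast hPV.symm) i) := by
    -- The dimensions are generalised so that the equalities behind the casts can be substituted.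
    have key : ∀ (m m' n : ℕ) (h : m' = m) (h' : n = m + 2) (h'' : n = m' + 2) (p : Fin m → V),
        Fin.append (fun i => ρ g (p (Fin.cast h i))) ![ρ g a, ρ g b] ∘ Fin.cast h'' =
          fun i => ρ g ((Fin.append p ![a, b] ∘ Fin.cast h') i) := by
      rintro m _ _ rfl rfl _ p
      funext i
      refine Fin.addCases (fun j => ?_) (fun j => ?_) i
      · simp
      · simp
        fin_cases j <;> rfl
    exact key _ _ _ hfr hPV.symm _ fun i => (p i : V)
  rw [h3, hoV g, hoA g P hP hfr p, h1, hC, hC] at h2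
  have h4 : det2 ![C (π a), C (π b)] =
      LinearMap.det (C : (Fin 2 → ℝ) →ₗ[ℝ] Fin 2 → ℝ) * det2 ![π a, π b] := by
    rw [← topForm_comp (by simp), matrix_vec_two_eq]
    rfl
  have h5 : det2 ![π a, π b] = 1 := by
    rw [det2_apply, ha, hb]
    simp
  rw [h4, h5, mul_one, sign_one] at h2
  exact sign_eq_one_iff.1 h2.symm

end OrientedQuotient

/-! ### Equations of an invariant arrangement and the use of transversality. -/

section Arrangements

variable {G V : Type*} [Group G] [NormedAddCommGroup V] [NormedSpace ℝ V]

theorem Submodule.map_rho_le_iff (ρ : Representation ℝ G V) (g : G) (P Q : Submodule ℝ V) :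
    P.map (ρ g) ≤ Q ↔ P ≤ Q.map (ρ g⁻¹) := by
  constructor
  · intro h v hv
    exact ⟨ρ g v, h ⟨v, hv, rfl⟩, by simp⟩
  · rintro h _ ⟨v, hv, rfl⟩
    obtain ⟨w, hw, rfl⟩ := h hv
    simpa using hw

/-- An element containing `g(P)` is moved by `g⁻¹` to one containing `P`. -/
theorem IsInvariantArrangement.maximal_map {ρ : Representation ℝ G V} {A : Set (Submodule ℝ V)}
    (hA : IsInvariantArrangement ρ A) (g : G) {P : Submodule ℝ V} (hP : Maximal (· ∈ A) P) :
    Maximal (· ∈ A) (P.map (ρ g)) := by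
  refine ⟨hA.map_mem g P hP.1, fun Q hQ hPQ => ?_⟩
  have h1 := hP.2 (hA.map_mem g⁻¹ Q hQ) ((Submodule.map_rho_le_iff ρ g P Q).1 hPQ)
  have h2 := (Submodule.map_rho_le_iff ρ g⁻¹ Q P).1 h1
  rwa [inv_inv] at h2

theorem IsInvariantArrangement.mem_singularSet_iff {ρ : Representation ℝ G V}
    {A : Set (Submodule ℝ V)} (hA : IsInvariantArrangement ρ A) {X : Type*} (f : X → V) (x : X) :
    x ∈ singularSet A f ↔ ∃ P, Maximal (· ∈ A) P ∧ f x ∈ P := by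
  constructor
  · rintro ⟨P, hP, hx⟩
    obtain ⟨Q, hPQ, hQ⟩ := hA.finite.exists_le_maximal hP
    exact ⟨Q, hQ, hPQ hx⟩
  · rintro ⟨P, hP, hx⟩
    exact ⟨P, hP.1, hx⟩

/-- Equations of the maximal elements of an invariant arrangement of codimension two, compatible
with the orientations. -/
structure ArrangementEquations [FiniteDimensional ℝ V] (ρ : Representation ℝ G V)
    (A : Set (Submodule ℝ V)) (oV : Orientation ℝ V (Fin (Module.finrank ℝ V)))
    (oA : ∀ P : Submodule ℝ V, Orientation ℝ P (Fin (Module.finrank ℝ P)))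
    (k : ℕ) [MulAction G (Fin k)] where
  sub : Fin k → Submodule ℝ V
  map : Fin k → V →L[ℝ] Fin 2 → ℝ
  injective_sub : Function.Injective sub
  maximal : ∀ r, Maximal (· ∈ A) (sub r)
  exists_sub_eq : ∀ P, Maximal (· ∈ A) P → ∃ r, sub r = P
  oriented : ∀ r, IsOrientedQuotient oV (oA (sub r)) (map r)
  equivariant : ∀ (g : G) r, ∃ C : (Fin 2 → ℝ) →L[ℝ] Fin 2 → ℝ,
    0 < LinearMap.det (C : (Fin 2 → ℝ) →ₗ[ℝ] Fin 2 → ℝ) ∧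
      ∀ v, map (g • r) (ρ g v) = C (map r v)

variable [FiniteDimensional ℝ V] {ρ : Representation ℝ G V}
    {A : Set (Submodule ℝ V)} {oV : Orientation ℝ V (Fin (Module.finrank ℝ V))}
    {oA : ∀ P : Submodule ℝ V, Orientation ℝ P (Fin (Module.finrank ℝ P))}

/-- The action on the maximal elements is transported to `Fin k`. The quotient maps are chosen one
by one with no equivariance required, since the comparison maps `C` absorb the choice. -/
theorem exists_arrangementEquations (hA : IsInvariantArrangement ρ A)
    (h₁ : HasCodimTwoMaximalElements A) (hoV : PreservesOrientation ρ oV)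
    (hoA : CompatibleOrientations ρ A oA) :
    ∃ (k : ℕ) (_ : MulAction G (Fin k)), Nonempty (ArrangementEquations ρ A oV oA k) := by
  let X := {P : Submodule ℝ V // Maximal (· ∈ A) P}
  have : Finite X := (hA.finite.subset fun P (hP : Maximal (· ∈ A) P) => hP.1).to_subtype
  let _ : MulAction G X :=
    { smul := fun g P => ⟨P.1.map (ρ g), hA.maximal_map g P.2⟩
      one_smul := fun P => Subtype.ext (by
        change P.1.map (ρ 1) = P.1
        rw [map_one]
        exact Submodule.map_id _)
      mul_smul := fun g h P => Subtype.ext (by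
        change P.1.map (ρ (g * h)) = (P.1.map (ρ h)).map (ρ g)
        rw [map_mul]
        exact Submodule.map_comp _ _ _) }
  let e : Fin (Nat.card X) ≃ X := (Finite.equivFin X).symm
  let _ : MulAction G (Fin (Nat.card X)) := e.mulAction G
  have he : ∀ (g : G) r, (e (g • r)).1 = (e r).1.map (ρ g) := by
    intro g r
    change (e (e.symm (g • e r))).1 = _
    rw [Equiv.apply_symm_apply]
    rfl
  choose π hπ using fun P : X =>
    exists_isOrientedQuotient oV (h₁.finrank_maximal P.1 P.2) (oA P.1)
  refine ⟨Nat.card X, inferInstance, ⟨{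
    sub := fun r => (e r).1
    map := fun r => π (e r)
    injective_sub := Subtype.val_injective.comp e.injective
    maximal := fun r => (e r).2
    exists_sub_eq := fun P hP => ⟨e.symm ⟨P, hP⟩, by simp⟩
    oriented := fun r => hπ (e r)
    equivariant := fun g r => ?_ }⟩⟩
  refine exists_det_pos_of_isOrientedQuotient hoV hoA (e r).2 (h₁.finrank_maximal _ (e r).2)
    (hπ (e r)) g ?_
  have := hπ (e (g • r))
  rwa [he g r] at this

namespace ArrangementEquations

variable {k : ℕ} [MulAction G (Fin k)] (E : ArrangementEquations ρ A oV oA k)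

theorem map_eq_zero_iff (r : Fin k) (v : V) : E.map r v = 0 ↔ v ∈ E.sub r :=
  (E.oriented r).eq_zero_iff v

theorem mem_singularSet_iff (hA : IsInvariantArrangement ρ A) {X : Type*} (f : X → V) (x : X) :
    x ∈ singularSet A f ↔ ∃ r, E.map r (f x) = 0 := by
  rw [hA.mem_singularSet_iff]
  constructor
  · rintro ⟨P, hP, hx⟩
    obtain ⟨r, rfl⟩ := E.exists_sub_eq P hP
    exact ⟨r, (E.map_eq_zero_iff r _).2 hx⟩
  · rintro ⟨r, hr⟩
    exact ⟨E.sub r, E.maximal r, (E.map_eq_zero_iff r _).1 hr⟩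

variable [MulAction G Sphere3]

/-- Transversality modulo the subspace, read in `ℝ²` through the quotient map. -/
theorem exists_map_ambientDeriv_eq {f : Sphere3 → V} (hf : IsTransverseGMap ρ A f) (r : Fin k)
    {x : Sphere3} (hx : E.map r (f x) = 0) (v : Fin 2 → ℝ) :
    ∃ u, E.map r (ambientDeriv (𝓡 3) f x u) = v := by
  obtain ⟨v, rfl⟩ := (E.oriented r).surjective v
  obtain ⟨u, p, hp, h⟩ := hf.transverse _ (E.maximal r).1 x ((E.map_eq_zero_iff r _).1 hx) v
  refine ⟨u, ?_⟩
  have h' : ambientDeriv (𝓡 3) f x u + p = v := h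
  rw [← h', map_add, (E.map_eq_zero_iff r p).2 hp, add_zero]

/-- The intersection of two distinct maximal elements belongs to `A` and has dimension at most `n -
4`. Transversality to it would make `3 + (n - 4)` dimensions fill `V`. -/
theorem eq_of_map_eq_zero (hA : IsInvariantArrangement ρ A) (h₁ : HasCodimTwoMaximalElements A)
    {f : Sphere3 → V} (hf : IsTransverseGMap ρ A f) {r r' : Fin k} {x : Sphere3}
    (hr : E.map r (f x) = 0) (hr' : E.map r' (f x) = 0) : r = r' := by
  by_contra hne
  have h1 := h₁.finrank_inf _ _ (E.maximal r) (E.maximal r') fun h => hne (E.injective_sub h)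
  have h2 := hf.transverse _ (hA.inf_mem _ (E.maximal r).1 _ (E.maximal r').1) x
    ⟨(E.map_eq_zero_iff r _).1 hr, (E.map_eq_zero_iff r' _).1 hr'⟩
  let T : EuclideanSpace ℝ (Fin 3) × (E.sub r ⊓ E.sub r' : Submodule ℝ V) →ₗ[ℝ] V :=
    (ambientDeriv (𝓡 3) f x : EuclideanSpace ℝ (Fin 3) →ₗ[ℝ] V).coprod
      (E.sub r ⊓ E.sub r').subtype
  have hT : Function.Surjective T := by
    intro v
    obtain ⟨u, p, hp, h⟩ := h2 v
    exact ⟨(u, ⟨p, hp⟩), h⟩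
  have h3 := T.finrank_le_finrank_of_surjective hT
  rw [Module.finrank_prod, finrank_euclideanSpace_fin] at h3
  omega

/-- The equations of the preimages of the maximal elements of the arrangement, for a family of
equivariant maps. -/
noncomputable def levelSystem {B : Type} [NormedAddCommGroup B] [NormedSpace ℝ B] {base : Set B}
    (hbase : IsCompact base) (F : B → Sphere3 → V)
    (hF : ContDiffOn ℝ ∞ (fun p : B × Euclid4 => F p.1 (toSphere p.2)) (Set.univ ×ˢ {0}ᶜ))
    (hFG : ∀ b (g : G) x, F b (g • x) = ρ g (F b x))
    (hreg : ∀ r, ∀ b ∈ base, ∀ x, E.map r (F b x) = 0 → ∀ v, ∃ w : B × Euclid4,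
      inner ℝ (sphereIncl x) w.2 = 0 ∧
        fderiv ℝ (fun p : B × Euclid4 => E.map r (F p.1 (toSphere p.2))) (b, sphereIncl x) w = v) :
    LevelSystem G B k where
  base := base
  isCompact_base := hbase
  eqn r b x := E.map r (F b x)
  contDiffOn r := (E.map r).contDiff.comp_contDiffOn hF
  equivariant g r := by
    obtain ⟨C, hC, h⟩ := E.equivariant g r
    exact ⟨C, hC, fun b x => by rw [hFG, h]⟩
  regular := hreg

end ArrangementEquations

end Arrangements

theorem fderiv_comp_toSphere_snd {B V W : Type*} [NormedAddCommGroup B] [NormedSpace ℝ B]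
    [NormedAddCommGroup V] [NormedSpace ℝ V] [NormedAddCommGroup W] [NormedSpace ℝ W]
    {f : Sphere3 → V}
    (hf : ContMDiff (𝓡 3) 𝓘(ℝ, V) ∞ f) (π : V →L[ℝ] W) (b : B) (x : Sphere3) (τ : B)
    (u : EuclideanSpace ℝ (Fin 3)) :
    fderiv ℝ (fun p : B × Euclid4 => π (f (toSphere p.2))) (b, sphereIncl x)
      (τ, sphereTangent x u) = π (ambientDeriv (𝓡 3) f x u) := by
  have h1 : HasFDerivAt (fun p : B × Euclid4 => π (f (toSphere p.2))) _ (b, sphereIncl x) :=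
    π.hasFDerivAt.comp _ (HasFDerivAt.comp (g := fun y => f (toSphere y)) (f := Prod.snd)
      (b, sphereIncl x) (hasFDerivAt_comp_toSphere hf (sphereIncl_ne_zero x)) hasFDerivAt_snd)
  rw [h1.fderiv, ← fderiv_comp_toSphere hf]
  rfl

namespace LevelSystem

variable {G : Type*} [Group G] [MulAction G Sphere3] {B : Type}
    [NormedAddCommGroup B] [NormedSpace ℝ B] {k : ℕ} [MulAction G (Fin k)]
    (L : LevelSystem G B k)

/-- The point of the zero set with given components. -/
def mkPoint {r : Fin k} {b : B} {x : Sphere3} (hb : b ∈ L.base) (h : L.eqn r b x = 0) :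
    L.zeroSet :=
  ⟨(r, (b, sphereIncl x)), hb, x.2, by
    change L.eqn r b (toSphere (sphereIncl x)) = 0
    rwa [toSphere_sphereIncl]⟩

theorem ext_point {z z' : L.zeroSet} (h1 : z.1.1 = z'.1.1) (h2 : z.1.2.1 = z'.1.2.1)
    (h3 : L.spherePoint z = L.spherePoint z') : z = z' :=
  Subtype.ext (Prod.ext h1 (Prod.ext h2 (congrArg sphereIncl h3)))

variable {d : ℕ} {H : Type*} [TopologicalSpace H]
  {I : ModelWithCorners ℝ (EuclideanSpace ℝ (Fin d)) H} {N : Type*} [TopologicalSpace N]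
  [ChartedSpace H N] [IsManifold I ∞ N]

theorem ambientDeriv_snd {a : N → L.zeroSet}
    (ha : ContMDiff I 𝓘(ℝ, B × Euclid4) ∞ fun x => ambientMap L.zeroSet (a x)) (x : N)
    (v : EuclideanSpace ℝ (Fin d)) :
    (ambientDeriv I (fun x => ambientMap L.zeroSet (a x)) x v).2 =
      sphereTangent (L.spherePoint (a x)) (mfderiv I (𝓡 3) (fun x => L.spherePoint (a x)) x v) := by
  have h1 := (ContinuousLinearMap.snd ℝ B Euclid4).hasFDerivAt.hasMFDerivAt.comp x
    ((ha x).mdifferentiableAt (by simp)).hasMFDerivAt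
  have h2 := ((contMDiff_sphereIncl (L.spherePoint (a x))).mdifferentiableAt
    (by simp)).hasMFDerivAt.comp x
    ((L.contMDiff_spherePoint ha x).mdifferentiableAt (by simp)).hasMFDerivAt
  exact DFunLike.congr_fun (hasMFDerivAt_unique h1 h2) v

end LevelSystem

/-! ### The oriented singular set of a transverse map. -/

section SingularSets

variable {G V : Type*} [Group G] [NormedAddCommGroup V] [NormedSpace ℝ V]
  [FiniteDimensional ℝ V] {ρ : Representation ℝ G V}
  {A : Set (Submodule ℝ V)} {oV : Orientation ℝ V (Fin (Module.finrank ℝ V))}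
  {oA : ∀ P : Submodule ℝ V, Orientation ℝ P (Fin (Module.finrank ℝ P))}
  {k : ℕ} [MulAction G (Fin k)]

namespace ArrangementEquations

theorem orSign_mul_orSign (E : ArrangementEquations ρ A oV oA k) (r : Fin k) {P : Submodule ℝ V}
    (hP : E.sub r = P) (h : Module.finrank ℝ V = Module.finrank ℝ P + 2)
    (p : Module.Basis (Fin (Module.finrank ℝ P)) ℝ P) (a b : V) :
    orSign (oA P) p * orSign oV (Fin.append (fun i => (p i : V)) ![a, b] ∘ Fin.cast h) =
      SignType.sign (det2 ![E.map r a, E.map r b]) := by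
  subst hP
  exact (E.oriented r).sign_eq h p p.linearIndependent a b

variable [MulAction G Sphere3]

/-- The equations of the singular set of a transverse map. -/
noncomputable def singularSystem (E : ArrangementEquations ρ A oV oA k) {f : Sphere3 → V}
    (hf : IsTransverseGMap ρ A f) : LevelSystem G (EuclideanSpace ℝ (Fin 0)) k :=
  -- The parameter space is the point `ℝ⁰`, so the construction that gives surfaces over an interval
  -- gives curves here.
  E.levelSystem (base := Set.univ) Set.subsingleton_univ.isCompact (fun _ => f)
    ((contDiffOn_comp_toSphere hf.smooth).comp contDiffOn_snd fun p hp => hp.2)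
    (fun _ => hf.equivariant) (fun r b _ x hx v => by
      obtain ⟨u, hu⟩ := E.exists_map_ambientDeriv_eq hf r hx v
      exact ⟨(0, sphereTangent x u), inner_sphereTangent x u,
        (fderiv_comp_toSphere_snd hf.smooth (E.map r) b x 0 u).trans hu⟩)

/-- The manifold is the zero set of `singularSystem`. Its projection to the sphere is injective
because `eq_of_map_eq_zero` recovers the index from the point. -/
theorem exists_isOrientedSingularSet (E : ArrangementEquations ρ A oV oA k)
    (hA : IsInvariantArrangement ρ A) (h₁ : HasCodimTwoMaximalElements A)
    (oS : ManifoldOrientation (𝓡 3) Sphere3) (hS : IsFreeOrientedAction G (𝓡 3) oS)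
    {f : Sphere3 → V} (hf : IsTransverseGMap ρ A f) :
    ∃ (M : OrientedGManifold G (𝓡 1)) (e : M.carrier → Sphere3),
      IsOrientedSingularSet A oS oV oA f M e := by
  obtain ⟨ε, hε, hεc, hεo⟩ := exists_sphere_sign oS
  let L := E.singularSystem hf
  have hL : ∀ z : L.zeroSet, E.map z.1.1 (f (L.spherePoint z)) = 0 := fun z => L.eqn_eq_zero z
  let Ω : (EuclideanSpace ℝ (Fin 0) × Euclid4) [⋀^Fin (1 + 3)]→ₗ[ℝ] ℝ :=
    det4.compLinearMap (LinearMap.snd ℝ _ _)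
  have hΩ : Ω ≠ 0 := by
    intro h
    apply det4_ne_zero
    ext v
    exact DFunLike.congr_fun h fun i => (0, v i)
  have hB : Module.finrank ℝ (EuclideanSpace ℝ (Fin 0)) + 1 = 1 := by simp
  choose c hc using L.exists_ambientChart_of_base_univ rfl hB
  obtain ⟨M, φ, hφ, -, hφG, hsign, -, hleft⟩ :=
    L.exists_orientedGManifold hB oS hS hε hεc hεo hΩ c hc
  let e : M.carrier → Sphere3 := fun x => L.spherePoint (φ x)
  have he : ContMDiff (𝓡 1) (𝓡 3) ∞ e := L.contMDiff_spherePoint (a := φ) hφ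
  refine ⟨M, e, he, fun x v v' h => ?_, fun x y h => ?_, fun g x => ?_, ?_, ?_⟩
  · refine Function.LeftInverse.injective (hleft x) (Prod.ext (Subsingleton.elim _ _) ?_)
    exact (L.ambientDeriv_snd hφ x v).trans ((congrArg (sphereTangent (e x)) h).trans
      (L.ambientDeriv_snd hφ x v').symm)
  · have hx := hL (φ x)
    have hy := hL (φ y)
    refine φ.injective (L.ext_point ?_ (Subsingleton.elim _ _) h)
    refine E.eq_of_map_eq_zero hA h₁ hf hx ?_
    have h' : L.spherePoint (φ x) = L.spherePoint (φ y) := h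
    rw [h']
    exact hy
  · change L.spherePoint (φ (g • x)) = _
    rw [hφG, L.spherePoint_smul]
  · ext x
    rw [E.mem_singularSet_iff hA]
    constructor
    · rintro ⟨y, rfl⟩
      exact ⟨_, hL (φ y)⟩
    · rintro ⟨r, hr⟩
      let z : L.zeroSet := L.mkPoint (r := r) (b := 0) (x := x) trivial hr
      refine ⟨φ.symm z, ?_⟩
      change L.spherePoint (φ (φ.symm z)) = x
      rw [φ.apply_symm_apply]
      rfl
  · intro P hP h x hx p t a b
    obtain ⟨r, rfl⟩ := E.exists_sub_eq P hP
    have hr : r = (φ x).1.1 :=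
      E.eq_of_map_eq_zero hA h₁ hf ((E.map_eq_zero_iff r _).2 hx) (hL (φ x))
    rw [E.orSign_mul_orSign r rfl h p]
    subst hr
    let D := ambientDeriv (𝓡 1) (fun x => ambientMap L.zeroSet (φ x)) x
    let t' : EuclideanSpace ℝ (Fin 1) := t
    let a' : EuclideanSpace ℝ (Fin 3) := a
    let b' : EuclideanSpace ℝ (Fin 3) := b
    let τ : EuclideanSpace ℝ (Fin 3) := mfderiv (𝓡 1) (𝓡 3) e x t
    have hD : (D t').2 = sphereTangent (e x) τ := L.ambientDeriv_snd hφ x t'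
    -- The tangent vector is completed by `a`, `b` and the radial vector. The latter reduces `det21`
    -- to `det2` and turns the ambient form into the determinant that computes `oS`.
    have h1 := hsign x ![t'] ![(0, sphereTangent (e x) a'), (0, sphereTangent (e x) b'),
      (0, sphereIncl (e x))]
    have h2 := hεo (e x) ![τ, a', b']
    have h3 : Ω (Fin.append (fun i => D (![t'] i)) ![(0, sphereTangent (e x) a'),
        (0, sphereTangent (e x) b'), (0, sphereIncl (e x))]) =
        det4 (Fin.append (fun i => sphereTangent (e x) (![τ, a', b'] i)) ![sphereIncl (e x)]) := by
      change det4 _ = _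
      congr 1
      funext i
      fin_cases i
      · exact hD
      all_goals rfl
    have h4 : ∀ u, L.diff (φ x) (0, sphereTangent (e x) u) =
        (E.map (φ x).1.1 (ambientDeriv (𝓡 3) f (e x) u), 0) := by
      intro u
      rw [L.diff_apply]
      exact Prod.ext (fderiv_comp_toSphere_snd hf.smooth (E.map (φ x).1.1) _ (e x) 0 u)
        (inner_sphereTangent (e x) u)
    have h5 : (L.diff (φ x) (0, sphereIncl (e x))).2 = 1 := inner_sphereIncl_self (e x)
    have h6 : (fun i => L.diff (φ x) ((![(0, sphereTangent (e x) a'), (0, sphereTangent (e x) b'),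
        (0, sphereIncl (e x))] : Fin 3 → EuclideanSpace ℝ (Fin 0) × Euclid4) i)) =
          ![(E.map (φ x).1.1 (ambientDeriv (𝓡 3) f (e x) a'), 0),
            (E.map (φ x).1.1 (ambientDeriv (𝓡 3) f (e x) b'), 0),
            L.diff (φ x) (0, sphereIncl (e x))] := by
      funext i
      fin_cases i
      · exact h4 a'
      · exact h4 b'
      · rfl
    rw [h6, det21_apply, h5, mul_one] at h1
    change orSign (oS.orientAt (e x)) ![τ, a', b'] = orSign (M.orientation.orientAt x) ![t'] *
      SignType.sign (det2 ![E.map (φ x).1.1 (ambientDeriv (𝓡 3) f (e x) a'),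
        E.map (φ x).1.1 (ambientDeriv (𝓡 3) f (e x) b')])
    -- The comparison sign `ε` now occurs twice and cancels.
    rw [h2, ← h3, h1]
    have h7 := hε (e x)
    change ε (e x) * (_ * (ε (e x) * _)) = _
    generalize ε (e x) = s1 at *
    generalize orSign (M.orientation.orientAt x) ![t'] = s2
    generalize SignType.sign (det2 _) = s3
    clear * - h7
    revert s1 s2 s3
    decide

end ArrangementEquations

end SingularSets

/-! ### The determinant on the product with a parameter line. -/

section SuspendedDeterminant

variable {B : Type*} [NormedAddCommGroup B] [NormedSpace ℝ B]

/-- The coordinates on `B × ℝ⁴` given by a linear form on `B`. -/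
noncomputable def suspendedCoord (l : B →L[ℝ] ℝ) : B × Euclid4 →ₗ[ℝ] Fin 5 → ℝ where
  toFun p := Fin.cons (l p.1) p.2
  map_add' p q := by
    ext i
    refine Fin.cases ?_ (fun j => ?_) i <;> simp
  map_smul' c p := by
    ext i
    refine Fin.cases ?_ (fun j => ?_) i <;> simp

/-- The determinant on `B × ℝ⁴` given by a linear form on `B`. -/
noncomputable def det5 (l : B →L[ℝ] ℝ) : (B × Euclid4) [⋀^Fin (2 + 3)]→ₗ[ℝ] ℝ :=
  (Matrix.detRowAlternating (n := Fin 5) (R := ℝ)).compLinearMap (suspendedCoord l)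

/-- In the column given by `l` only the entry of the first vector can be nonzero. -/
theorem det5_apply (l : B →L[ℝ] ℝ) (v : Fin (2 + 3) → B × Euclid4) (w : Fin 4 → Euclid4)
    (h : ∀ i : Fin 4, v i.succ = (0, w i)) : det5 l v = l (v 0).1 * det4 w := by
  have h0 : det5 l v = Matrix.det (Matrix.of fun i => suspendedCoord l (v i)) := by
    rw [det5, AlternatingMap.compLinearMap_apply]
    congr 1
  rw [h0, Matrix.det_succ_column_zero, Fin.sum_univ_succ, Finset.sum_eq_zero, add_zero]
  · have h1 : det4 w = Matrix.det (Matrix.of fun i j => w i j) := by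
      rw [det4, Module.Basis.det_apply, ← Matrix.det_transpose]
      rfl
    rw [h1]
    have h2 : (Matrix.of fun i => suspendedCoord l (v i)).submatrix (Fin.succAbove 0) Fin.succ =
        Matrix.of fun i j => w i j := by
      ext i j
      simp [suspendedCoord, h]
    rw [h2]
    simp [suspendedCoord]
  · intro i _
    simp [suspendedCoord, h]

theorem det5_ne_zero {l : B →L[ℝ] ℝ} {b : B} (hb : l b = 1) : det5 l ≠ 0 := by
  intro h
  apply det4_ne_zero
  ext w
  have h1 := det5_apply l (Fin.cons (b, 0) fun i => (0, w i)) w fun i => rfl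
  rw [h] at h1
  have h2 : 0 = l b * det4 w := h1
  rw [hb, one_mul] at h2
  exact h2.symm

end SuspendedDeterminant

/-- Only the slice of `K` at `t` is known, which suffices for derivatives in directions with no
parameter component. -/
theorem fderiv_slice {V W : Type*} [NormedAddCommGroup V] [NormedSpace ℝ V]
    [NormedAddCommGroup W] [NormedSpace ℝ W] {f : Sphere3 → V} (hf : ContMDiff (𝓡 3) 𝓘(ℝ, V) ∞ f)
    (π : V →L[ℝ] W) {K : ℝ × Euclid4 → W} {t : ℝ} (hK : ∀ y, K (t, y) = π (f (toSphere y)))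
    {x : Sphere3} (hd : DifferentiableAt ℝ K (t, sphereIncl x)) (u : EuclideanSpace ℝ (Fin 3)) :
    fderiv ℝ K (t, sphereIncl x) (0, sphereTangent x u) = π (ambientDeriv (𝓡 3) f x u) := by
  have h1 := hd.hasFDerivAt.comp (sphereIncl x) (hasFDerivAt_prodMk_right t (sphereIncl x))
  have h2 : HasFDerivAt (fun y => π (f (toSphere y))) _ (sphereIncl x) :=
    π.hasFDerivAt.comp _ (hasFDerivAt_comp_toSphere hf (sphereIncl_ne_zero x))
  have h3 := h1.unique (h2.congr_of_eventuallyEq (Filter.Eventually.of_forall hK))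
  rw [← fderiv_comp_toSphere hf]
  exact DFunLike.congr_fun h3 (sphereTangent x u)

/-! ### The ends of the family: slices of the zero set. -/

section Faces

variable {G V : Type*} [Group G] [NormedAddCommGroup V] [NormedSpace ℝ V]
  [FiniteDimensional ℝ V] {ρ : Representation ℝ G V}
  {A : Set (Submodule ℝ V)} {oV : Orientation ℝ V (Fin (Module.finrank ℝ V))}
  {oA : ∀ P : Submodule ℝ V, Orientation ℝ P (Fin (Module.finrank ℝ P))}
  {k : ℕ} [MulAction G (Fin k)] [MulAction G Sphere3]

namespace ArrangementEquations

variable (E : ArrangementEquations ρ A oV oA k) {f : Sphere3 → V} (L : LevelSystem G ℝ k) {t₀ : ℝ}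

theorem diff_slice (hf : IsTransverseGMap ρ A f) (hL : ∀ r x, L.eqn r t₀ x = E.map r (f x))
    {z : L.zeroSet} (hz : z.1.2.1 = t₀) (u : EuclideanSpace ℝ (Fin 3)) :
    L.diff z (0, sphereTangent (L.spherePoint z) u) =
      (E.map z.1.1 (ambientDeriv (𝓡 3) f (L.spherePoint z) u), 0) := by
  subst hz
  rw [L.diff_apply]
  have h1 := fderiv_slice hf.smooth (E.map z.1.1) (K := L.extEqn z.1.1) (t := z.1.2.1)
    (x := L.spherePoint z) (fun y => hL _ _) (L.hasFDerivAt_extEqn z).differentiableAt u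
  exact Prod.ext h1 (inner_sphereTangent _ u)

/-- Transversality of the end map is what permits boundary charts at that end. -/
theorem isRegularAt_slice (hf : IsTransverseGMap ρ A f)
    (hL : ∀ r x, L.eqn r t₀ x = E.map r (f x)) : L.IsRegularAt t₀ := by
  intro r x hx v
  obtain ⟨u, hu⟩ := E.exists_map_ambientDeriv_eq hf r ((hL r x).symm.trans hx) v
  refine ⟨sphereTangent x u, inner_sphereTangent x u, ?_⟩
  rw [← hu]
  refine fderiv_slice hf.smooth (E.map r) (fun y => hL _ _) ?_ u
  exact ((L.extEqn_contDiffOn r).contDiffAt (LevelSystem.isOpen_domain.mem_nhds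
    (⟨trivial, sphereIncl_ne_zero x⟩ : ((t₀, sphereIncl x) : ℝ × Euclid4) ∈
      Set.univ ×ˢ {0}ᶜ))).differentiableAt (by simp)

variable {oS : ManifoldOrientation (𝓡 3) Sphere3} {M : OrientedGManifold G (𝓡 1)}
  {e : M.carrier → Sphere3}

/-- The singular set of `f` as a slice of the zero set of a family of equations containing `f`. -/
theorem exists_slice (hA : IsInvariantArrangement ρ A) (h₁ : HasCodimTwoMaximalElements A)
    (hf : IsTransverseGMap ρ A f) (hM : IsOrientedSingularSet A oS oV oA f M e)
    (ht₀ : t₀ ∈ L.base) (hL : ∀ r x, L.eqn r t₀ x = E.map r (f x)) :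
    ∃ i : M.carrier → L.zeroSet, Continuous i ∧ (∀ x, (i x).1.2.1 = t₀) ∧
      (∀ x, L.spherePoint (i x) = e x) ∧ (∀ (g : G) x, i (g • x) = g • i x) ∧
      Function.Injective i ∧ ∀ z : L.zeroSet, z.1.2.1 = t₀ → z ∈ Set.range i := by
  have h1 : ∀ x, ∃ r, E.map r (f (e x)) = 0 := fun x =>
    (E.mem_singularSet_iff hA f (e x)).1 (hM.range_eq ▸ Set.mem_range_self x)
  choose r hr using h1
  have huniq : ∀ {s s' : Fin k} {x}, E.map s (f x) = 0 → E.map s' (f x) = 0 → s = s' :=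
    fun h h' => E.eq_of_map_eq_zero hA h₁ hf h h'
  -- The index is unique, so each of its fibres is the zero set of a continuous function; there
  -- being finitely many indices, `r` is continuous.
  have hcl : ∀ s, IsClosed (r ⁻¹' {s}) := by
    intro s
    have h2 : r ⁻¹' {s} = (fun x => E.map s (f (e x))) ⁻¹' {0} := by
      ext x
      constructor
      · rintro rfl
        exact hr x
      · exact fun h => huniq (hr x) h
    rw [h2]
    exact isClosed_singleton.preimage
      ((E.map s).continuous.comp (hf.smooth.continuous.comp hM.smooth.continuous))
  have hrc : Continuous r := by
    rw [continuous_iff_isClosed]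
    intro S _
    have h2 : r ⁻¹' S = ⋃ s ∈ S, r ⁻¹' {s} := by
      ext x
      simp
    rw [h2]
    exact S.toFinite.isClosed_biUnion fun s _ => hcl s
  let i : M.carrier → L.zeroSet := fun x =>
    L.mkPoint (r := r x) (x := e x) ht₀ ((hL _ _).trans (hr x))
  refine ⟨i, ?_, fun x => rfl, fun x => rfl, fun g x => ?_, fun x y h => ?_, fun z hz => ?_⟩
  · exact Continuous.subtype_mk (hrc.prodMk (continuous_const.prodMk
      (contMDiff_sphereIncl.continuous.comp hM.smooth.continuous))) _
  · refine L.ext_point ?_ rfl (hM.equivariant g x)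
    change r (g • x) = g • r x
    refine huniq (hr _) ?_
    obtain ⟨C, -, hC⟩ := E.equivariant g (r x)
    rw [hM.equivariant, hf.equivariant, hC, hr, map_zero]
  · exact hM.injective (congrArg L.spherePoint h)
  · have h2 : E.map z.1.1 (f (L.spherePoint z)) = 0 := by
      rw [← hL, ← hz]
      exact L.eqn_eq_zero z
    have h3 : L.spherePoint z ∈ Set.range e := by
      rw [hM.range_eq]
      exact (E.mem_singularSet_iff hA f _).2 ⟨_, h2⟩
    obtain ⟨x, hx⟩ := h3
    refine ⟨x, L.ext_point ?_ hz.symm hx⟩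
    rw [← hx] at h2
    exact huniq (hr x) h2

/-- The orientation of a slice of the zero set, compared with the orientation of the zero set. -/
theorem orSign_slice (hf : IsTransverseGMap ρ A f)
    (h₁ : HasCodimTwoMaximalElements A) (hM : IsOrientedSingularSet A oS oV oA f M e)
    (hL : ∀ r x, L.eqn r t₀ x = E.map r (f x))
    {ε : Sphere3 → SignType} (hε : ∀ x, ε x ≠ 0)
    (hεo : ∀ x (v : Fin 3 → EuclideanSpace ℝ (Fin 3)), orSign (oS.orientAt x) v =
        ε x * SignType.sign
          (det4 (Fin.append (fun i => sphereTangent x (v i)) ![sphereIncl x])))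
    {z : L.zeroSet} (hz : z.1.2.1 = t₀) {x : M.carrier} (hx : L.spherePoint z = e x)
    {o : Orientation ℝ (EuclideanSpace ℝ (Fin 2)) (Fin 2)}
    (D : EuclideanSpace ℝ (Fin 2) → ℝ × Euclid4)
    (hsign : ∀ v a, SignType.sign (det5 (ContinuousLinearMap.id ℝ ℝ)
      (Fin.append (fun i => D (v i)) a)) =
      orSign o v * (ε (L.spherePoint z) * SignType.sign (det21 fun i => L.diff z (a i))))
    (w y : EuclideanSpace ℝ (Fin 2)) (t : EuclideanSpace ℝ (Fin 1))
    (hy : D y = (0, sphereTangent (e x) (mfderiv (𝓡 1) (𝓡 3) e x t))) :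
    orSign o ![w, y] = SignType.sign (D w).1 * orSign (M.orientation.orientAt x) ![t] := by
  have hzero : E.map z.1.1 (f (L.spherePoint z)) = 0 := by
    rw [← hL, ← hz]
    exact L.eqn_eq_zero z
  have hdiff := E.diff_slice L hf hL hz
  -- `a` and `b` go to the standard basis of `ℝ²`, so the determinants on the target become `1` and
  -- only frames in the source are compared.
  obtain ⟨a, ha⟩ := E.exists_map_ambientDeriv_eq hf z.1.1 hzero ![1, 0]
  obtain ⟨b, hb⟩ := E.exists_map_ambientDeriv_eq hf z.1.1 hzero ![0, 1]
  let τ : EuclideanSpace ℝ (Fin 3) := mfderiv (𝓡 1) (𝓡 3) e x t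
  have h1 := hsign ![w, y] ![(0, sphereTangent (L.spherePoint z) a),
    (0, sphereTangent (L.spherePoint z) b), (0, sphereIncl (L.spherePoint z))]
  -- In the frame formed by `w`, `y`, `a`, `b` and the radial vector, only `w` can have a parameter
  -- component, and its sign relates the two orientations.
  rw [det5_apply _ _ (Fin.append (fun i => sphereTangent (e x) (![τ, a, b] i))
    ![sphereIncl (e x)]) (by
      intro i
      rw [← hx] at hy ⊢
      fin_cases i
      · exact hy
      all_goals rfl)] at h1
  replace h1 : SignType.sign ((D w).1 * _) = _ := h1
  have h5 : (L.diff z (0, sphereIncl (L.spherePoint z))).2 = 1 :=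
    inner_sphereIncl_self (L.spherePoint z)
  have h6 : (fun i => L.diff z ((![(0, sphereTangent (L.spherePoint z) a),
      (0, sphereTangent (L.spherePoint z) b),
      (0, sphereIncl (L.spherePoint z))] : Fin 3 → ℝ × Euclid4) i)) =
        ![(![1, 0], 0), (![0, 1], 0), L.diff z (0, sphereIncl (L.spherePoint z))] := by
    funext i
    fin_cases i
    · exact (hdiff a).trans (congrArg (fun q => (q, (0 : ℝ))) ha)
    · exact (hdiff b).trans (congrArg (fun q => (q, (0 : ℝ))) hb)
    · rfl
  rw [h6, det21_apply, h5, det2_apply, sign_mul] at h1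
  have h7 : orSign (oS.orientAt (e x)) ![τ, a, b] = orSign (M.orientation.orientAt x) ![t] *
      (orSign (oA (E.sub z.1.1)) (Module.finBasis ℝ (E.sub z.1.1)) *
        orSign oV (Fin.append (fun i => (Module.finBasis ℝ (E.sub z.1.1) i : V))
          ![ambientDeriv (𝓡 3) f (e x) a, ambientDeriv (𝓡 3) f (e x) b] ∘
            Fin.cast (h₁.finrank_maximal _ (E.maximal z.1.1)).symm)) :=
    hM.oriented _ (E.maximal z.1.1) (h₁.finrank_maximal _ (E.maximal z.1.1)).symm x
      ((E.map_eq_zero_iff _ _).1 (hx ▸ hzero)) _ t a b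
  rw [E.orSign_mul_orSign z.1.1 rfl, ← hx, ha, hb, hx, det2_apply, hεo] at h7
  have h8 := hε (e x)
  rw [hx] at h1
  simp only [Matrix.cons_val_zero, Matrix.cons_val_one, mul_one, mul_zero, sub_zero,
    sign_one] at h1 h7
  generalize SignType.sign (det4 _) = s4 at h1 h7
  generalize ε (e x) = s1 at *
  generalize orSign (M.orientation.orientAt x) ![t] = s2 at *
  generalize SignType.sign (D w).1 = s3 at *
  generalize orSign o ![w, y] = s5 at *
  clear * - h1 h7 h8
  revert s1 s2 s3 s4 s5
  decide

end ArrangementEquations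

end Faces

/-! ### The bordism between two singular sets. -/

section Bordism

variable {G V : Type*} [Group G] [NormedAddCommGroup V] [NormedSpace ℝ V]
  [FiniteDimensional ℝ V] {ρ : Representation ℝ G V}
  {A : Set (Submodule ℝ V)} {oV : Orientation ℝ V (Fin (Module.finrank ℝ V))}
  {oA : ∀ P : Submodule ℝ V, Orientation ℝ P (Fin (Module.finrank ℝ P))}
  {k : ℕ} [MulAction G (Fin k)] [MulAction G Sphere3]

namespace ArrangementEquations

/-- A regular family of equations interpolating between `f` and `f'`. -/
theorem exists_interpolating_levelSystem [Fintype G] (E : ArrangementEquations ρ A oV oA k)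
    (hG : ∀ g : G, ContMDiff (𝓡 3) (𝓡 3) ∞ fun x : Sphere3 => g • x)
    (hfree : ∀ (g : G) (x : Sphere3), g • x = x → g = 1)
    {f f' : Sphere3 → V} (hf : IsTransverseGMap ρ A f) (hf' : IsTransverseGMap ρ A f') :
    ∃ L : LevelSystem G ℝ k, L.base = Set.Icc 0 1 ∧ (∀ r x, L.eqn r 0 x = E.map r (f x)) ∧
      ∀ r x, L.eqn r 1 x = E.map r (f' x) := by
  obtain ⟨u, w, hu, hw, huG, hwG, hreg⟩ := exists_generic_homotopy hG hfree ρ hf.smooth hf'.smooth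
    E.map fun r => (E.oriented r).surjective
  let F := perturbedHomotopy f f' u w
  have hF := contDiffOn_perturbedHomotopy hf.smooth hf'.smooth hu hw
  have hF0 : ∀ x, F 0 x = f x := fun x => by simp [F, perturbedHomotopy]
  have hF1 : ∀ x, F 1 x = f' x := fun x => by simp [F, perturbedHomotopy]
  have hdiff : ∀ r t x, DifferentiableAt ℝ (fun p : ℝ × Euclid4 => E.map r (F p.1 (toSphere p.2)))
      (t, sphereIncl x) := fun r t x => (E.map r).differentiableAt.comp _
    ((hF.contDiffAt (LevelSystem.isOpen_domain.mem_nhds (⟨trivial, sphereIncl_ne_zero x⟩ :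
      ((t, sphereIncl x) : ℝ × Euclid4) ∈ Set.univ ×ˢ {0}ᶜ))).differentiableAt (by simp))
  -- At the ends regularity comes from transversality of the end maps; genericity covers only the
  -- open interval.
  have hend : ∀ {f₀ : Sphere3 → V} {t}, IsTransverseGMap ρ A f₀ → (∀ x, F t x = f₀ x) →
      ∀ r x, E.map r (F t x) = 0 → ∀ v, ∃ z : ℝ × Euclid4, inner ℝ (sphereIncl x) z.2 = 0 ∧
        fderiv ℝ (fun p : ℝ × Euclid4 => E.map r (F p.1 (toSphere p.2))) (t, sphereIncl x) z =
          v := by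
    intro f₀ t hf₀ hFt r x hx v
    obtain ⟨y, hy⟩ := E.exists_map_ambientDeriv_eq hf₀ r (hFt x ▸ hx) v
    refine ⟨(0, sphereTangent x y), inner_sphereTangent x y, ?_⟩
    rw [← hy]
    exact fderiv_slice hf₀.smooth (E.map r) (fun q => by simp only [hFt]) (hdiff r t x) y
  refine ⟨E.levelSystem (base := Set.Icc 0 1) isCompact_Icc F hF (fun t g x => ?_)
    fun r t ht x hx v => ?_, rfl, fun r x => congrArg _ (hF0 x), fun r x => congrArg _ (hF1 x)⟩
  · simp only [F, perturbedHomotopy, hf.equivariant, hf'.equivariant, huG, hwG, map_add, map_smul]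
  · rcases ht.1.eq_or_lt with rfl | h0
    · exact hend hf hF0 r x hx v
    rcases ht.2.eq_or_lt with rfl | h1
    · exact hend hf' hF1 r x hx v
    exact hreg r t ⟨h0, h1⟩ x hx v

/-- The bordism is the zero set of the interpolating system over `[0, 1]`. Its part over an end is
the singular set of the end map, because there the index is determined by the point. -/
theorem gBordant_of_isOrientedSingularSet [Fintype G] (E : ArrangementEquations ρ A oV oA k)
    (hA : IsInvariantArrangement ρ A) (h₁ : HasCodimTwoMaximalElements A)
    {oS : ManifoldOrientation (𝓡 3) Sphere3} (hS : IsFreeOrientedAction G (𝓡 3) oS)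
    {f f' : Sphere3 → V} (hf : IsTransverseGMap ρ A f) (hf' : IsTransverseGMap ρ A f')
    {M M' : OrientedGManifold G (𝓡 1)} {e : M.carrier → Sphere3} {e' : M'.carrier → Sphere3}
    (hM : IsOrientedSingularSet A oS oV oA f M e)
    (hM' : IsOrientedSingularSet A oS oV oA f' M' e') : GBordant M M' := by
  obtain ⟨ε, hε, hεc, hεo⟩ := exists_sphere_sign oS
  obtain ⟨L, hbase, hL0, hL1⟩ := E.exists_interpolating_levelSystem hS.smooth hS.free hf hf'
  choose c hc hc01 hc0 hc1 using L.exists_ambientChart_of_base_Icc hbase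
    (E.isRegularAt_slice L hf hL0) (E.isRegularAt_slice L hf' hL1)
  obtain ⟨W, φ, hφ, hφs, hφG, hsign, hext, hleft⟩ :=
    L.exists_orientedGManifold (d := 2) (by simp) oS hS hε hεc hεo
      (det5_ne_zero (l := ContinuousLinearMap.id ℝ ℝ) (b := 1) rfl) c hc
  -- One argument for both ends: the orientations of the bordism and of its slice differ by the sign
  -- of the parameter component of `w`.
  have key : ∀ {t₀ : ℝ} {f : Sphere3 → V} {M : OrientedGManifold G (𝓡 1)}
      {e : M.carrier → Sphere3}, t₀ ∈ L.base → IsTransverseGMap ρ A f →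
      (∀ r x, L.eqn r t₀ x = E.map r (f x)) → IsOrientedSingularSet A oS oV oA f M e →
      ∃ i : M.carrier → W.carrier, ContMDiff (𝓡 1) (𝓡∂ 2) ∞ i ∧
        (∀ (g : G) x, i (g • x) = g • i x) ∧ Function.Injective i ∧
        (∀ p, p ∈ Set.range i ↔ (φ p).1.2.1 = t₀) ∧
        ∀ x (w : EuclideanSpace ℝ (Fin 2)) (t : EuclideanSpace ℝ (Fin 1)),
          orSign (W.orientation.orientAt (i x)) ![w, mfderiv (𝓡 1) (𝓡∂ 2) i x t] =
            SignType.sign (ambientDeriv (𝓡∂ 2) (fun x => ambientMap L.zeroSet (φ x)) (i x) w).1 *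
              orSign (M.orientation.orientAt x) ![t] := by
    intro t₀ f M e ht₀ hf hL hM
    obtain ⟨i, hi, hit, hie, hiG, hinj, hrange⟩ := E.exists_slice L hA h₁ hf hM ht₀ hL
    let j : M.carrier → W.carrier := fun x => φ.symm (i x)
    have hφj : ∀ x, φ (j x) = i x := fun x => φ.apply_symm_apply _
    have hjamb : (fun x => ambientMap L.zeroSet (φ (j x))) =
        fun x => (t₀, sphereIncl (e x)) := by
      funext x
      rw [hφj]
      exact Prod.ext (hit x) (congrArg sphereIncl (hie x))
    have hsm : ContMDiff (𝓡 1) 𝓘(ℝ, Euclid4) ∞ fun x => sphereIncl (e x) :=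
      contMDiff_sphereIncl.comp hM.smooth
    have hjs : ContMDiff (𝓡 1) (𝓡∂ 2) ∞ j := by
      refine hφs M j (φ.symm.continuous.comp hi) ?_
      rw [hjamb]
      exact contMDiff_const.prodMk_space hsm
    refine ⟨j, hjs, fun g x => φ.injective ?_, φ.symm.injective.comp hinj, fun p => ?_,
      fun x w t => ?_⟩
    · rw [hφG, hφj, hφj, hiG]
    · constructor
      · rintro ⟨x, rfl⟩
        rw [hφj, hit]
      · intro hp
        obtain ⟨x, hx⟩ := hrange _ hp
        exact ⟨x, φ.injective ((hφj x).trans hx)⟩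
    · refine E.orSign_slice L hf h₁ hM hL hε hεo (z := φ (j x)) (x := x)
        ((congrArg (fun z : L.zeroSet => z.1.2.1) (hφj x)).trans (hit x))
        ((congrArg L.spherePoint (hφj x)).trans (hie x))
        (fun v => ambientDeriv (𝓡∂ 2) (fun x => ambientMap L.zeroSet (φ x)) (j x) v)
        (hsign (j x)) w _ t ?_
      have h1 := ((hφ (j x)).mdifferentiableAt (by simp)).hasMFDerivAt.comp x
        ((hjs x).mdifferentiableAt (by simp)).hasMFDerivAt
      have h2 := (hasFDerivAt_prodMk_right t₀ (sphereIncl (e x))).hasMFDerivAt.comp x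
        (((contMDiff_sphereIncl (e x)).mdifferentiableAt (by simp)).hasMFDerivAt.comp x
          ((hM.smooth x).mdifferentiableAt (by simp)).hasMFDerivAt)
      have h3 : (fun x => ambientMap L.zeroSet (φ x)) ∘ j =
          (fun y : Euclid4 => (t₀, y)) ∘ sphereIncl ∘ e := hjamb
      rw [h3] at h1
      exact DFunLike.congr_fun (hasMFDerivAt_unique h1 h2) t
  obtain ⟨i, his, hiG, hinj, hirange, hio⟩ := key (hbase ▸ ⟨le_rfl, zero_le_one⟩) hf hL0 hM
  obtain ⟨j, hjs, hjG, hjinj, hjrange, hjo⟩ := key (hbase ▸ ⟨zero_le_one, le_rfl⟩) hf' hL1 hM'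
  refine ⟨W, i, j, his, hjs, hiG, hjG, hinj, hjinj, ?_, ?_, fun x w hw t => ?_, fun y w hw t => ?_⟩
  · rw [Set.disjoint_left]
    intro p hp hp'
    have := ((hirange p).1 hp).symm.trans ((hjrange p).1 hp')
    exact zero_ne_one this
  -- Boundary points are those whose first coordinate in the preferred chart is zero, and by `hc01`
  -- these lie over `t = 0` or `t = 1`.
  · ext p
    have h1 : p ∈ (𝓡∂ 2).boundary W.carrier ↔
        extChartAt (𝓡∂ 2) p p ∈ frontier (Set.range (𝓡∂ 2)) := Iff.rfl
    rw [h1, frontier_range_modelWithCornersEuclideanHalfSpace, Set.mem_union, hirange, hjrange,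
      ← hc01, hext]
    exact eq_comm
  -- At `t = 0` the first coordinate has differential `dt`, so outward vectors have `dt < 0` and the
  -- orientation of `M` is reversed.
  · have h1 := hc0 (φ (i x)) ((hirange _).1 ⟨x, rfl⟩)
      (ambientDeriv (𝓡∂ 2) (fun x => ambientMap L.zeroSet (φ x)) (i x) w)
    have h2 := hleft (i x) w
    have h3 : w 0 = (ambientDeriv (𝓡∂ 2) (fun x => ambientMap L.zeroSet (φ x)) (i x) w).1 := by
      rw [← h1]
      exact congrArg (fun y : EuclideanSpace ℝ (Fin 2) => y 0) h2.symm
    refine (hio x w t).trans ?_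
    rw [← h3, sign_neg hw, neg_one_mul]
    rfl
  -- At `t = 1` the first coordinate has differential `-dt`, so outward vectors have `dt > 0` and
  -- the orientation of `M'` is kept.
  · have h1 := hc1 (φ (j y)) ((hjrange _).1 ⟨y, rfl⟩)
      (ambientDeriv (𝓡∂ 2) (fun x => ambientMap L.zeroSet (φ x)) (j y) w)
    have h2 := hleft (j y) w
    have h3 : w 0 = -(ambientDeriv (𝓡∂ 2) (fun x => ambientMap L.zeroSet (φ x)) (j y) w).1 := by
      rw [← h1]
      exact congrArg (fun y : EuclideanSpace ℝ (Fin 2) => y 0) h2.symm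
    refine (hjo y w t).trans ?_
    rw [sign_pos (by linarith), one_mul]
    rfl

end ArrangementEquations

end Bordism

/-! ### Smooth equivariant approximation. -/

section Approximation

variable {G V : Type*} [Group G] [MulAction G Sphere3]
  [NormedAddCommGroup V] [NormedSpace ℝ V] [FiniteDimensional ℝ V]

/-- Continuous equivariant maps from the sphere can be approximated by smooth equivariant maps. -/
theorem exists_contMDiff_equivariant_dist_lt [Fintype G]
    (hG : ∀ g : G, ContMDiff (𝓡 3) (𝓡 3) ∞ fun x : Sphere3 => g • x) (ρ : Representation ℝ G V)
    {f : Sphere3 → V} (hf : Continuous f) (hfG : ∀ (g : G) x, f (g • x) = ρ g (f x))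
    {δ : ℝ} (hδ : 0 < δ) :
    ∃ f' : Sphere3 → V, ContMDiff (𝓡 3) 𝓘(ℝ, V) ∞ f' ∧ (∀ (g : G) x, f' (g • x) = ρ g (f' x)) ∧
      ∀ x, dist (f' x) (f x) < δ := by
  -- The maps `ρ g` need not be isometries, so the bound is imposed on the error after applying
  -- every `ρ g`; averaging over `G` then preserves it.
  let t : Sphere3 → Set V := fun x => ⋂ g : G, {v | ρ g (v - f x) ∈ Metric.ball (0 : V) δ}
  have hρ : ∀ g : G, Continuous (ρ g) := fun g => (ρ g).continuous_of_finiteDimensional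
  have ht : ∀ x, Convex ℝ (t x) := by
    intro x
    refine convex_iInter fun g => ?_
    have h1 : {v | ρ g (v - f x) ∈ Metric.ball (0 : V) δ} =
        ρ g ⁻¹' Metric.ball (ρ g (f x)) δ := by
      ext v
      simp [map_sub, dist_eq_norm]
    rw [h1]
    exact (convex_ball _ _).linear_preimage (ρ g)
  have hloc : ∀ x, ∃ c, ∀ᶠ y in 𝓝 x, c ∈ t y := by
    intro x
    have h1 : ∀ g : G, ∀ᶠ y in 𝓝 x, ρ g (f x - f y) ∈ Metric.ball (0 : V) δ := by
      intro g
      have h2 : ContinuousAt (fun y => ρ g (f x - f y)) x :=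
        ((hρ g).comp (continuous_const.sub hf)).continuousAt
      refine h2.eventually_mem (Metric.isOpen_ball.mem_nhds ?_)
      simpa using hδ
    refine ⟨f x, ?_⟩
    filter_upwards [Filter.eventually_all.2 h1] with y hy using Set.mem_iInter.2 hy
  obtain ⟨a, ha⟩ := exists_contMDiffMap_forall_mem_convex_of_local_const (I := 𝓡 3) (n := ⊤) ht
    hloc
  let n : ℝ := Fintype.card G
  have hn : 0 < n := Nat.cast_pos.2 Fintype.card_pos
  refine ⟨fun x => n⁻¹ • equivariantSum ρ a x,
    (contDiff_const_smul n⁻¹).contMDiff.comp (contMDiff_equivariantSum hG ρ a.contMDiff),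
    fun g x => ?_, fun x => ?_⟩
  · simp only [equivariantSum_smul, map_smul]
  · change dist (n⁻¹ • equivariantSum ρ a x) (f x) < δ
    have h1 : n⁻¹ • equivariantSum ρ a x - f x =
        n⁻¹ • ∑ g : G, ρ g (a (g⁻¹ • x) - f (g⁻¹ • x)) := by
      have h2 : ∀ g : G, ρ g (a (g⁻¹ • x) - f (g⁻¹ • x)) = ρ g (a (g⁻¹ • x)) - f x := by
        intro g
        rw [map_sub, ← hfG, smul_inv_smul]
      simp only [h2, Finset.sum_sub_distrib, Finset.sum_const, Finset.card_univ, smul_sub]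
      rw [← Nat.cast_smul_eq_nsmul ℝ, smul_smul, inv_mul_cancel₀ hn.ne', one_smul]
      rfl
    rw [dist_eq_norm, h1, norm_smul, norm_inv, Real.norm_of_nonneg hn.le, inv_mul_lt_iff₀ hn]
    refine (norm_sum_le _ _).trans_lt ?_
    have h3 : ∀ g : G, ‖ρ g (a (g⁻¹ • x) - f (g⁻¹ • x))‖ < δ := by
      intro g
      simpa using Set.mem_iInter.1 (ha (g⁻¹ • x)) g
    refine (Finset.sum_lt_sum_of_nonempty Finset.univ_nonempty fun g _ => h3 g).trans_eq ?_
    simp [n]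

/-- The union of the arrangement is closed and the image of `f` is compact, so a close approximation
still misses it; transversality is then vacuous. -/
theorem exists_isTransverseGMap_singularSet_eq_empty [Fintype G]
    (hG : ∀ g : G, ContMDiff (𝓡 3) (𝓡 3) ∞ fun x : Sphere3 => g • x) {ρ : Representation ℝ G V}
    {A : Set (Submodule ℝ V)} (hA : A.Finite)
    {f : Sphere3 → V} (hf : Continuous f) (hfG : ∀ (g : G) x, f (g • x) = ρ g (f x))
    (h : singularSet A f = ∅) :
    ∃ f' : Sphere3 → V, IsTransverseGMap ρ A f' ∧ singularSet A f' = ∅ := by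
  let D : Set V := ⋃ P ∈ A, (P : Set V)
  have hD : IsClosed D := hA.isClosed_biUnion fun P _ => P.closed_of_finiteDimensional
  have hfD : Set.range f ⊆ Dᶜ := by
    rintro _ ⟨x, rfl⟩ hx
    obtain ⟨P, hP, hx⟩ := Set.mem_iUnion₂.1 hx
    exact Set.eq_empty_iff_forall_notMem.1 h x ⟨P, hP, hx⟩
  obtain ⟨δ, hδ, hδD⟩ := (isCompact_range hf).exists_thickening_subset_open hD.isOpen_compl hfD
  obtain ⟨f', hf', hf'G, hd⟩ := exists_contMDiff_equivariant_dist_lt hG ρ hf hfG hδ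
  have h' : ∀ P ∈ A, ∀ x, f' x ∉ P := fun P hP x hx =>
    hδD (Metric.mem_thickening_iff.2 ⟨f x, ⟨x, rfl⟩, hd x⟩) (Set.mem_iUnion₂.2 ⟨P, hP, hx⟩)
  refine ⟨f', ⟨hf', hf'G, fun P hP x hx => (h' P hP x hx).elim⟩, ?_⟩
  rw [Set.eq_empty_iff_forall_notMem]
  rintro x ⟨P, hP, hx⟩
  exact h' P hP x hx

end Approximation

/-! ### The empty singular set and the main theorem. -/

theorem isOrientedSingularSet_empty {G V : Type*} [Group G] [MulAction G Sphere3]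
    [NormedAddCommGroup V] [NormedSpace ℝ V] {A : Set (Submodule ℝ V)}
    {oS : ManifoldOrientation (𝓡 3) Sphere3}
    {oV : Orientation ℝ V (Fin (Module.finrank ℝ V))}
    {oA : ∀ P : Submodule ℝ V, Orientation ℝ P (Fin (Module.finrank ℝ P))}
    {f : Sphere3 → V} (h : singularSet A f = ∅) :
    IsOrientedSingularSet A oS oV oA f (OrientedGManifold.empty G)
      (fun x : Empty => x.elim) where
  smooth := fun x : Empty => x.elim
  immersion := fun x : Empty => x.elim
  injective := fun x : Empty => x.elim
  equivariant := fun _ (x : Empty) => x.elim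
  range_eq := by
    rw [h]
    exact Set.range_eq_empty_iff.2 (inferInstanceAs (IsEmpty Empty))
  oriented := fun _ _ _ (x : Empty) => x.elim

theorem mainTheorem3 {G V : Type*} [Group G] [Finite G] [MulAction G Sphere3]
    [NormedAddCommGroup V] [NormedSpace ℝ V] [FiniteDimensional ℝ V]
    (ρ : Representation ℝ G V) (A : Set (Submodule ℝ V))
    (oS : ManifoldOrientation (𝓡 3) Sphere3)
    (oV : Orientation ℝ V (Fin (Module.finrank ℝ V)))
    (oA : ∀ P : Submodule ℝ V, Orientation ℝ P (Fin (Module.finrank ℝ P)))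
    (hA : IsInvariantArrangement ρ A)
    (h₁ : HasCodimTwoMaximalElements A)
    (h₂S : IsFreeOrientedAction G (𝓡 3) oS)
    (h₂V : PreservesOrientation ρ oV)
    (h₃ : CompatibleOrientations ρ A oA) :
    (∀ f : Sphere3 → V, IsTransverseGMap ρ A f →
      ∃! c : Omega1 G, IsSingularClass A oS oV oA f c) ∧
    (∀ f f' : Sphere3 → V, IsTransverseGMap ρ A f → IsTransverseGMap ρ A f' →
      ∀ c c' : Omega1 G, IsSingularClass A oS oV oA f c → IsSingularClass A oS oV oA f' c' →
        c = c') ∧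
    (∀ f : Sphere3 → V, IsTransverseGMap ρ A f →
      ∀ c : Omega1 G, IsSingularClass A oS oV oA f c → c ≠ 0 →
        ∀ g : Sphere3 → V, Continuous g → (∀ (γ : G) (x : Sphere3), g (γ • x) = ρ γ (g x)) →
          (singularSet A g).Nonempty) := by
  have := Fintype.ofFinite G
  obtain ⟨k, _, ⟨E⟩⟩ := exists_arrangementEquations hA h₁ h₂V h₃
  have key : ∀ f f' : Sphere3 → V, IsTransverseGMap ρ A f → IsTransverseGMap ρ A f' →
      ∀ c c' : Omega1 G, IsSingularClass A oS oV oA f c → IsSingularClass A oS oV oA f' c' →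
        c = c' := by
    rintro f f' hf hf' _ _ ⟨M, e, hM, rfl⟩ ⟨M', e', hM', rfl⟩
    exact Quot.sound (E.gBordant_of_isOrientedSingularSet hA h₁ h₂S hf hf' hM hM')
  refine ⟨fun f hf => ?_, key, fun f hf c hc hc0 g hg hgG => ?_⟩
  · obtain ⟨M, e, hM⟩ := E.exists_isOrientedSingularSet hA h₁ oS h₂S hf
    -- Uniqueness is the case `f = f'` of invariance: any two manifolds representing `Δ(f)` are
    -- bordant.
    exact ⟨M.bordismClass, ⟨M, e, hM, rfl⟩,
      fun c hc => key f f hf hf _ _ hc ⟨M, e, hM, rfl⟩⟩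
  · by_contra hne
    obtain ⟨g', hg', hempty⟩ := exists_isTransverseGMap_singularSet_eq_empty h₂S.smooth hA.finite
      hg hgG (Set.not_nonempty_iff_eq_empty.1 hne)
    exact hc0 (key f g' hf hg' c 0 hc ⟨_, _, isOrientedSingularSet_empty hempty, rfl⟩)
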